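/- **Setting.** Let $p,q,r>0$ with $p+q+r=1$, and let $p',r',q'',r''>0$ with $p'+r'=q''+r''=1$, $\frac pr=\frac{p'}{r'}$ and $\frac qr=\frac{q''}{r''}$. Consider the Markov chain on $\{0,1,2,\dots\}^2$, started at $(0,0)$ at time $0$, with the following transitions. From $(i,j)$ with $i,j>0$ it goes to $(i-1,j)$, $(i,j-1)$, $(i+1,j+1)$ with probabilities $p,q,r$. From $(i,0)$ with $i>0$ it goes to $(i-1,0)$, $(i+1,1)$ with probabilities $p',r'$. From $(0,j)$ with $j>0$ it goes to $(0,j-1)$, $(1,j+1)$ with probabilities $q'',r''$. From $(0,0)$ it goes to $(1,1)$ with probability $1$. Let $p_{i,j}(n)$ be the probability that the chain is at $(i,j)$ at time $n$, and define the following formal power series in $t$, with coefficients in $\mathbb R[x,y]$: $$P_{0,0}=\sum_{n\ge0}p_{0,0}(n)t^n,\quad P_1(x)=\sum_{n\ge 0,\,i>0}p_{i,0}(n)x^it^n,\quad P_2(y)=\sum_{n\ge 0,\,j>0}p_{0,j}(n)y^jt^n,\quad P(x,y)=\sum_{n\ge 0,\,i,j>0}p_{i,j}(n)x^iy^jt^n,$$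 $$Q(x,y)=P_{0,0}+r'P_1(x)+r''P_2(y)+rP(x,y),$$ $$S(x,y)=(t-qx)(t-py)\,Q(px,qy)+(t-px)(t-qy)\,Q(py,qx).$$ A series $F$ in the variables $x_1,\dots,x_k$ is *algebraic* if $\Phi(F,x_1,\dots,x_k)=0$ for some non-zero polynomial $\Phi$ with real coefficients; the *degree* of an algebraic series in $t$ is the degree of its minimal polynomial over $\mathbb R(t)$. **Theorem.** The series $S(x,y)$ is symmetric in $x$ and $y$ and is algebraic (in the variables $t,x,y$). It is expressed explicitly in terms of the unique power series $Z\in\mathbb R[[t]]$ such that $Z=1+4pqrt^3Z^3$, as follows. 1. The coefficient of $x^0y^0$ in $S(x,y)$ is an algebraic series in $t$, equal to $2t^2P_{0,0}$. Let $\Delta_-(v)=1-tZ(1+Z)v+t^2Z^2v^2$. Then $$2pq\,P_{0,0}+r(1-r)=A_{p,q}+A_{q,p},\qquad A_{p,q}=\frac{\bigl(p(1-2p)-qrt^3\bigr)\sqrt{\Delta_-(p/t)}}{(1-t^3)(1-2pZ)},$$ where $A_{q,p}$ is obtained by exchanging $p$ and $q$. Here $\sqrt{\Delta_-(p/t)}$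 and $\sqrt{\Delta_-(q/t)}$ are the power series in $t$ with positive constant term whose squares are $\Delta_-(p/t)$ and $\Delta_-(q/t)$, and the quotients, computed in the field of Laurent series $\mathbb R((t))$, are algebraic power series in $t$. The series $P_{0,0}$ is algebraic, of degree $6$ if $p=q$ and of degree $12$ otherwise. 2. Let $\Delta_+(x)=1-4pqrt^2Z^2x$, let $\sqrt{\Delta_+(x)}$ be its square root with constant term $1$ in $t$, and let $$F_{p,q}(x)=(t-qx)\bigl(t-(1-q)x+t^2prx^2\bigr),$$ $$H(x)=q(2t-x+px)F_{p,q}(x)+p(2t-x+qx)F_{q,p}(x)-(p-q)^2x^2\bigl(2rt-(1-p)(1-q)x+2pqrx^2t^2\bigr).$$ Then $$\bigl(t-(1-p)x+t^2qrx^2\bigr)\bigl(t-(1-q)x+t^2prx^2\bigr)\frac{S(x,0)}t+\frac{rH(x)}{2pq}=\frac{(2tZ-x)\sqrt{\Delta_+(x)}}{2pqZ}\Bigl(A_{p,q}F_{p,q}(x)+A_{q,p}F_{q,p}(x)\Bigr).$$ This holds for the indeterminate $x$, and also when $x$ is replaced by any element of $\mathbb R(x,y)$, such as $y$ or $0$;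 for $x=0$ it gives back the expression of $P_{0,0}$. 3. With $G(x,y)=rxyt(t-qx)(t-py)$, $$S(x,y)=\frac{G(x,y)+G(y,x)-(t-py)(t-qy)\,x\,S(x,0)-(t-px)(t-qx)\,y\,S(0,y)}{t\bigl(xy-t(x+y+pqrx^2y^2)\bigr)}.$$ -/

import Mathlib

open scoped LaurentSeries PowerSeries

noncomputable section

namespace QuadrantChain

/-! ### The Markov chain on the quadrant -/

/-- Transition probabilities from the first state to the second one: interior steps have
probabilities `p, q, r`, steps from the (punctured) x-axis `p', r'`, and steps from the
(punctured) y-axis `q'', r''`. -/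
def stepProb (p q r p' r' q'' r'' : ℝ) : ℕ × ℕ → ℕ × ℕ → ℝ
  | (0, 0), s => if s = (1, 1) then 1 else 0
  | (i + 1, 0), s => if s = (i, 0) then p' else if s = (i + 2, 1) then r' else 0
  | (0, j + 1), s => if s = (0, j) then q'' else if s = (1, j + 2) then r'' else 0
  | (i + 1, j + 1), s =>
      if s = (i, j + 1) then p else if s = (i + 1, j) then q
      else if s = (i + 2, j + 2) then r else 0

/-- `law … n (i, j)` is the probability that the chain started at the origin at time `0`
is at `(i, j)` at time `n`. (Each state has finitely many predecessors, so the sum is finite.) -/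
def law (p q r p' r' q'' r'' : ℝ) : ℕ → ℕ × ℕ → ℝ
  | 0, s => if s = (0, 0) then 1 else 0
  | n + 1, s => ∑ᶠ s' : ℕ × ℕ, law p q r p' r' q'' r'' n s' * stepProb p q r p' r' q'' r'' s' s

/-! ### Generating functions

They are power series in `t` over a field `K` containing `ℝ`; the arguments `a, b` are elements
of `K`, for instance indeterminates if `K = ℝ(x, y)`. The law at a fixed time has finite support,
so that each coefficient is polynomial in `a` and `b`. -/

section GeneratingFunctions

variable (K : Type) [Field K] [Algebra ℝ K] (p q r p' r' q'' r'' : ℝ)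

/-- Generating function of the walks ending at the origin. -/
def P00 : K⟦X⟧ :=
  PowerSeries.mk fun n => algebraMap ℝ K (law p q r p' r' q'' r'' n (0, 0))

variable {K}

/-- Generating function of the walks ending on the x-axis, except at the origin. -/
def P1 (a : K) : K⟦X⟧ :=
  PowerSeries.mk fun n =>
    ∑ᶠ i : ℕ, algebraMap ℝ K (law p q r p' r' q'' r'' n (i + 1, 0)) * a ^ (i + 1)

/-- Generating function of the walks ending on the y-axis, except at the origin. -/
def P2 (b : K) : K⟦X⟧ :=
  PowerSeries.mk fun n =>
    ∑ᶠ j : ℕ, algebraMap ℝ K (law p q r p' r' q'' r'' n (0, j + 1)) * b ^ (j + 1)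

/-- Generating function of the walks ending in the interior of the quadrant. -/
def Pint (a b : K) : K⟦X⟧ :=
  PowerSeries.mk fun n =>
    ∑ᶠ s : ℕ × ℕ, algebraMap ℝ K (law p q r p' r' q'' r'' n (s.1 + 1, s.2 + 1)) *
      a ^ (s.1 + 1) * b ^ (s.2 + 1)

/-- `Q(a, b) = P₀₀ + r' P₁(a) + r'' P₂(b) + r P(a, b)`. -/
def Qser (a b : K) : K⟦X⟧ :=
  P00 K p q r p' r' q'' r''
    + PowerSeries.C (algebraMap ℝ K r') * P1 p q r p' r' q'' r'' a
    + PowerSeries.C (algebraMap ℝ K r'') * P2 p q r p' r' q'' r'' b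
    + PowerSeries.C (algebraMap ℝ K r) * Pint p q r p' r' q'' r'' a b

/-- `S(a, b) = (t - q a)(t - p b) Q(p a, q b) + (t - p a)(t - q b) Q(p b, q a)`. -/
def Sser (a b : K) : K⟦X⟧ :=
  (PowerSeries.X - PowerSeries.C (q • a)) * (PowerSeries.X - PowerSeries.C (p • b)) *
      Qser p q r p' r' q'' r'' (p • a) (q • b)
    + (PowerSeries.X - PowerSeries.C (p • a)) * (PowerSeries.X - PowerSeries.C (q • b)) *
      Qser p q r p' r' q'' r'' (p • b) (q • a)

end GeneratingFunctions

/-! ### Algebraic series -/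

/-- `F` is algebraic with respect to the variables `v`: there is a nonzero polynomial `P` with
real coefficients such that `P(F, v₁, …, v_k) = 0`. -/
def IsAlgSeries {A : Type} [CommRing A] [Algebra ℝ A] {k : ℕ} (v : Fin k → A) (F : A) : Prop :=
  ∃ P : MvPolynomial (Fin (k + 1)) ℝ, P ≠ 0 ∧
    MvPolynomial.aeval (Fin.cons F v : Fin (k + 1) → A) P = 0

section Degree

open scoped RatFunc

/-- The degree of a series in `ℝ[[t]]` over the field `ℝ(t)`, that is, the degree of its
minimal polynomial (and `0` if the series is not algebraic). -/
def algDegree (F : ℝ⟦X⟧) : ℕ := (minpoly (RatFunc ℝ) (F : ℝ⸨X⸩)).natDegree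

end Degree

/-! ### The field `ℝ(x, y)` and embeddings into Laurent series in `t` -/

/-- The field `ℝ(x, y)`. -/
abbrev Kxy : Type := FractionRing (MvPolynomial (Fin 2) ℝ)

/-- The indeterminate `x` of `ℝ(x, y)`. -/
def xvar : Kxy := algebraMap (MvPolynomial (Fin 2) ℝ) Kxy (MvPolynomial.X 0)

/-- The indeterminate `y` of `ℝ(x, y)`. -/
def yvar : Kxy := algebraMap (MvPolynomial (Fin 2) ℝ) Kxy (MvPolynomial.X 1)

section Embeddings

variable (K : Type) [Field K] [Algebra ℝ K]

/-- The variable `t` of `K((t))`. -/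
def tvar : K⸨X⸩ := HahnSeries.single 1 1

/-- A real number as a constant of `K((t))`. -/
def cst (s : ℝ) : K⸨X⸩ := HahnSeries.C (algebraMap ℝ K s)

/-- The embedding of `ℝ[[t]]` into `K((t))`. -/
def emb (F : ℝ⟦X⟧) : K⸨X⸩ :=
  HahnSeries.ofPowerSeries ℤ K (PowerSeries.map (algebraMap ℝ K) F)

end Embeddings

/-! ### The explicit expressions -/

section Formulas

variable {L : Type} [Field L]

/-- `Δ₋(v) = 1 - t Z (1 + Z) v + t² Z² v²`, where `v` stands for `1/x`. -/
def deltaMinus (t Z v : L) : L := 1 - t * Z * (1 + Z) * v + t ^ 2 * Z ^ 2 * v ^ 2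

/-- `Δ₊(x) = 1 - 4 p q r t² Z² x`. -/
def deltaPlus (p q r t Z x : L) : L := 1 - 4 * p * q * r * t ^ 2 * Z ^ 2 * x

/-- `A_{p,q}`, where `R` stands for the square root of `Δ₋(p/t)`. -/
def Aexpr (p q r t Z R : L) : L :=
  ((p * (1 - 2 * p) - q * r * t ^ 3) * R) / ((1 - t ^ 3) * (1 - 2 * p * Z))

/-- `F_{p,q}(x)`. -/
def Fexpr (p q r t x : L) : L := (t - x * q) * (t - (1 - q) * x + t ^ 2 * p * r * x ^ 2)

/-- `H(x)`. -/
def Hexpr (p q r t x : L) : L :=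
  q * (2 * t - x + p * x) * Fexpr p q r t x + p * (2 * t - x + q * x) * Fexpr q p r t x
    - (p - q) ^ 2 * x ^ 2 *
      (2 * r * t - (1 - p) * (1 - q) * x + 2 * p * q * r * x ^ 2 * t ^ 2)

/-- `G(x, y) = r x y t (t - q x)(t - p y)`. -/
def Gexpr (p q r t x y : L) : L := r * x * y * t * (t - q * x) * (t - p * y)

/-- `√Δ₋(p/t)`: the power series `R` in `t`, with positive constant term, whose square is
`Δ₋(p/t)`. -/
def IsSqrtDeltaMinus (p : ℝ) (Z R : ℝ⟦X⟧) : Prop :=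
  (R : ℝ⸨X⸩) ^ 2 = deltaMinus (tvar ℝ) (Z : ℝ⸨X⸩) (cst ℝ p / tvar ℝ) ∧
    0 < PowerSeries.constantCoeff R

/-- `√Δ₊(a)`: the power series `R` in `t`, with constant term `1`, whose square is `Δ₊(a)`. -/
def IsSqrtDeltaPlus (p q r : ℝ) (Z : ℝ⟦X⟧) (a : Kxy) (R : Kxy⟦X⟧) : Prop :=
  (R : Kxy⸨X⸩) ^ 2 =
      deltaPlus (cst Kxy p) (cst Kxy q) (cst Kxy r) (tvar Kxy) (emb Kxy Z) (HahnSeries.C a) ∧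
    PowerSeries.constantCoeff R = 1

end Formulas

end QuadrantChain

end

open QuadrantChain

/-! ### Tools on power series -/

namespace PowerSeries

section Contraction

variable {B : Type*} [CommRing B] {F : B⟦X⟧ → B⟦X⟧}

/-! Since p'/r' = p/r and q''/r'' = q/r, the weights used in Q make all transitions proportional to
one step law (`stepProb_eq`), so Q satisfies a kernel equation with unknown boundary series Q(x,0)
and Q(0,y) (`Qgen_kernel`). After x ↦ px, y ↦ qy the kernel becomes symmetric, and S is the
combination of Q(px,qy) and Q(py,qx) in which the boundary unknowns enter only through the single
series τ(x) = S(x,0)/t (`Sgen_kernel`).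

Put x = ut and y = vt. On the curve uv = u + v + pqr t³u²v² the kernel vanishes and the
inhomogeneous term decouples into a part in u and a part in v (`kernel_identity`). Hence N/u³, where
N is `Npoly`, changes sign when u and v are exchanged (`anti_invariant`). The function J(u) =
`cubic`/u² is invariant. The equation of Z says that 2Z is a critical point of J, so that
(2Z-u)²Δ₊(ut)/u² = -4Z²(J(u) - J(2Z)) (`sq_factor`), and (2Z-u)√Δ₊(ut)/u is a second anti-invariant.
The product of the two is invariant with denominator u⁴. At t = 0 the involution is u ↦ u/(u-1),
whose invariants of this shape are the quadratic polynomials in (u-1)/u². Peeling off one power of t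
at a time shows that the product is a quadratic polynomial in J over ℝ[[t]]
(`IsInvariant.exists_eq`). It vanishes at u = 2Z, so one anti-invariant cancels and N =
(2Z-u)√Δ₊(ut)·(aJ+b)u² remains (`homogenize_Nser_eq`). Evaluating where the coefficient of τ in N
vanishes determines a and b (`constants_eq`), and this gives `main_identity`. Its specialisations
are the stated formulas; algebraicity follows because N is affine in τ.

For the degree of P₀₀, 1/Z is the only root in ℝ((t)) of a cubic polynomial over ℝ(t), and ℝ(t,Z) =
ℝ(tZ) is a rational function field. The radicands of √Δ₋(p/t), √Δ₋(q/t), and their product if p ≠ q,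
take negative values as polynomials in tZ, so they are not squares there. The degree over ℝ(t,Z) is
therefore 2 or 4. The factor 3 of the cubic extension is gained because some coefficient of the
minimal polynomial over ℝ(t,Z) is not in ℝ(t) (`natDegree_minpoly_eq_three_mul`,
`eval_zero_eq_eval_one`). -/

theorem X_pow_dvd_iterate_sub (hF : ∀ f g n, X ^ n ∣ f - g → X ^ (n + 1) ∣ F f - F g)
    (f g : B⟦X⟧) (n : ℕ) : X ^ n ∣ F^[n] f - F^[n] g := by
  induction n with
  | zero => simp
  | succ n ih =>
    rw [Function.iterate_succ_apply', Function.iterate_succ_apply']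
    exact hF _ _ _ ih

theorem eq_of_forall_X_pow_dvd_sub {f g : B⟦X⟧} (h : ∀ n, X ^ n ∣ f - g) : f = g := by
  ext n
  have := X_pow_dvd_iff.1 (h (n + 1)) n (Nat.lt_succ_self n)
  rwa [map_sub, sub_eq_zero] at this

theorem fixedPoint_unique (hF : ∀ f g n, X ^ n ∣ f - g → X ^ (n + 1) ∣ F f - F g)
    {f g : B⟦X⟧} (hf : F f = f) (hg : F g = g) : f = g := by
  refine eq_of_forall_X_pow_dvd_sub fun n => ?_
  have := X_pow_dvd_iterate_sub hF f g n
  rwa [Function.iterate_fixed hf, Function.iterate_fixed hg] at this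

/-- Contraction principle for the X-adic topology: the coefficient of X^n no longer changes after n
+ 1 iterations, so the limit can be read off diagonally. -/
theorem exists_fixedPoint (hF : ∀ f g n, X ^ n ∣ f - g → X ^ (n + 1) ∣ F f - F g) :
    ∃ f, F f = f := by
  let f : B⟦X⟧ := mk fun n => coeff n (F^[n + 1] 0)
  have hf : ∀ n, X ^ n ∣ f - F^[n] 0 := by
    intro n
    rw [X_pow_dvd_iff]
    intro m hm
    obtain ⟨k, rfl⟩ := Nat.exists_eq_add_of_le (Nat.succ_le_of_lt hm)
    have := X_pow_dvd_iff.1 (X_pow_dvd_iterate_sub hF 0 (F^[k] 0) (m + 1)) m (Nat.lt_succ_self m)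
    rw [← Function.iterate_add_apply] at this
    simpa [f] using this
  refine ⟨f, eq_of_forall_X_pow_dvd_sub fun n => ?_⟩
  have h1 := (pow_dvd_pow X (Nat.le_succ n)).trans (hF f (F^[n] 0) n (hf n))
  have h2 := (pow_dvd_pow X (Nat.le_succ n)).trans (hf (n + 1))
  rw [Function.iterate_succ_apply'] at h2
  simpa using dvd_sub h1 h2

end Contraction

/-- A power series with constant term `1` has a square root with constant term `1`. -/
theorem exists_sq_eq_one_add {B : Type*} [CommRing B] [Algebra ℚ B] (g : B⟦X⟧) :
    ∃ d : B⟦X⟧, d ^ 2 = 1 + X * g ∧ constantCoeff d = 1 := by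
  -- With d = 1 + Xh the equation d² = 1 + Xg becomes 2h = g - Xh².
  obtain ⟨h, hh⟩ := exists_fixedPoint (F := fun h : B⟦X⟧ => (1 / 2 : ℚ) • (g - X * h ^ 2)) (by
    rintro f₁ f₂ n ⟨k, hk⟩
    refine ⟨(-1 / 2 : ℚ) • (k * (f₁ + f₂)), ?_⟩
    rw [← smul_sub, show g - X * f₁ ^ 2 - (g - X * f₂ ^ 2) = - (X * ((f₁ - f₂) * (f₁ + f₂))) by ring,
      hk, mul_smul_comm, neg_div, neg_smul, smul_neg]
    congr 2
    ring)
  refine ⟨1 + X * h, ?_, by simp⟩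
  have h2 : (2 : B⟦X⟧) * h = g - X * h ^ 2 := by
    conv_lhs => rw [← hh]
    rw [mul_smul_comm, show (2 : B⟦X⟧) * (g - X * h ^ 2) = (2 : ℚ) • (g - X * h ^ 2) by
      rw [ofNat_smul_eq_nsmul]; simp [two_mul, two_smul], smul_smul]
    norm_num
  linear_combination X * h2

/-! ### Substitution of a series in t for a variable of the coefficients -/

section Subst

variable {A B : Type*} [CommRing A] [CommRing B]

/-- The extension of a ring homomorphism `A → B⟦X⟧` to `A⟦X⟧` mapping `X` to `X`. -/
noncomputable def extendX (g : A →+* B⟦X⟧) : A⟦X⟧ →+* B⟦X⟧ where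
  toFun F := mk fun n => ∑ ij ∈ Finset.HasAntidiagonal.antidiagonal n, coeff ij.2 (g (coeff ij.1 F))
  map_zero' := by ext; simp
  map_one' := by
    ext n
    rw [coeff_mk, Finset.sum_eq_single (0, n)]
    · simp
    · rintro ⟨i, j⟩ hij hne
      have : i ≠ 0 := by
        rintro rfl
        simp at hij
        simp [hij] at hne
      simp [coeff_one, this]
    · simp
  map_add' F G := by ext n; simp [Finset.sum_add_distrib]
  map_mul' F G := by
    ext n
    simp only [coeff_mk, coeff_mul, map_sum, map_mul, Finset.sum_mul_sum, ← Finset.sum_product']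
    simp only [Finset.sum_sigma']
    -- Both sides sum over 2×2 arrays of naturals of total n, split by rows or by columns;
    -- transposition is its own inverse.
    refine Finset.sum_nbij'
      (fun x => ⟨(x.2.1.1 + x.2.2.1, x.2.1.2 + x.2.2.2), ((x.2.1.1, x.2.2.1), (x.2.1.2, x.2.2.2))⟩)
      (fun x => ⟨(x.2.1.1 + x.2.2.1, x.2.1.2 + x.2.2.2), ((x.2.1.1, x.2.2.1), (x.2.1.2, x.2.2.2))⟩)
      ?_ ?_ ?_ ?_ ?_
    all_goals
      rintro ⟨⟨a, b⟩, ⟨c, d⟩, ⟨e, f⟩⟩ h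
      simp only [Finset.mem_sigma, Finset.mem_product, Finset.HasAntidiagonal.mem_antidiagonal] at h
      obtain ⟨h1, h2, h3⟩ := h
    · simp; omega
    · simp; omega
    · simp [h2, h3]
    · simp [h2, h3]
    · simp

theorem coeff_extendX (g : A →+* B⟦X⟧) (F : A⟦X⟧) (n : ℕ) :
    coeff n (extendX g F) = ∑ ij ∈ Finset.HasAntidiagonal.antidiagonal n, coeff ij.2 (g (coeff ij.1 F)) := by
  simp [extendX]

@[simp] theorem constantCoeff_extendX (g : A →+* B⟦X⟧) (F : A⟦X⟧) :
    constantCoeff (extendX g F) = constantCoeff (g (constantCoeff F)) := by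
  rw [← coeff_zero_eq_constantCoeff_apply, coeff_extendX]
  simp

@[simp] theorem extendX_C (g : A →+* B⟦X⟧) (a : A) : extendX g (C a) = g a := by
  ext n
  rw [coeff_extendX, Finset.sum_eq_single (0, n)]
  · simp
  · rintro ⟨i, j⟩ hij hne
    have : i ≠ 0 := by
      rintro rfl
      simp at hij
      simp [hij] at hne
    simp [coeff_C, this]
  · simp

@[simp] theorem extendX_X (g : A →+* B⟦X⟧) : extendX g X = X := by
  ext n
  rw [coeff_extendX]
  rcases n with _ | n
  · simp
  · rw [Finset.sum_eq_single (1, n)]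
    · rcases n with _ | n <;> simp [coeff_X, coeff_one]
    · rintro ⟨i, j⟩ hij hne
      have : i ≠ 1 := by
        rintro rfl
        simp at hij
        exact hne (by simp; omega)
      simp [coeff_X, this]
    · simp [add_comm]

/-- Continuity comes for free: removing the constant term and dividing by X shows by induction that
the difference of the two images is divisible by every power of X. -/
theorem ringHom_eq_of_C_of_X {φ ψ : A⟦X⟧ →+* B⟦X⟧} (hC : ∀ a, φ (C a) = ψ (C a))
    (hφ : φ X = X) (hψ : ψ X = X) : φ = ψ := by
  ext1 F
  refine eq_of_forall_X_pow_dvd_sub fun n => ?_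
  induction n generalizing F with
  | zero => simp
  | succ n ih =>
    obtain ⟨k, hk⟩ := ih (mk fun p => coeff (p + 1) F)
    have h := F.eq_X_mul_shift_add_const
    refine ⟨k, ?_⟩
    rw [h, map_add, map_add, map_mul, map_mul, hφ, hψ, hC, pow_succ', mul_assoc, ← hk]
    ring

theorem extendX_map {A' : Type*} [CommRing A'] (g : A →+* B⟦X⟧) (f : A' →+* A) (F : A'⟦X⟧) :
    extendX g (map f F) = extendX (g.comp f) F := by
  refine DFunLike.congr_fun (ringHom_eq_of_C_of_X (φ := (extendX g).comp (map f))
    (ψ := extendX (g.comp f)) ?_ ?_ ?_) F <;> simp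

theorem extendX_C_comp (f : A →+* B) (F : A⟦X⟧) :
    extendX ((C (R := B)).comp f) F = map f F := by
  refine DFunLike.congr_fun (ringHom_eq_of_C_of_X (φ := extendX ((C (R := B)).comp f))
    (ψ := map f) ?_ ?_ ?_) F <;> simp

/-- Evaluation at `w` of a power series with polynomial coefficients. -/
noncomputable def evalPoly {B : Type*} [CommRing B] [Algebra ℝ B] (w : B⟦X⟧) :
    (Polynomial ℝ)⟦X⟧ →+* B⟦X⟧ :=
  extendX (Polynomial.aeval w : Polynomial ℝ →ₐ[ℝ] B⟦X⟧).toRingHom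

variable [Algebra ℝ B] (w : B⟦X⟧)

@[simp] theorem evalPoly_X : evalPoly w X = X := extendX_X _

@[simp] theorem evalPoly_C (f : Polynomial ℝ) : evalPoly w (C f) = Polynomial.aeval w f :=
  extendX_C _ _

@[simp] theorem evalPoly_map_C (F : ℝ⟦X⟧) :
    evalPoly w (map Polynomial.C F) = map (algebraMap ℝ B) F := by
  rw [evalPoly, extendX_map, ← extendX_C_comp]
  congr 2
  ext a
  simp [algebraMap_apply]

theorem constantCoeff_evalPoly (F : (Polynomial ℝ)⟦X⟧) :
    constantCoeff (evalPoly w F) = Polynomial.aeval (constantCoeff w) (constantCoeff F) := by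
  rw [evalPoly, constantCoeff_extendX]
  induction constantCoeff F using Polynomial.induction_on with
  | C a => simp [algebraMap_apply]
  | add f g hf hg => simp_all
  | monomial n a _ => simp [algebraMap_apply]

/-- The homogenisation `x ↦ u t`. -/
noncomputable abbrev homogenize : (Polynomial ℝ)⟦X⟧ →+* (Polynomial ℝ)⟦X⟧ := evalPoly (C Polynomial.X * X)

@[simp] theorem evalPoly_algebraMap (a : ℝ) :
    evalPoly w (algebraMap ℝ (Polynomial ℝ)⟦X⟧ a) = algebraMap ℝ B⟦X⟧ a := by
  rw [algebraMap_apply, Polynomial.algebraMap_eq, evalPoly_C, Polynomial.aeval_C]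

theorem evalPoly_homogenize (F : (Polynomial ℝ)⟦X⟧) :
    evalPoly w (homogenize F) = evalPoly (w * X) F := by
  refine DFunLike.congr_fun (ringHom_eq_of_C_of_X (φ := (evalPoly w).comp homogenize)
    (ψ := evalPoly (w * X)) (fun a => ?_) ?_ ?_) F
  · induction a using Polynomial.induction_on with
    | C a => simp
    | add f g hf hg => simp_all
    | monomial n a _ => simp
  · simp
  · simp

/-- The monomial x^i t^n becomes u^i t^(n+i), so distinct monomials have distinct images. This
allows `main_identity` to be proved after the substitution x = ut. -/
theorem homogenize_injective : Function.Injective homogenize := by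
  rw [injective_iff_map_eq_zero]
  intro F hF
  ext n i
  have h : ∀ (f : Polynomial ℝ) (j : ℕ),
      coeff j (Polynomial.aeval (C Polynomial.X * X : (Polynomial ℝ)⟦X⟧) f)
        = Polynomial.monomial j (f.coeff j) := by
    intro f j
    induction f using Polynomial.induction_on' with
    | add f g hf hg => simp [hf, hg]
    | monomial k a =>
      rw [Polynomial.aeval_monomial, mul_pow, ← map_pow, algebraMap_apply, coeff_C_mul,
        coeff_C_mul, coeff_X_pow, Polynomial.coeff_monomial]
      by_cases hjk : j = k
      · subst hjk
        simp [← Polynomial.C_mul_X_pow_eq_monomial]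
      · simp [hjk, Ne.symm hjk]
  have := congrArg (fun G : (Polynomial ℝ)⟦X⟧ => (coeff (n + i) G).coeff i) hF
  simp only [homogenize, evalPoly, coeff_extendX, AlgHom.toRingHom_eq_coe, RingHom.coe_coe, h] at this
  rw [Polynomial.finsetSum_coeff, Finset.sum_eq_single (n, i)] at this
  · simpa using this
  · rintro ⟨a, b⟩ hab hne
    have : b ≠ i := by
      rintro rfl
      simp at hab
      exact hne (by simp; omega)
    simp [Polynomial.coeff_monomial, this]
  · simp

end Subst

end PowerSeries

/-! ### The functional equation -/

namespace QuadrantChain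

open Finset

/-- The weights of the four types of states in `Qser`. -/
def weight (r r' r'' : ℝ) : ℕ × ℕ → ℝ
  | (0, 0) => 1
  | (_ + 1, 0) => r'
  | (0, _ + 1) => r''
  | (_ + 1, _ + 1) => r

/-- The weighted law. -/
noncomputable def mass (p q r p' r' q'' r'' : ℝ) (n : ℕ) (s : ℕ × ℕ) : ℝ :=
  weight r r' r'' s * law p q r p' r' q'' r'' n s

/-- The hypotheses on the parameters of the chain. -/
structure Params (p q r p' r' q'' r'' : ℝ) : Prop where
  hp : 0 < p
  hq : 0 < q
  hr : 0 < r
  sum : p + q + r = 1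
  hp' : p' = r' * (p / r)
  hq'' : q'' = r'' * (q / r)
  hr' : r' * (1 - q) = r
  hr'' : r'' * (1 - p) = r

variable {p q r p' r' q'' r'' : ℝ}

/-- The point of the hypotheses on the ratios: apart from the weight of the starting state, one step
law serves the interior, both axes and the origin. Steps leaving the quadrant drop out because their
targets are not pairs of naturals. -/
theorem stepProb_eq (h : Params p q r p' r' q'' r'') (s' : ℕ × ℕ) (i j : ℕ) :
    stepProb p q r p' r' q'' r'' s' (i, j) = weight r r' r'' s' *
      ((if s' = (i + 1, j) then p / r else 0) + (if s' = (i, j + 1) then q / r else 0)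
        + if (s'.1 + 1, s'.2 + 1) = (i, j) then 1 else 0) := by
  have hr := h.hr.ne'
  obtain ⟨a, b⟩ := s'
  rcases a with _ | a <;> rcases b with _ | b <;>
    simp only [stepProb, weight, Prod.mk.injEq, zero_add, Nat.add_right_cancel_iff,
      (Nat.succ_ne_zero _).symm, false_and, and_false, if_false]
  · split_ifs <;> first | (exfalso; omega) | simp
  · rw [h.hq'']
    split_ifs <;> first | (exfalso; omega) | simp
  · rw [h.hp']
    split_ifs <;> first | (exfalso; omega) | simp
  · split_ifs <;> first | (exfalso; omega) | (simp; done) | (simp; field_simp)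

theorem mem_support_ite_finite {α : Type*} (a : α) (f : α → ℝ) [DecidableEq α] :
    (Function.support fun s => f s * if s = a then (1 : ℝ) else 0).Finite :=
  (Set.finite_singleton a).subset fun s hs => by
    by_contra hne
    simp_all

theorem finsum_mul_ite {α : Type*} (a : α) (f : α → ℝ) [DecidableEq α] :
    ∑ᶠ s, f s * (if s = a then (1 : ℝ) else 0) = f a := by
  rw [finsum_eq_single _ a fun s hs => by simp [hs]]
  simp

/-- The weighted law of the predecessor by a diagonal step. -/
noncomputable def diagMass (p q r p' r' q'' r'' : ℝ) (n : ℕ) : ℕ × ℕ → ℝ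
  | (i + 1, j + 1) => mass p q r p' r' q'' r'' n (i, j)
  | _ => 0

theorem law_succ (h : Params p q r p' r' q'' r'') (n i j : ℕ) :
    law p q r p' r' q'' r'' (n + 1) (i, j) =
      p / r * mass p q r p' r' q'' r'' n (i + 1, j) + q / r * mass p q r p' r' q'' r'' n (i, j + 1)
        + diagMass p q r p' r' q'' r'' n (i, j) := by
  set m := mass p q r p' r' q'' r'' n with hm
  have e1 : ∀ s', law p q r p' r' q'' r'' n s' * stepProb p q r p' r' q'' r'' s' (i, j) =
      (p / r * m s') * (if s' = (i + 1, j) then 1 else 0)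
        + (q / r * m s') * (if s' = (i, j + 1) then 1 else 0)
        + m s' * (if (s'.1 + 1, s'.2 + 1) = (i, j) then 1 else 0) := by
    intro s'
    rw [stepProb_eq h, hm, mass]
    split_ifs <;> ring
  rw [law]
  simp_rw [e1]
  have f1 := mem_support_ite_finite (i + 1, j) fun s' => p / r * m s'
  have f2 := mem_support_ite_finite (i, j + 1) fun s' => q / r * m s'
  have key : (Function.support fun s' : ℕ × ℕ =>
      m s' * (if (s'.1 + 1, s'.2 + 1) = (i, j) then (1 : ℝ) else 0)).Finite ∧
      ∑ᶠ s' : ℕ × ℕ, m s' * (if (s'.1 + 1, s'.2 + 1) = (i, j) then (1 : ℝ) else 0)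
        = diagMass p q r p' r' q'' r'' n (i, j) := by
    rcases i with _ | i
    · simp [diagMass]
    rcases j with _ | j
    · simp [diagMass]
    have : ∀ s' : ℕ × ℕ, ((s'.1 + 1, s'.2 + 1) = (i + 1, j + 1)) ↔ s' = (i, j) := by
      rintro ⟨a, b⟩; simp
    simp_rw [this]
    exact ⟨mem_support_ite_finite (i, j) m, finsum_mul_ite (i, j) m⟩
  rw [finsum_add_distrib ((f1.union f2).subset (Function.support_add _ _)) key.1,
    finsum_add_distrib f1 f2, finsum_mul_ite, finsum_mul_ite, key.2]

/-- A step raises each coordinate by at most one. All generating functions at time n thus live on a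
box of side n + 1. -/
theorem law_eq_zero (h : Params p q r p' r' q'' r'') (n i j : ℕ) (hn : n < i ∨ n < j) :
    law p q r p' r' q'' r'' n (i, j) = 0 := by
  induction n generalizing i j with
  | zero =>
    have : ¬ (i = 0 ∧ j = 0) := by omega
    simp [law, this]
  | succ n ih =>
    rw [law_succ h]
    simp only [mass]
    rw [ih _ _ (by omega), ih _ _ (by omega)]
    rcases i with _ | i
    · simp [diagMass]
    rcases j with _ | j
    · simp [diagMass]
    simp [diagMass, mass, ih i j (by omega)]

theorem mass_eq_zero (h : Params p q r p' r' q'' r'') (n i j : ℕ) (hn : n < i ∨ n < j) :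
    mass p q r p' r' q'' r'' n (i, j) = 0 := by
  rw [mass, law_eq_zero h n i j hn, mul_zero]

theorem sum_shift {B : Type*} [CommRing B] (g : ℕ → B) (x : B) (N : ℕ) (hN : g N = 0) :
    x * ∑ i ∈ range N, g (i + 1) * x ^ i = ∑ i ∈ range N, g i * x ^ i - g 0 := by
  have h1 := sum_range_succ (fun i => g i * x ^ i) N
  rw [sum_range_succ', hN] at h1
  rw [mul_sum, eq_sub_iff_add_eq, ← add_zero (∑ i ∈ range N, g i * x ^ i)]
  simp only [pow_zero, mul_one, zero_mul] at h1
  rw [← h1]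
  congr 1
  exact sum_congr rfl fun i _ => by ring

theorem sum_mul_zero_pow {B : Type*} [CommRing B] (g : ℕ → B) (N : ℕ) (hN : 0 < N) :
    ∑ i ∈ range N, g i * 0 ^ i = g 0 := by
  obtain ⟨N, rfl⟩ := Nat.exists_eq_add_of_le' hN
  rw [sum_range_succ']
  simp

section Gen

variable {B : Type*} [CommRing B] [Algebra ℝ B]

/-- The generating polynomial of `f` on a box. -/
noncomputable def gen (N : ℕ) (f : ℕ × ℕ → ℝ) (x y : B) : B :=
  ∑ i ∈ range N, ∑ j ∈ range N, algebraMap ℝ B (f (i, j)) * x ^ i * y ^ j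

theorem gen_eq (N : ℕ) (f : ℕ × ℕ → ℝ) (x y : B) :
    gen N f x y = ∑ i ∈ range N, (∑ j ∈ range N, algebraMap ℝ B (f (i, j)) * y ^ j) * x ^ i := by
  refine sum_congr rfl fun i _ => ?_
  rw [sum_mul]
  exact sum_congr rfl fun j _ => by ring

theorem gen_swap (N : ℕ) (f : ℕ × ℕ → ℝ) (x y : B) :
    gen N f x y = gen N (fun s => f s.swap) y x := by
  rw [gen, sum_comm]
  refine sum_congr rfl fun i _ => sum_congr rfl fun j _ => ?_
  simp only [Prod.swap_prod_mk]
  ring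

theorem gen_shift_left (N : ℕ) (hN : 0 < N) (f : ℕ × ℕ → ℝ) (hf : ∀ j, f (N, j) = 0) (x y : B) :
    x * gen N (fun s => f (s.1 + 1, s.2)) x y = gen N f x y - gen N f 0 y := by
  rw [gen_eq, gen_eq, gen_eq, sum_mul_zero_pow _ _ hN]
  exact sum_shift (fun i => ∑ j ∈ range N, algebraMap ℝ B (f (i, j)) * y ^ j) x N (by simp [hf])

theorem gen_shift_right (N : ℕ) (hN : 0 < N) (f : ℕ × ℕ → ℝ) (hf : ∀ i, f (i, N) = 0) (x y : B) :
    y * gen N (fun s => f (s.1, s.2 + 1)) x y = gen N f x y - gen N f x 0 := by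
  rw [gen_swap, gen_swap N f x y, gen_swap N f x 0]
  exact gen_shift_left N hN (fun s => f s.swap) hf y x

theorem gen_succ (N : ℕ) (f : ℕ × ℕ → ℝ) (hf : ∀ i j, N ≤ i ∨ N ≤ j → f (i, j) = 0) (x y : B) :
    gen (N + 1) f x y = gen N f x y := by
  rw [gen, gen, sum_range_succ, sum_eq_zero (s := range (N + 1))
    (f := fun j => algebraMap ℝ B (f (N, j)) * x ^ N * y ^ j), add_zero]
  · refine sum_congr rfl fun i _ => ?_
    rw [sum_range_succ, hf i N (Or.inr le_rfl)]
    simp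
  · intro j _
    rw [hf N j (Or.inl le_rfl)]
    simp

theorem gen_add (N : ℕ) (f g : ℕ × ℕ → ℝ) (x y : B) :
    gen N (fun s => f s + g s) x y = gen N f x y + gen N g x y := by
  simp [gen, add_mul, sum_add_distrib]

theorem gen_smul (N : ℕ) (a : ℝ) (f : ℕ × ℕ → ℝ) (x y : B) :
    gen N (fun s => a * f s) x y = algebraMap ℝ B a * gen N f x y := by
  simp [gen, mul_sum, mul_assoc]

end Gen

section Equation

variable {B : Type*} [CommRing B] [Algebra ℝ B]

theorem gen_diagMass (n : ℕ) (x y : B) :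
    gen (n + 2) (diagMass p q r p' r' q'' r'' n) x y
      = x * y * gen (n + 1) (mass p q r p' r' q'' r'' n) x y := by
  rw [gen, sum_range_succ', gen, mul_sum]
  simp only [diagMass]
  simp only [map_zero, zero_mul, sum_const_zero, add_zero]
  refine sum_congr rfl fun i _ => ?_
  rw [sum_range_succ', mul_sum]
  simp only [map_zero, zero_mul, add_zero]
  exact sum_congr rfl fun j _ => by ring

/-- The factor xy turns the two index shifts into subtraction of a boundary term, which is exact
because the mass at time n vanishes just outside the box of side n + 1. -/
theorem gen_law_succ (h : Params p q r p' r' q'' r'') (n : ℕ) (x y : B) :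
    x * y * (algebraMap ℝ B r * gen (n + 2) (law p q r p' r' q'' r'' (n + 1)) x y) =
      algebraMap ℝ B p * y * (gen (n + 1) (mass p q r p' r' q'' r'' n) x y
          - gen (n + 1) (mass p q r p' r' q'' r'' n) 0 y)
        + algebraMap ℝ B q * x * (gen (n + 1) (mass p q r p' r' q'' r'' n) x y
          - gen (n + 1) (mass p q r p' r' q'' r'' n) x 0)
        + algebraMap ℝ B r * x ^ 2 * y ^ 2 * gen (n + 1) (mass p q r p' r' q'' r'' n) x y := by
  set m := mass p q r p' r' q'' r'' n with hm
  have hm0 : ∀ i j, n + 1 ≤ i ∨ n + 1 ≤ j → m (i, j) = 0 := fun i j hij =>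
    mass_eq_zero h n i j (by omega)
  have e : ∀ s, law p q r p' r' q'' r'' (n + 1) s = (p / r * m (s.1 + 1, s.2)
      + q / r * m (s.1, s.2 + 1)) + diagMass p q r p' r' q'' r'' n s := fun s => law_succ h n s.1 s.2
  have s1 : gen (n + 2) (fun s => m (s.1 + 1, s.2)) x y =
      gen (n + 1) (fun s => m (s.1 + 1, s.2)) x y :=
    gen_succ (n + 1) (fun s => m (s.1 + 1, s.2)) (fun i j hij => hm0 (i + 1) j (by omega)) x y
  have s2 : gen (n + 2) (fun s => m (s.1, s.2 + 1)) x y =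
      gen (n + 1) (fun s => m (s.1, s.2 + 1)) x y :=
    gen_succ (n + 1) (fun s => m (s.1, s.2 + 1)) (fun i j hij => hm0 i (j + 1) (by omega)) x y
  have t1 := gen_shift_left (n + 1) n.succ_pos m (fun j => hm0 _ _ (by omega)) x y
  have t2 := gen_shift_right (n + 1) n.succ_pos m (fun j => hm0 _ _ (by omega)) x y
  have r1 : algebraMap ℝ B r * algebraMap ℝ B (p / r) = algebraMap ℝ B p := by
    rw [← map_mul, mul_div_cancel₀ _ h.hr.ne']
  have r2 : algebraMap ℝ B r * algebraMap ℝ B (q / r) = algebraMap ℝ B q := by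
    rw [← map_mul, mul_div_cancel₀ _ h.hr.ne']
  have e' : law p q r p' r' q'' r'' (n + 1) = fun s => (p / r * m (s.1 + 1, s.2)
      + q / r * m (s.1, s.2 + 1)) + diagMass p q r p' r' q'' r'' n s := funext e
  rw [e', gen_add, gen_add, gen_smul, gen_smul, gen_diagMass, s1, s2, ← t1, ← t2, ← r1, ← r2]
  ring

/-- The boundary weights satisfy r = r'(1-q) = r''(1-p), and r = 1-p-q at the origin. Hence the
unweighted law is recovered by subtracting q times the bottom row and p times the left column, with
the origin counted in both. -/
theorem gen_mass (h : Params p q r p' r' q'' r'') (n : ℕ) (x y : B) :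
    gen (n + 1) (mass p q r p' r' q'' r'' n) x y
      - algebraMap ℝ B q * gen (n + 1) (mass p q r p' r' q'' r'' n) x 0
      - algebraMap ℝ B p * gen (n + 1) (mass p q r p' r' q'' r'' n) 0 y
      = algebraMap ℝ B r * gen (n + 1) (law p q r p' r' q'' r'' n) x y := by
  have key : ∀ s : ℕ × ℕ, r * law p q r p' r' q'' r'' n s =
      mass p q r p' r' q'' r'' n s + ((-q) * (if s.2 = 0 then mass p q r p' r' q'' r'' n s else 0)
        + (-p) * (if s.1 = 0 then mass p q r p' r' q'' r'' n s else 0)) := by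
    rintro ⟨i, j⟩
    have h1 := h.hr'
    have h2 := h.hr''
    have h3 := h.sum
    rcases i with _ | i <;> rcases j with _ | j <;> simp [mass, weight]
    · linear_combination (law p q r p' r' q'' r'' n (0, 0)) * h3
    · linear_combination (-law p q r p' r' q'' r'' n (0, j + 1)) * h2
    · linear_combination (-law p q r p' r' q'' r'' n (i + 1, 0)) * h1
  rw [← gen_smul (n + 1) r (law p q r p' r' q'' r'' n)]
  have key' : (fun s => r * law p q r p' r' q'' r'' n s) = _ := funext key
  rw [key', gen_add, gen_add, gen_smul, gen_smul]
  have g1 : gen (n + 1) (fun s => if s.2 = 0 then mass p q r p' r' q'' r'' n s else 0) x y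
      = gen (n + 1) (mass p q r p' r' q'' r'' n) x 0 := by
    refine sum_congr rfl fun i _ => sum_congr rfl fun j _ => ?_
    rcases j with _ | j <;> simp
  have g2 : gen (n + 1) (fun s => if s.1 = 0 then mass p q r p' r' q'' r'' n s else 0) x y
      = gen (n + 1) (mass p q r p' r' q'' r'' n) 0 y := by
    refine sum_congr rfl fun i _ => sum_congr rfl fun j _ => ?_
    rcases i with _ | i <;> simp
  rw [g1, g2, map_neg, map_neg]
  ring

/-- The series `Q` over an arbitrary commutative `ℝ`-algebra. -/
noncomputable def Qgen (p q r p' r' q'' r'' : ℝ) (x y : B) : B⟦X⟧ :=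
  PowerSeries.mk fun n => gen (n + 1) (mass p q r p' r' q'' r'' n) x y

/-- Coefficient by coefficient in t, `gen_mass` relates the weighted and unweighted laws at one
time, and `gen_law_succ` carries the law from the previous time. The term rxy is the initial state.
-/
theorem Qgen_kernel (h : Params p q r p' r' q'' r'') (x y : B) :
    (PowerSeries.C (x * y) - PowerSeries.X * PowerSeries.C (algebraMap ℝ B p * y
        + algebraMap ℝ B q * x + algebraMap ℝ B r * x ^ 2 * y ^ 2))
      * Qgen p q r p' r' q'' r'' x y =
    PowerSeries.C (algebraMap ℝ B r * x * y)
      + PowerSeries.C (algebraMap ℝ B q * x) * (PowerSeries.C y - PowerSeries.X)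
        * Qgen p q r p' r' q'' r'' x 0
      + PowerSeries.C (algebraMap ℝ B p * y) * (PowerSeries.C x - PowerSeries.X)
        * Qgen p q r p' r' q'' r'' 0 y := by
  ext n
  have h1 := gen_mass h n x y
  rcases n with _ | n
  · simp only [sub_mul, mul_sub, mul_assoc, map_add (PowerSeries.coeff _), map_sub (PowerSeries.coeff _),
      PowerSeries.coeff_zero_X_mul, PowerSeries.coeff_C_mul, Qgen, PowerSeries.coeff_mk]
    simp [gen, mass, weight, law] at h1 ⊢
    linear_combination x * y * h1
  · have h2 := gen_law_succ h n x y
    simp only [sub_mul, mul_sub, mul_assoc, map_add (PowerSeries.coeff _), map_sub (PowerSeries.coeff _),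
      PowerSeries.coeff_succ_X_mul, PowerSeries.coeff_C_mul, Qgen, PowerSeries.coeff_mk,
      PowerSeries.coeff_succ_C]
    linear_combination x * y * h1 + h2

theorem Qgen_map {B' : Type*} [CommRing B'] [Algebra ℝ B'] (f : B →ₐ[ℝ] B') (x y : B) :
    PowerSeries.map f.toRingHom (Qgen p q r p' r' q'' r'' x y)
      = Qgen p q r p' r' q'' r'' (f x) (f y) := by
  ext n
  simp [Qgen, gen]

end Equation

section Frozen

variable {K : Type} [Field K] [Algebra ℝ K]

theorem Qser_eq (h : Params p q r p' r' q'' r'') (a b : K) :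
    Qser p q r p' r' q'' r'' a b = Qgen p q r p' r' q'' r'' a b := by
  ext n
  have h1 : ∑ᶠ i : ℕ, algebraMap ℝ K (law p q r p' r' q'' r'' n (i + 1, 0)) * a ^ (i + 1)
      = ∑ i ∈ range n, algebraMap ℝ K (law p q r p' r' q'' r'' n (i + 1, 0)) * a ^ (i + 1) := by
    refine finsum_eq_sum_of_support_subset _ fun i hi => ?_
    by_contra hi'
    simp at hi'
    simp [law_eq_zero h n (i + 1) 0 (by omega)] at hi
  have h2 : ∑ᶠ j : ℕ, algebraMap ℝ K (law p q r p' r' q'' r'' n (0, j + 1)) * b ^ (j + 1)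
      = ∑ j ∈ range n, algebraMap ℝ K (law p q r p' r' q'' r'' n (0, j + 1)) * b ^ (j + 1) := by
    refine finsum_eq_sum_of_support_subset _ fun i hi => ?_
    by_contra hi'
    simp at hi'
    simp [law_eq_zero h n 0 (i + 1) (by omega)] at hi
  have h3 : ∑ᶠ s : ℕ × ℕ, algebraMap ℝ K (law p q r p' r' q'' r'' n (s.1 + 1, s.2 + 1)) *
      a ^ (s.1 + 1) * b ^ (s.2 + 1) = ∑ i ∈ range n, ∑ j ∈ range n,
        algebraMap ℝ K (law p q r p' r' q'' r'' n (i + 1, j + 1)) * a ^ (i + 1) * b ^ (j + 1) := by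
    rw [← sum_product' (f := fun i j =>
      algebraMap ℝ K (law p q r p' r' q'' r'' n (i + 1, j + 1)) * a ^ (i + 1) * b ^ (j + 1))]
    refine finsum_eq_sum_of_support_subset _ fun s hs => ?_
    by_contra hs'
    simp at hs'
    simp [law_eq_zero h n (s.1 + 1) (s.2 + 1) (by omega)] at hs
  simp only [Qser, P00, P1, P2, Pint, map_add, PowerSeries.coeff_C_mul, PowerSeries.coeff_mk, Qgen,
    h1, h2, h3]
  simp only [gen]
  rw [sum_range_succ', sum_range_succ']
  simp_rw [sum_range_succ' (fun j => _ * _ * b ^ j)]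
  simp only [mass, weight, map_mul, sum_add_distrib, mul_sum, pow_zero, mul_one, one_mul]
  simp only [mul_assoc]
  ring

end Frozen

end QuadrantChain

/-! ### The symmetrised equation and the anti-invariant -/

namespace QuadrantChain

section Algebra

/-- `t - (1 - a) x + t² b x²`. -/
def quad {A : Type*} [CommRing A] (a b t x : A) : A := t - (1 - a) * x + t ^ 2 * b * x ^ 2

/-- The polynomial `H`, over a ring. -/
def Hpoly {A : Type*} [CommRing A] (p q r t x : A) : A :=
  q * (2 * t - x + p * x) * ((t - x * q) * quad q (p * r) t x)
    + p * (2 * t - x + q * x) * ((t - x * p) * quad p (q * r) t x)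
    - (p - q) ^ 2 * x ^ 2 *
      (2 * r * t - (1 - p) * (1 - q) * x + 2 * p * q * r * x ^ 2 * t ^ 2)

/-- The left-hand side of the equation for `S(x, 0)`, multiplied by `2 p q`, where `τ` stands
for `S(x, 0) / t`. -/
def Npoly {A : Type*} [CommRing A] (p q r t x τ : A) : A :=
  2 * p * q * (quad p (q * r) t x * quad q (p * r) t x * τ) + r * Hpoly p q r t x

theorem map_Npoly {A A' : Type*} [CommRing A] [CommRing A'] (f : A →+* A') (p q r t x τ : A) :
    f (Npoly p q r t x τ) = Npoly (f p) (f q) (f r) (f t) (f x) (f τ) := by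
  have h2 : f 2 = 2 := map_ofNat f 2
  simp [Npoly, Hpoly, quad, h2]

/-- The cubic `x²(J(x) - J(t/p))` up to a factor. -/
theorem invariant_quad {A : Type*} [CommRing A] {p q r t u v : A}
    (hk : u * v = u + v + p * q * r * t ^ 3 * u ^ 2 * v ^ 2) :
    v ^ 2 * ((1 - p * u) * quad p (q * r) t (u * t))
      = u ^ 2 * ((1 - p * v) * quad p (q * r) t (v * t)) := by
  unfold quad
  linear_combination t * (u - v) * hk

/-- The reason for the choice of H: multiplied by a suitable factor, the inhomogeneous term of the
symmetrised equation becomes, on the curve, a combination of a function of u and the same function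
of v. -/
theorem kernel_identity {A : Type*} [CommRing A] {p q r t u v : A} (hpqr : p + q + r = 1)
    (hk : u * v = u + v + p * q * r * t ^ 3 * u ^ 2 * v ^ 2) :
    2 * p * q * u ^ 4 * v * quad p (q * r) t (v * t) * quad q (p * r) t (v * t) * t
        * ((1 - q * u) * (1 - p * v) + (1 - p * u) * (1 - q * v))
      + v * (v ^ 3 * Hpoly p q r t (u * t) + u ^ 3 * Hpoly p q r t (v * t))
        * ((1 - p * u) * (1 - q * u)) = 0 := by
  have hm : p * q * r * t ^ 3 * u ^ 2 * v ^ 2 = u * v - u - v := by linear_combination -hk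
  have key : ∀ p q r u v : A, p * q * r * t ^ 3 * u ^ 2 * v ^ 2 = u * v - u - v →
      p * u ^ 2 * quad p (q * r) t (v * t) = t * (p * u ^ 2 * (1 - (1 - p) * v) + (u * v - u - v)) := by
    intro p q r u v h
    unfold quad
    linear_combination t * h
  have x1 := key p q r u v hm
  have x2 := key q p r u v (by linear_combination hm)
  have x3 := key p q r v u (by linear_combination hm)
  have x4 := key q p r v u (by linear_combination hm)
  have e : ∀ w : A, Hpoly p q r t (w * t) = t ^ 2 * (
      q * (2 - w + p * w) * (1 - w * q) * quad q (p * r) t (w * t)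
        + p * (2 - w + q * w) * (1 - w * p) * quad p (q * r) t (w * t)
        - t * (p - q) ^ 2 * w ^ 2 *
          (2 * r - (1 - p) * (1 - q) * w + 2 * p * q * r * w ^ 2 * t ^ 3)) := by
    intro w; unfold Hpoly; ring
  rw [e, e]
  -- Each `quad` in one variable is grouped with the square of the other one, so that `key` and `hm`
  -- eliminate the cubic occurrences of t. What is left holds identically in u and v, without the
  -- kernel relation.
  trans 2 * v * (p * u ^ 2 * quad p (q * r) t (v * t)) * (q * u ^ 2 * quad q (p * r) t (v * t)) * t
        * ((1 - q * u) * (1 - p * v) + (1 - p * u) * (1 - q * v))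
      + v * t ^ 2 * (v * ((2 - u + p * u) * (1 - u * q) * (q * v ^ 2 * quad q (p * r) t (u * t))
            + (2 - u + q * u) * (1 - u * p) * (p * v ^ 2 * quad p (q * r) t (u * t))
            - t * (p - q) ^ 2 * u ^ 2 * ((2 * r - (1 - p) * (1 - q) * u) * v ^ 2
              + 2 * (p * q * r * t ^ 3 * u ^ 2 * v ^ 2)))
          + u * ((2 - v + p * v) * (1 - v * q) * (q * u ^ 2 * quad q (p * r) t (v * t))
            + (2 - v + q * v) * (1 - v * p) * (p * u ^ 2 * quad p (q * r) t (v * t))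
            - t * (p - q) ^ 2 * v ^ 2 * ((2 * r - (1 - p) * (1 - q) * v) * u ^ 2
              + 2 * (p * q * r * t ^ 3 * u ^ 2 * v ^ 2))))
        * ((1 - p * u) * (1 - q * u))
  · ring
  · rw [x1, x2, show p * v ^ 2 * quad p (q * r) t (u * t) = _ from x3,
      show q * v ^ 2 * quad q (p * r) t (u * t) = _ from x4, hm]
    obtain rfl : r = 1 - p - q := by linear_combination hpqr
    ring

/-- Dividing the relation between the two values of τ by (1-pu)(1-qu)(1-pv)(1-qv) and multiplying it
by the invariant (1-pu)(1-qu)·`quad`·`quad`/u⁴ turns the coefficients of the τ's into those of N/u³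
and N/v³. The right side is then absorbed by H. -/
theorem anti_invariant_aux {A : Type*} [CommRing A] [IsDomain A] {p q r t u v τu τv : A}
    (hpqr : p + q + r = 1) (hv : v ≠ 0) (ht : t ≠ 0)
    (hk : u * v = u + v + p * q * r * t ^ 3 * u ^ 2 * v ^ 2)
    (hpu : 1 - p * u ≠ 0) (hqu : 1 - q * u ≠ 0) (hpv : 1 - p * v ≠ 0) (hqv : 1 - q * v ≠ 0)
    (hτ : r * (u * t) * (v * t) * ((t - q * (u * t)) * (t - p * (v * t))
        + (t - p * (u * t)) * (t - q * (v * t)))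
      = (u * t) * (t - p * (v * t)) * (t - q * (v * t)) * τu
        + (v * t) * (t - p * (u * t)) * (t - q * (u * t)) * τv) :
    v ^ 3 * Npoly p q r t (u * t) τu + u ^ 3 * Npoly p q r t (v * t) τv = 0 := by
  have hτ' : r * u * v * t * ((1 - q * u) * (1 - p * v) + (1 - p * u) * (1 - q * v))
      = u * (1 - p * v) * (1 - q * v) * τu + v * (1 - p * u) * (1 - q * u) * τv := by
    have : t ^ 3 ≠ 0 := pow_ne_zero 3 ht
    apply mul_left_cancel₀ this
    linear_combination hτ
  have i1 := invariant_quad hk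
  have i2 := invariant_quad (p := q) (q := p) (r := r) (t := t) (u := u) (v := v)
    (by linear_combination hk)
  have i3 := kernel_identity hpqr hk
  have i4 : v ^ 4 * ((1 - p * u) * quad p (q * r) t (u * t) * ((1 - q * u) * quad q (p * r) t (u * t)))
      = u ^ 4 * ((1 - p * v) * quad p (q * r) t (v * t) * ((1 - q * v) * quad q (p * r) t (v * t))) := by
    linear_combination v ^ 2 * ((1 - q * u) * quad q (p * r) t (u * t)) * i1
      + u ^ 2 * ((1 - p * v) * quad p (q * r) t (v * t)) * i2
  have hM : v * ((1 - p * u) * (1 - q * u) * ((1 - p * v) * (1 - q * v))) ≠ 0 := by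
    simp [*]
  apply mul_left_cancel₀ hM
  unfold Npoly
  linear_combination 2 * p * q * (1 - p * v) * (1 - q * v) * τu * i4
    - 2 * p * q * u ^ 3 * ((1 - p * v) * quad p (q * r) t (v * t) * ((1 - q * v) * quad q (p * r) t (v * t))) * hτ'
    + r * (1 - p * v) * (1 - q * v) * i3

end Algebra

end QuadrantChain

/-! ### The symmetrised series and its evaluation on the kernel curve -/

namespace QuadrantChain

section Symmetrised

variable {B : Type*} [CommRing B] [Algebra ℝ B] {p q r p' r' q'' r'' : ℝ}

/-- The series `S` over an arbitrary commutative `ℝ`-algebra. -/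
noncomputable def Sgen (p q r p' r' q'' r'' : ℝ) (x y : B) : B⟦X⟧ :=
  (PowerSeries.X - PowerSeries.C (p • y)) * (PowerSeries.X - PowerSeries.C (q • x)) *
      Qgen p q r p' r' q'' r'' (p • x) (q • y)
    + (PowerSeries.X - PowerSeries.C (p • x)) * (PowerSeries.X - PowerSeries.C (q • y)) *
      Qgen p q r p' r' q'' r'' (p • y) (q • x)

/-- The series `S(x, 0) / t`. -/
noncomputable def tau (p q r p' r' q'' r'' : ℝ) (x : B) : B⟦X⟧ :=
  (PowerSeries.X - PowerSeries.C (q • x)) * Qgen p q r p' r' q'' r'' (p • x) 0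
    + (PowerSeries.X - PowerSeries.C (p • x)) * Qgen p q r p' r' q'' r'' 0 (q • x)

theorem Sser_eq {K : Type} [Field K] [Algebra ℝ K] (h : Params p q r p' r' q'' r'') (a b : K) :
    Sser p q r p' r' q'' r'' a b = Sgen p q r p' r' q'' r'' a b := by
  simp only [Sser, Sgen, Qser_eq h]
  ring

theorem Sgen_comm (x y : B) : Sgen p q r p' r' q'' r'' x y = Sgen p q r p' r' q'' r'' y x := by
  unfold Sgen
  ring

theorem Sgen_zero (x : B) : Sgen p q r p' r' q'' r'' x 0
    = PowerSeries.X * tau p q r p' r' q'' r'' x := by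
  simp only [Sgen, tau, smul_zero, map_zero, sub_zero]
  ring

/-- Every term of the kernel equation acquires a factor pq under the scaling, and removing it leaves
a kernel symmetric in x and y. -/
theorem Qgen_kernel_scaled (h : Params p q r p' r' q'' r'') (x y : B) :
    (PowerSeries.C (x * y) - PowerSeries.X * PowerSeries.C (x + y + (p * q * r) • (x ^ 2 * y ^ 2)))
      * Qgen p q r p' r' q'' r'' (p • x) (q • y) =
    PowerSeries.C (r • (x * y))
      + PowerSeries.C x * (PowerSeries.C (q • y) - PowerSeries.X)
        * Qgen p q r p' r' q'' r'' (p • x) 0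
      + PowerSeries.C y * (PowerSeries.C (p • x) - PowerSeries.X)
        * Qgen p q r p' r' q'' r'' 0 (q • y) := by
  have h1 := Qgen_kernel h (p • x) (q • y)
  have hpq : (p * q)⁻¹ * p * q = 1 := by
    have := h.hp.ne'
    have := h.hq.ne'
    field_simp
  have hi : PowerSeries.C (algebraMap ℝ B (p * q)⁻¹) * PowerSeries.C (algebraMap ℝ B p)
      * PowerSeries.C (algebraMap ℝ B q) = 1 := by
    rw [← map_mul, ← map_mul, ← map_mul, ← map_mul, hpq, map_one, map_one]
  simp only [Algebra.smul_def, map_mul, map_add, map_pow] at h1 ⊢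
  generalize PowerSeries.C (algebraMap ℝ B (p * q)⁻¹) = c at *
  generalize PowerSeries.C (algebraMap ℝ B p) = P at *
  generalize PowerSeries.C (algebraMap ℝ B q) = Q at *
  generalize PowerSeries.C (algebraMap ℝ B r) = R at *
  generalize PowerSeries.C x = x' at *
  generalize PowerSeries.C y = y' at *
  generalize Qgen p q r p' r' q'' r'' (algebraMap ℝ B p * x) (algebraMap ℝ B q * y) = F at *
  generalize Qgen p q r p' r' q'' r'' (algebraMap ℝ B p * x) 0 = F₁ at *
  generalize Qgen p q r p' r' q'' r'' 0 (algebraMap ℝ B q * y) = F₂ at *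
  linear_combination c * h1 - (((x' * y' - PowerSeries.X * (x' + y' + P * Q * R *
    (x' ^ 2 * y' ^ 2))) * F) - (R * (x' * y') + x' * (Q * y' - PowerSeries.X) * F₁
    + y' * (P * x' - PowerSeries.X) * F₂)) * hi

/-- Since the kernel is symmetric, the equations at (x,y) and (y,x) can be added. The multipliers
are those that give Q(px,0) and Q(0,qx) the common factor x(t-py)(t-qy), so that the two unknowns
merge into τ(x), and likewise for y. -/
theorem Sgen_kernel (h : Params p q r p' r' q'' r'') (x y : B) :
    (PowerSeries.C (x * y) - PowerSeries.X * PowerSeries.C (x + y + (p * q * r) • (x ^ 2 * y ^ 2)))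
      * Sgen p q r p' r' q'' r'' x y =
    PowerSeries.C (r • (x * y))
        * ((PowerSeries.X - PowerSeries.C (q • x)) * (PowerSeries.X - PowerSeries.C (p • y))
          + (PowerSeries.X - PowerSeries.C (p • x)) * (PowerSeries.X - PowerSeries.C (q • y)))
      - PowerSeries.C x * (PowerSeries.X - PowerSeries.C (p • y))
          * (PowerSeries.X - PowerSeries.C (q • y)) * tau p q r p' r' q'' r'' x
      - PowerSeries.C y * (PowerSeries.X - PowerSeries.C (p • x))
          * (PowerSeries.X - PowerSeries.C (q • x)) * tau p q r p' r' q'' r'' y := by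
  have h1 := Qgen_kernel_scaled h x y
  have h2 := Qgen_kernel_scaled h y x
  rw [mul_comm y x, mul_comm (y ^ 2), add_comm y x] at h2
  unfold Sgen tau
  linear_combination
    (PowerSeries.X - PowerSeries.C (q • x)) * (PowerSeries.X - PowerSeries.C (p • y)) * h1
    + (PowerSeries.X - PowerSeries.C (p • x)) * (PowerSeries.X - PowerSeries.C (q • y)) * h2

theorem tau_map {B' : Type*} [CommRing B'] [Algebra ℝ B'] (f : B →ₐ[ℝ] B') (x : B) :
    PowerSeries.map f.toRingHom (tau p q r p' r' q'' r'' x) = tau p q r p' r' q'' r'' (f x) := by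
  simp only [tau, map_add, map_mul, map_sub, Qgen_map]
  simp

/-- The evaluation of `tau` at a power series. -/
theorem evalPoly_tau (w : B⟦X⟧) :
    PowerSeries.evalPoly w (tau p q r p' r' q'' r'' (Polynomial.X : Polynomial ℝ))
      = PowerSeries.extendX (RingHom.id _) (tau p q r p' r' q'' r'' w) := by
  have := tau_map (p := p) (q := q) (r := r) (p' := p') (r' := r') (q'' := q'') (r'' := r'')
    (Polynomial.aeval w : Polynomial ℝ →ₐ[ℝ] B⟦X⟧) Polynomial.X
  rw [Polynomial.aeval_X] at this
  rw [← this, PowerSeries.extendX_map]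
  rfl

/-- The arguments are themselves series in t: the kernel equation is used over the coefficient ring
`B⟦X⟧`, and `extendX` of the identity then merges the two copies of the variable. The relation `hk`
makes the term in S disappear. -/
theorem evalPoly_tau_kernel (h : Params p q r p' r' q'' r'') (x y : B⟦X⟧)
    (hk : x * y = PowerSeries.X * (x + y + (p * q * r) • (x ^ 2 * y ^ 2))) :
    r • (x * y) * ((PowerSeries.X - q • x) * (PowerSeries.X - p • y)
          + (PowerSeries.X - p • x) * (PowerSeries.X - q • y))
      = x * (PowerSeries.X - p • y) * (PowerSeries.X - q • y)
          * PowerSeries.evalPoly x (tau p q r p' r' q'' r'' Polynomial.X)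
        + y * (PowerSeries.X - p • x) * (PowerSeries.X - q • x)
          * PowerSeries.evalPoly y (tau p q r p' r' q'' r'' Polynomial.X) := by
  have h1 := congrArg (PowerSeries.extendX (RingHom.id _)) (Sgen_kernel h x y)
  simp only [map_mul, map_sub, map_add, PowerSeries.extendX_X, ← evalPoly_tau,
    PowerSeries.extendX_C, RingHom.id_apply] at h1
  linear_combination PowerSeries.extendX (RingHom.id _) (Sgen p q r p' r' q'' r'' x y) * hk - h1

end Symmetrised

section Series

variable {p q r p' r' q'' r'' : ℝ}

/-- The series `Npoly` for `S(x, 0)`, with coefficients in `ℝ[x]`. -/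
noncomputable def Nser (p q r p' r' q'' r'' : ℝ) : (Polynomial ℝ)⟦X⟧ :=
  Npoly (algebraMap ℝ _ p) (algebraMap ℝ _ q) (algebraMap ℝ _ r) PowerSeries.X
    (PowerSeries.C Polynomial.X) (tau p q r p' r' q'' r'' Polynomial.X)

theorem evalPoly_Nser {B : Type*} [CommRing B] [Algebra ℝ B] (w : B⟦X⟧) :
    PowerSeries.evalPoly w (Nser p q r p' r' q'' r'') =
      Npoly (algebraMap ℝ _ p) (algebraMap ℝ _ q) (algebraMap ℝ _ r) PowerSeries.X w
        (PowerSeries.evalPoly w (tau p q r p' r' q'' r'' Polynomial.X)) := by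
  simp [Nser, map_Npoly]

theorem anti_invariant (h : Params p q r p' r' q'' r'') {u v : ℝ⟦X⟧} (hv : v ≠ 0)
    (hk : u * v = u + v + algebraMap ℝ ℝ⟦X⟧ (p * q * r) * PowerSeries.X ^ 3 * u ^ 2 * v ^ 2)
    (hpu : 1 - algebraMap ℝ _ p * u ≠ 0) (hqu : 1 - algebraMap ℝ _ q * u ≠ 0)
    (hpv : 1 - algebraMap ℝ _ p * v ≠ 0) (hqv : 1 - algebraMap ℝ _ q * v ≠ 0) :
    v ^ 3 * PowerSeries.evalPoly (u * PowerSeries.X) (Nser p q r p' r' q'' r'')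
      + u ^ 3 * PowerSeries.evalPoly (v * PowerSeries.X) (Nser p q r p' r' q'' r'') = 0 := by
  rw [evalPoly_Nser, evalPoly_Nser]
  refine anti_invariant_aux ?_ hv PowerSeries.X_ne_zero (by simpa using hk) hpu hqu hpv hqv ?_
  · rw [← map_add, ← map_add, h.sum, map_one]
  · have := evalPoly_tau_kernel h (u * PowerSeries.X) (v * PowerSeries.X) (by
      rw [Algebra.smul_def]
      linear_combination PowerSeries.X ^ 2 * hk)
    simp only [Algebra.smul_def] at this
    linear_combination this

end Series

end QuadrantChain

/-! ### Invariants of the involution of the kernel -/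

namespace QuadrantChain

section PolynomialInvariants

open Polynomial

theorem eval_involution (f : Polynomial ℝ) (e : ℕ) (he : f.natDegree ≤ e) {u : ℝ} (hu : u ≠ 1) :
    (∑ i ∈ Finset.range (e + 1), C (f.coeff i) * X ^ i * (X - 1) ^ (e - i)).eval u
      = (u - 1) ^ e * f.eval (u / (u - 1)) := by
  have hu' : u - 1 ≠ 0 := sub_ne_zero.2 hu
  rw [eval_finsetSum, eval_eq_sum_range' (Nat.lt_succ_of_le he), Finset.mul_sum]
  refine Finset.sum_congr rfl fun i hi => ?_
  have hi' : i ≤ e := Nat.lt_succ_iff.1 (Finset.mem_range.1 hi)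
  obtain ⟨k, rfl⟩ := Nat.exists_eq_add_of_le hi'
  simp only [eval_mul, eval_C, eval_pow, eval_X, eval_sub, eval_one, add_tsub_cancel_left]
  rw [pow_add, div_pow]
  field_simp

/-- A polynomial `f` such that `f(u) / u⁴` is invariant under `u ↦ u / (u - 1)`. -/
theorem exists_of_involution (f : Polynomial ℝ) (S : Set ℝ) (hS : S.Finite) (h1 : (1 : ℝ) ∈ S)
    (h : ∀ u, u ∉ S → f.eval u = (u - 1) ^ 4 * f.eval (u / (u - 1))) :
    ∃ a b c : ℝ, f = C a * (X - 1) ^ 2 + C b * X ^ 2 * (X - 1) + C c * X ^ 4 := by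
  -- Multiplying by (u-1)^(e-4) clears all denominators at once, without knowing in advance that the
  -- degree is at most 4.
  set e := max f.natDegree 4 with he
  have key : (X - 1) ^ (e - 4) * f
      = ∑ i ∈ Finset.range (e + 1), C (f.coeff i) * X ^ i * (X - 1) ^ (e - i) := by
    refine eq_of_infinite_eval_eq _ _ (hS.infinite_compl.mono fun u hu => ?_)
    have hu1 : u ≠ 1 := fun h => hu (h ▸ h1)
    rw [Set.mem_ofPred_eq, eval_involution f e (le_max_left _ _) hu1, eval_mul, h u hu]
    have : e = e - 4 + 4 := by omega
    conv_rhs => rw [this, pow_add]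
    simp only [eval_pow, eval_sub, eval_X, eval_one]
    ring
  have hdeg : f.natDegree ≤ 4 := by
    by_contra! hlt
    have hed : e = f.natDegree := by omega
    -- At u = 1 only the term i = e survives on the right, while the left side vanishes when e > 4:
    -- the leading coefficient would be zero.
    have := congrArg (eval 1) key
    rw [eval_mul, eval_pow, eval_finsetSum, Finset.sum_range_succ, Finset.sum_eq_zero] at this
    · simp [hed, zero_pow (by omega : f.natDegree - 4 ≠ 0)] at this
      rw [Polynomial.leadingCoeff_eq_zero.1 this.symm] at hlt
      simp at hlt
    · intro i hi
      have : e - i ≠ 0 := by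
        have := Finset.mem_range.1 hi
        omega
      simp [zero_pow this]
  have he4 : e = 4 := by omega
  have ef := f.as_sum_range_C_mul_X_pow' (Nat.lt_succ_of_le hdeg)
  rw [he4] at key
  -- The values at 1 and -1 give two linear relations that determine the coefficients of X and X³
  -- from the others.
  have v1 := congrArg (eval 1) key
  have v2 := congrArg (eval (-1)) key
  rw [eval_mul, eval_eq_sum_range' (Nat.lt_succ_of_le hdeg)] at v1 v2
  simp [Finset.sum_range_succ] at v1 v2
  norm_num at v1 v2
  refine ⟨f.coeff 0, f.coeff 0 - f.coeff 2, f.coeff 4, ?_⟩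
  have c1 : f.coeff 1 = -2 * f.coeff 0 := by linarith
  have c3 : f.coeff 3 = f.coeff 0 - f.coeff 2 := by linarith
  conv_lhs => rw [ef]
  simp only [Finset.sum_range_succ, Finset.sum_range_zero, c1, c3, map_sub, map_mul, map_neg]
  rw [show (C (2 : ℝ) : Polynomial ℝ) = 2 from rfl]
  ring

end PolynomialInvariants

/-! ### Invariants with power series coefficients -/

section SeriesInvariants

open PowerSeries

/-- Constants of `ℝ⟦t⟧` in `ℝ[x]⟦t⟧`. -/
noncomputable abbrev constX : ℝ⟦X⟧ →+* (Polynomial ℝ)⟦X⟧ := PowerSeries.map Polynomial.C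

/-- The cubic `u - 1 + c t³ u³`. -/
def cubic {A : Type*} [CommRing A] (c t u : A) : A := u - 1 + c * t ^ 3 * u ^ 3

theorem cubic_invariant {A : Type*} [CommRing A] {c t u v : A}
    (hk : u * v = u + v + c * t ^ 3 * u ^ 2 * v ^ 2) :
    v ^ 2 * cubic c t u = u ^ 2 * cubic c t v := by
  unfold cubic
  linear_combination (v - u) * hk

/-- `Ξ(u)/u⁴` is invariant under the involution of the kernel, for `u ∉ S`. -/
def IsInvariant (c : ℝ) (S : Set ℝ) (Ξ : (Polynomial ℝ)⟦X⟧) : Prop :=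
  ∀ u : ℝ, u ∉ S → ∃ v : ℝ⟦X⟧,
    C u * v = C u + v + C c * X ^ 3 * C u ^ 2 * v ^ 2 ∧
      v ^ 4 * evalPoly (C u) Ξ = C u ^ 4 * evalPoly v Ξ

theorem constantCoeff_kernel_root {c u : ℝ} (hu : u ≠ 1) {v : ℝ⟦X⟧}
    (hv : C u * v = C u + v + C c * X ^ 3 * C u ^ 2 * v ^ 2) :
    constantCoeff v = u / (u - 1) := by
  have hu' : u - 1 ≠ 0 := sub_ne_zero.2 hu
  have := congrArg constantCoeff hv
  simp at this
  rw [eq_div_iff hu']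
  linear_combination this

/-- The basic invariants. -/
noncomputable def basicInvariant (c : ℝ) (α β γ : ℝ⟦X⟧) : (Polynomial ℝ)⟦X⟧ :=
  constX α * cubic (algebraMap ℝ _ c) X (C Polynomial.X) ^ 2
    + constX β * C Polynomial.X ^ 2 * cubic (algebraMap ℝ _ c) X (C Polynomial.X)
    + constX γ * C Polynomial.X ^ 4

theorem evalPoly_basicInvariant (c : ℝ) (α β γ w : ℝ⟦X⟧) :
    evalPoly w (basicInvariant c α β γ) = α * cubic (C c) X w ^ 2
      + β * w ^ 2 * cubic (C c) X w + γ * w ^ 4 := by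
  have : ∀ F : ℝ⟦X⟧, map (algebraMap ℝ ℝ) F = F := fun F => by ext; simp
  simp [basicInvariant, cubic, PowerSeries.algebraMap_apply]

/-- The constant term in t of an invariant is invariant under u ↦ u/(u-1), hence classified. Its
lift by the exact invariants in J differs from the series by a multiple of t, and the quotient by t
is again invariant. -/
theorem IsInvariant.exists_step {c : ℝ} {S : Set ℝ} (hS : S.Finite) (h1 : (1 : ℝ) ∈ S)
    {Ξ : (Polynomial ℝ)⟦X⟧} (h : IsInvariant c S Ξ) :
    ∃ (a : ℝ × ℝ × ℝ) (Ξ' : (Polynomial ℝ)⟦X⟧), IsInvariant c S Ξ' ∧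
      Ξ = basicInvariant c (C a.1) (C a.2.1) (C a.2.2) + X * Ξ' := by
  obtain ⟨a, b, d, hf⟩ := exists_of_involution (constantCoeff Ξ) S hS h1 (by
    intro u hu
    have hu1 : u ≠ 1 := fun h => hu (h ▸ h1)
    have hu' : u - 1 ≠ 0 := sub_ne_zero.2 hu1
    obtain ⟨v, hk, hv⟩ := h u hu
    have hv0 := constantCoeff_kernel_root hu1 hk
    have := congrArg constantCoeff hv
    simp only [map_mul, map_pow, constantCoeff_evalPoly, hv0, constantCoeff_C,
      Polynomial.coe_aeval_eq_eval] at this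
    by_cases hu0 : u = 0
    · subst hu0
      norm_num
    · field_simp at this
      linear_combination this)
  have h0 : constantCoeff (Ξ - basicInvariant c (C a) (C b) (C d)) = 0 := by
    rw [map_sub, hf]
    simp [basicInvariant, cubic, PowerSeries.algebraMap_apply]
  obtain ⟨Ξ', hΞ'⟩ := X_dvd_iff.2 h0
  refine ⟨(a, b, d), Ξ', fun u hu => ?_, by rw [← hΞ']; ring⟩
  obtain ⟨v, hk, hv⟩ := h u hu
  refine ⟨v, hk, ?_⟩
  have hΞ : Ξ = basicInvariant c (C a) (C b) (C d) + X * Ξ' := by rw [← hΞ']; ring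
  rw [hΞ] at hv
  simp only [map_add, map_mul, evalPoly_X, evalPoly_basicInvariant] at hv
  have hc := cubic_invariant hk
  apply mul_left_cancel₀ (X_ne_zero (R := ℝ))
  linear_combination hv - (C a * (v ^ 2 * cubic (C c) X (C u) + C u ^ 2 * cubic (C c) X v)
    + C b * v ^ 2 * C u ^ 2) * hc

theorem basicInvariant_shift (c : ℝ) (a b d : ℝ) (α β γ : ℝ⟦X⟧) :
    basicInvariant c (C a + X * α) (C b + X * β) (C d + X * γ)
      = basicInvariant c (C a) (C b) (C d) + X * basicInvariant c α β γ := by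
  simp only [basicInvariant, map_add, map_mul, map_X]
  ring

/-- The remainders of `exists_step` are iterated, and the triples of real constants obtained at each
stage become the coefficients of α, β, γ. -/
theorem IsInvariant.exists_eq {c : ℝ} {S : Set ℝ} (hS : S.Finite) (h1 : (1 : ℝ) ∈ S)
    {Ξ : (Polynomial ℝ)⟦X⟧} (h : IsInvariant c S Ξ) :
    ∃ α β γ : ℝ⟦X⟧, Ξ = basicInvariant c α β γ := by
  choose coefs next hnext heq using
    fun Ξ : {Ξ // IsInvariant c S Ξ} => Ξ.2.exists_step hS h1
  let step : {Ξ // IsInvariant c S Ξ} → {Ξ // IsInvariant c S Ξ} := fun Ξ => ⟨next Ξ, hnext Ξ⟩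
  let ser : (ℝ × ℝ × ℝ → ℝ) → {Ξ // IsInvariant c S Ξ} → ℝ⟦X⟧ := fun g Ξ =>
    mk fun n => g (coefs (step^[n] Ξ))
  have hser : ∀ g Ξ, ser g Ξ = C (g (coefs Ξ)) + X * ser g (step Ξ) := by
    intro g Ξ
    ext n
    rcases n with _ | n
    · simp [ser]
    · simp [ser]
  refine ⟨ser (·.1) ⟨Ξ, h⟩, ser (·.2.1) ⟨Ξ, h⟩, ser (·.2.2) ⟨Ξ, h⟩, ?_⟩
  refine eq_of_forall_X_pow_dvd_sub fun n => ?_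
  suffices ∀ Ξ : {Ξ // IsInvariant c S Ξ}, X ^ n ∣ Ξ.1
      - basicInvariant c (ser (·.1) Ξ) (ser (·.2.1) Ξ) (ser (·.2.2) Ξ) from this ⟨Ξ, h⟩
  induction n with
  | zero => simp
  | succ n ih =>
    intro Ξ
    obtain ⟨k, hk⟩ := ih (step Ξ)
    refine ⟨k, ?_⟩
    rw [hser (·.1), hser (·.2.1), hser (·.2.2), basicInvariant_shift]
    conv_lhs => rw [heq Ξ]
    rw [pow_succ', mul_assoc, ← hk]
    ring

end SeriesInvariants

end QuadrantChain

/-! ### Solution of the anti-invariant equation -/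

namespace QuadrantChain

open PowerSeries

section Existence

theorem existsUnique_Z (k : ℝ) :
    ∃ Z : ℝ⟦X⟧, ∀ W : ℝ⟦X⟧, W = 1 + C k * X ^ 3 * W ^ 3 ↔ W = Z := by
  have hF : ∀ (f g : ℝ⟦X⟧) n, X ^ n ∣ f - g →
      X ^ (n + 1) ∣ (1 + C k * X ^ 3 * f ^ 3) - (1 + C k * X ^ 3 * g ^ 3) := by
    rintro f g n ⟨a, ha⟩
    refine ⟨C k * X ^ 2 * (a * (f ^ 2 + f * g + g ^ 2)), ?_⟩
    linear_combination C k * X ^ 3 * (f ^ 2 + f * g + g ^ 2) * ha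
  obtain ⟨Z, hZ⟩ := exists_fixedPoint (F := fun f : ℝ⟦X⟧ => 1 + C k * X ^ 3 * f ^ 3) hF
  refine ⟨Z, fun W => ⟨fun hW => ?_, ?_⟩⟩
  · exact fixedPoint_unique (F := fun f : ℝ⟦X⟧ => 1 + C k * X ^ 3 * f ^ 3) hF hW.symm hZ
  · rintro rfl
    exact hZ.symm

/-- Power series solution of `a x = b + X³ k x²`. -/
theorem exists_quadratic_root {a : ℝ} (ha : a ≠ 0) (b k : ℝ) :
    ∃ x : ℝ⟦X⟧, C a * x = C b + X ^ 3 * C k * x ^ 2 := by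
  obtain ⟨x, hx⟩ := exists_fixedPoint
    (F := fun f : ℝ⟦X⟧ => C a⁻¹ * (C b + X ^ 3 * C k * f ^ 2)) (by
      rintro f g n ⟨l, hl⟩
      refine ⟨C a⁻¹ * X ^ 2 * C k * (l * (f + g)), ?_⟩
      linear_combination C a⁻¹ * X ^ 3 * C k * (f + g) * hl)
  refine ⟨x, ?_⟩
  have h1 : C a * C a⁻¹ = (1 : ℝ⟦X⟧) := by rw [← map_mul, mul_inv_cancel₀ ha, map_one]
  linear_combination (C b + X ^ 3 * C k * x ^ 2) * h1 - C a * hx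

theorem constantCoeff_Z {k : ℝ} {Z : ℝ⟦X⟧} (hZ : Z = 1 + C k * X ^ 3 * Z ^ 3) :
    constantCoeff Z = 1 := by
  rw [hZ]; simp

theorem exists_sqrtDeltaPlus (k : ℝ) (Z : ℝ⟦X⟧) :
    ∃ D : (Polynomial ℝ)⟦X⟧, D ^ 2 = 1 - algebraMap ℝ _ k * X ^ 2 * constX Z ^ 2 * C Polynomial.X ∧
      constantCoeff D = 1 := by
  obtain ⟨D, hD, hD'⟩ := exists_sq_eq_one_add
    (-(algebraMap ℝ (Polynomial ℝ)⟦X⟧ k * X * constX Z ^ 2 * C Polynomial.X))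
  exact ⟨D, by rw [hD]; ring, hD'⟩

end Existence

section Solution

variable {p q r p' r' q'' r'' : ℝ} {Z : ℝ⟦X⟧} {D : (Polynomial ℝ)⟦X⟧}

theorem map_algebraMap_self (F : ℝ⟦X⟧) : map (algebraMap ℝ ℝ) F = F := by ext; simp

theorem constantCoeff_constX (F : ℝ⟦X⟧) :
    constantCoeff (constX F) = Polynomial.C (constantCoeff F) := by
  rw [← coeff_zero_eq_constantCoeff_apply, coeff_map, coeff_zero_eq_constantCoeff_apply]

/-- `√Δ₊` after the substitution `x = w t`. -/
theorem evalPoly_sqrtDeltaPlus {k : ℝ}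
    (hD : D ^ 2 = 1 - algebraMap ℝ _ k * X ^ 2 * constX Z ^ 2 * C Polynomial.X) (w : ℝ⟦X⟧) :
    evalPoly (w * X) D ^ 2 = 1 - C k * X ^ 3 * Z ^ 2 * w := by
  rw [← map_pow, hD]
  simp [PowerSeries.algebraMap_apply]
  ring

theorem constantCoeff_evalPoly_sqrtDeltaPlus (hD' : constantCoeff D = 1) (w : ℝ⟦X⟧) :
    constantCoeff (evalPoly (w * X) D) = 1 := by
  rw [constantCoeff_evalPoly, hD', map_one]

/-- The cubic in w on the right has a double root at 2Z precisely because of the equation of Z; its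
remaining linear factor is the radicand of d. -/
theorem sq_factor {A : Type*} [CommRing A] {c t Z d w : A} (hZ : Z = 1 + 4 * c * t ^ 3 * Z ^ 3)
    (hd : d ^ 2 = 1 - 4 * c * t ^ 3 * Z ^ 2 * w) :
    ((2 * Z - w) * d) ^ 2 = -4 * Z ^ 2 * cubic c t w + (4 * Z - 3) * w ^ 2 := by
  unfold cubic
  linear_combination (2 * Z - w) ^ 2 * hd + (4 * w * Z - 4 * w ^ 2) * hZ

/-- By `sq_factor` and the invariance of J the squares of the two terms agree, so the terms are
equal or opposite. At t = 0, with v = u/(u-1), they are opposite, and they could only be equal for u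
= 0 or u = 2. -/
theorem anti_invariant_sqrt {c u : ℝ} (hu0 : u ≠ 0) (hu1 : u ≠ 1) (hu2 : u ≠ 2)
    {v du dv : ℝ⟦X⟧} (hZ : Z = 1 + C (4 * c) * X ^ 3 * Z ^ 3)
    (hk : C u * v = C u + v + C c * X ^ 3 * C u ^ 2 * v ^ 2)
    (hdu : du ^ 2 = 1 - C (4 * c) * X ^ 3 * Z ^ 2 * C u) (hdu' : constantCoeff du = 1)
    (hdv : dv ^ 2 = 1 - C (4 * c) * X ^ 3 * Z ^ 2 * v) (hdv' : constantCoeff dv = 1) :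
    v * ((2 * Z - C u) * du) + C u * ((2 * Z - v) * dv) = 0 := by
  have h4 : C (4 * c) = 4 * (C c : ℝ⟦X⟧) := by rw [map_mul, map_ofNat]
  rw [h4] at hZ hdu hdv
  have e1 := sq_factor hZ hdu
  have e2 := sq_factor hZ hdv
  have hc := cubic_invariant hk
  have hv0 := constantCoeff_kernel_root hu1 hk
  have hZ0 : constantCoeff Z = 1 := constantCoeff_Z (k := 4 * c) (by rw [h4]; exact hZ)
  have hu' : u - 1 ≠ 0 := sub_ne_zero.2 hu1
  have hprod : (v * ((2 * Z - C u) * du) + C u * ((2 * Z - v) * dv))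
      * (v * ((2 * Z - C u) * du) - C u * ((2 * Z - v) * dv)) = 0 := by
    linear_combination v ^ 2 * e1 - C u ^ 2 * e2 - 4 * Z ^ 2 * hc
  refine (mul_eq_zero.1 hprod).resolve_right fun h => ?_
  have := congrArg constantCoeff h
  simp [hZ0, hdu', hdv', hv0, map_ofNat] at this
  field_simp at this
  apply hu2
  have h3 : u * (u - 2) = 0 := by linear_combination this / (-2)
  rcases mul_eq_zero.1 h3 with h3 | h3
  · exact absurd h3 hu0
  · linarith

/-- The invariant obtained as a product of two anti-invariants. -/
theorem isInvariant_product (h : Params p q r p' r' q'' r'')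
    (hZ : Z = 1 + C (4 * (p * q * r)) * X ^ 3 * Z ^ 3)
    (hD : D ^ 2 = 1 - algebraMap ℝ _ (4 * (p * q * r)) * X ^ 2 * constX Z ^ 2 * C Polynomial.X)
    (hD' : constantCoeff D = 1) :
    IsInvariant (p * q * r) {0, 1, 2, 1 / p, 1 / q, 1 / (1 - p), 1 / (1 - q)}
      (homogenize (Nser p q r p' r' q'' r'')
        * ((2 * constX Z - C Polynomial.X) * homogenize D)) := by
  intro u hu
  simp only [Set.mem_insert_iff, Set.mem_singleton_iff, not_or] at hu
  obtain ⟨hu0, hu1, hu2, hup, huq, hup', huq'⟩ := hu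
  have hu' : u - 1 ≠ 0 := sub_ne_zero.2 hu1
  obtain ⟨v, hv⟩ := exists_quadratic_root hu' u (p * q * r * u ^ 2)
  have hk : C u * v = C u + v + C (p * q * r) * X ^ 3 * C u ^ 2 * v ^ 2 := by
    simp only [map_sub, map_one, map_mul, map_pow] at hv ⊢
    linear_combination hv
  refine ⟨v, hk, ?_⟩
  have hv0 := constantCoeff_kernel_root hu1 hk
  have hne : ∀ a : ℝ, a ≠ 0 → u ≠ 1 / a → 1 - algebraMap ℝ ℝ⟦X⟧ a * C u ≠ 0 := by
    intro a ha hua h0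
    have := congrArg constantCoeff h0
    simp at this
    apply hua
    field_simp
    linear_combination -this
  -- The constant term of v is u/(u-1), so 1 - av has zero constant term only for u = 1/(1-a); this
  -- explains the last two excluded values.
  have hne' : ∀ a : ℝ, 1 - a ≠ 0 → u ≠ 1 / (1 - a) → 1 - algebraMap ℝ ℝ⟦X⟧ a * v ≠ 0 := by
    intro a ha hua h0
    have := congrArg constantCoeff h0
    simp [hv0] at this
    apply hua
    field_simp at this ⊢
    linear_combination this
  have hp1 : 1 - p ≠ 0 := by linarith [h.hq, h.hr, h.sum]
  have hq1 : 1 - q ≠ 0 := by linarith [h.hp, h.hr, h.sum]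
  have hv : v ≠ 0 := by
    rintro rfl
    simp at hv0
    exact div_ne_zero hu0 hu' hv0.symm
  have a1 := anti_invariant h (u := C u) hv (by simpa [PowerSeries.algebraMap_apply] using hk)
    (hne p h.hp.ne' hup) (hne q h.hq.ne' huq) (hne' p hp1 hup') (hne' q hq1 huq')
  have a2 := anti_invariant_sqrt hu0 hu1 hu2 hZ hk
    (evalPoly_sqrtDeltaPlus hD (C u)) (constantCoeff_evalPoly_sqrtDeltaPlus hD' _)
    (evalPoly_sqrtDeltaPlus hD v) (constantCoeff_evalPoly_sqrtDeltaPlus hD' _)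
  simp only [map_mul, map_sub, map_ofNat, evalPoly_homogenize, evalPoly_map_C,
    map_algebraMap_self, evalPoly_C, Polynomial.aeval_X]
  linear_combination (v * ((2 * Z - C u) * evalPoly (C u * X) D)) * a1
    - C u ^ 3 * evalPoly (v * X) (Nser p q r p' r' q'' r'') * a2

/-- With W the explicit anti-invariant, WN/u⁴ is a quadratic polynomial in J that vanishes for J =
J(2Z). It is thus a multiple of J - J(2Z), which is W²/u² up to the factor -4Z²; cancelling W leaves
a linear polynomial in J. -/
theorem homogenize_Nser_eq (h : Params p q r p' r' q'' r'')
    (hZ : Z = 1 + C (4 * (p * q * r)) * X ^ 3 * Z ^ 3)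
    (hD : D ^ 2 = 1 - algebraMap ℝ _ (4 * (p * q * r)) * X ^ 2 * constX Z ^ 2 * C Polynomial.X)
    (hD' : constantCoeff D = 1) :
    ∃ a b : ℝ⟦X⟧, homogenize (Nser p q r p' r' q'' r'')
      = (2 * constX Z - C Polynomial.X) * homogenize D
        * (constX a * cubic (algebraMap ℝ _ (p * q * r)) X (C Polynomial.X)
          + constX b * C Polynomial.X ^ 2) := by
  obtain ⟨α, β, γ, hΞ⟩ := (isInvariant_product h hZ hD hD').exists_eq (Set.toFinite _) (by simp)
  have hZ0 := constantCoeff_Z hZ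
  have h4 : C (4 * (p * q * r)) = 4 * (C (p * q * r) : ℝ⟦X⟧) := by rw [map_mul, map_ofNat]
  have hZ4 := hZ
  rw [h4] at hZ4
  -- The factor 2Z - u kills the left side, and `hJ` computes J(2Z): this is the single relation
  -- between α, β and γ.
  have hev := congrArg (evalPoly (2 * Z)) hΞ
  have hJ : cubic (C (p * q * r)) X (2 * Z) = 4 * Z - 3 := by
    unfold cubic
    linear_combination -2 * hZ4
  rw [evalPoly_basicInvariant, hJ] at hev
  simp only [map_mul, map_sub, map_ofNat, evalPoly_map_C, map_algebraMap_self, evalPoly_C,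
    Polynomial.aeval_X, sub_self, zero_mul, mul_zero] at hev
  have hZi : Z * Z⁻¹ = 1 := PowerSeries.mul_inv_cancel _ (by rw [hZ0]; exact one_ne_zero)
  have hJi : (4 * Z - 3) * (4 * Z - 3)⁻¹ = 1 := PowerSeries.mul_inv_cancel _ (by
    simp [hZ0, map_ofNat]; norm_num)
  have hqi : (4 : ℝ⟦X⟧) * C (1 / 4) = 1 := by
    rw [← map_ofNat (C (R := ℝ)) 4, ← map_mul]; norm_num
  set J := (4 * Z - 3) with hJdef
  obtain ⟨Ji, hJi'⟩ : ∃ Ji, Ji = J⁻¹ := ⟨_, rfl⟩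
  obtain ⟨Zi, hZi'⟩ : ∃ Zi, Zi = Z⁻¹ := ⟨_, rfl⟩
  obtain ⟨κ, hκ⟩ : ∃ κ, κ = (C (1 / 4) : ℝ⟦X⟧) := ⟨_, rfl⟩
  rw [← hJi'] at hJi
  rw [← hZi'] at hZi
  rw [← hκ] at hqi
  -- Division of the quadratic by -4Z²J + (4Z-3): `h1` and `h2` match the extreme coefficients, and
  -- the middle one `h3` is the relation `hev`.
  have h1 : -4 * Z ^ 2 * (-(κ * Zi ^ 2 * α)) = α := by
    linear_combination Z ^ 2 * Zi ^ 2 * α * hqi + (Z * Zi + 1) * α * hZi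
  have h2 : J * (γ * Ji) = γ := by linear_combination γ * hJi
  have h3 : J * (-(κ * Zi ^ 2 * α)) - 4 * Z ^ 2 * (γ * Ji) = β := by
    have hne : 4 * Z ^ 2 * J ≠ 0 := by
      intro h0
      have := congrArg constantCoeff h0
      simp [hJdef, hZ0, map_ofNat] at this
      norm_num at this
    apply mul_left_cancel₀ hne
    linear_combination -J ^ 2 * h1 - 16 * Z ^ 4 * h2 + hev
  refine ⟨-(κ * Zi ^ 2 * α), γ * Ji, ?_⟩
  have hW : (2 * constX Z - C Polynomial.X) * homogenize D ≠ 0 := by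
    intro h0
    have := congrArg constantCoeff h0
    rw [map_mul, constantCoeff_evalPoly, hD'] at this
    simp [constantCoeff_constX, hZ0, map_ofNat] at this
    have := congrArg (Polynomial.eval 0) this
    simp at this
  apply mul_left_cancel₀ hW
  have hWsq := sq_factor (A := (Polynomial ℝ)⟦X⟧) (c := algebraMap ℝ _ (p * q * r)) (t := X)
    (Z := constX Z) (d := homogenize D) (w := C Polynomial.X) (by
      conv_lhs => rw [hZ4]
      simp [map_ofNat, PowerSeries.algebraMap_apply]) (by
      rw [← map_pow, hD]
      simp [PowerSeries.algebraMap_apply, map_ofNat]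
      ring)
  generalize (2 * constX Z - C Polynomial.X) * homogenize D = W at *
  have hΞ' : W * homogenize (Nser p q r p' r' q'' r'') = basicInvariant (p * q * r) α β γ := by
    rw [← hΞ]; ring
  rw [hΞ', ← mul_assoc W W, ← sq, hWsq, basicInvariant]
  have m1 := congrArg constX h1
  have m2 := congrArg constX h2
  have m3 := congrArg constX h3
  rw [hJdef] at m2 m3
  generalize cubic (algebraMap ℝ (Polynomial ℝ)⟦X⟧ (p * q * r)) X (C Polynomial.X) = j at *
  simp only [map_mul, map_sub, map_pow, map_neg, map_ofNat] at m1 m2 m3 ⊢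
  linear_combination (-j ^ 2) * m1 - C Polynomial.X ^ 2 * j * m3 - C Polynomial.X ^ 4 * m2

end Solution

end QuadrantChain

/-! ### Determination of the constants -/

namespace QuadrantChain

open PowerSeries

section Identities

variable {A : Type*} [CommRing A]

/-- The level set of J through u = 1/p consists of 1/p and the two roots of `quad`, and J(1/p) =
p(1-p) + qrt³. -/
theorem one_sub_mul_quad {p q r t u : A} :
    (1 - p * u) * quad p (q * r) t (u * t)
      = t * (-cubic (p * q * r) t u + (p * (1 - p) + q * r * t ^ 3) * u ^ 2) := by
  unfold quad cubic
  ring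

/-- The half of H that contains this quadratic factor vanishes, and the equation of x removes the
cubic powers of t elsewhere. The last factor is the numerator of A_{p,q} without its square root. -/
theorem Hpoly_at_root {p q r t x : A} (hpqr : p + q + r = 1)
    (hx : 1 - (1 - p) * x + t ^ 3 * (q * r) * x ^ 2 = 0) :
    Hpoly p q r t (x * t)
      = t ^ 3 * ((q - p) * (2 - (1 - p) * x) * x ^ 2 * (p * (1 - 2 * p) - q * r * t ^ 3)) := by
  obtain rfl : r = 1 - p - q := by linear_combination hpqr
  have e : Hpoly p q (1 - p - q) t (x * t) = t ^ 3 * (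
      (2 - x + p * x) * (1 - x * q) * (q * (1 - (1 - q) * x)
        + p * (t ^ 3 * (q * (1 - p - q)) * x ^ 2))
      + p * (2 - x + q * x) * ((1 - x * p) * (1 - (1 - p) * x + t ^ 3 * (q * (1 - p - q)) * x ^ 2))
      - (p - q) ^ 2 * x ^ 2 *
        (2 * (1 - p - q) - (1 - p) * (1 - q) * x)
      - (p - q) ^ 2 * x ^ 2 * (2 * p * (t ^ 3 * (q * (1 - p - q)) * x ^ 2))) := by
    unfold Hpoly quad; ring
  have hk : t ^ 3 * (q * (1 - p - q)) * x ^ 2 = (1 - p) * x - 1 := by linear_combination hx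
  rw [e, hk]
  linear_combination (t ^ 3 * (q - p) * (2 - (1 - p) * x)) * hk

/-- The discriminant (1-p)² - 4k of the quadratic in x equals R² up to a factor rational in Z
(`s3`), and Δ₊ at the root is a square up to a factor of the same class (`s2`, `s4`). Hence √Δ₊ at
the root is expressed through R and x. -/
theorem sq_sqrt_relation [IsDomain A] {p q r t Z x d R : A}
    (hZ : Z = 1 + 4 * (p * q * r) * t ^ 3 * Z ^ 3)
    (hd : d ^ 2 = 1 - 4 * (p * q * r) * t ^ 3 * Z ^ 2 * x)
    (hR : R ^ 2 = 1 - p * Z * (1 + Z) + p ^ 2 * Z ^ 2)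
    (hx : 1 - (1 - p) * x + t ^ 3 * (q * r) * x ^ 2 = 0) :
    (d * R * (1 - (1 - p) * Z) * x) ^ 2
      = (p * Z ^ 2 * (2 - (1 - p) * x) * (1 - 2 * Z * (t ^ 3 * (q * r)) * x)) ^ 2 := by
  obtain ⟨k, hk⟩ : ∃ k, k = t ^ 3 * (q * r) := ⟨_, rfl⟩
  have hZ' : 4 * p * k * Z ^ 3 = Z - 1 := by rw [hk]; linear_combination -hZ
  have hd' : d ^ 2 = 1 - 4 * p * k * Z ^ 2 * x := by rw [hk]; linear_combination hd
  rw [← hk] at hx ⊢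
  have s1 : (2 - (1 - p) * x) ^ 2 = x ^ 2 * ((1 - p) ^ 2 - 4 * k) := by linear_combination 4 * hx
  have s2 : (1 - 2 * Z * k * x) ^ 2 = (1 - 4 * Z ^ 2 * k) - 4 * Z * k * x * (1 - (1 - p) * Z) := by
    linear_combination 4 * Z ^ 2 * k * hx
  have s3 : p * Z ^ 3 * ((1 - p) ^ 2 - 4 * k) = (1 - (1 - p) * Z) * R ^ 2 := by
    linear_combination -hZ' - (1 - (1 - p) * Z) * hR
  have s4 : d ^ 2 * (1 - (1 - p) * Z)
      = p * Z * ((1 - 4 * Z ^ 2 * k) - 4 * Z * k * x * (1 - (1 - p) * Z)) := by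
    linear_combination (1 - (1 - p) * Z) * hd' + hZ'
  linear_combination R ^ 2 * (1 - (1 - p) * Z) * x ^ 2 * s4
    - p * Z * x ^ 2 * ((1 - 4 * Z ^ 2 * k) - 4 * Z * k * x * (1 - (1 - p) * Z)) * s3
    - p ^ 2 * Z ^ 4 * (1 - 2 * Z * k * x) ^ 2 * s1
    - p ^ 2 * Z ^ 4 * (x ^ 2 * ((1 - p) ^ 2 - 4 * k)) * s2

end Identities

section Constants

variable {p q r p' r' q'' r'' : ℝ} {Z : ℝ⟦X⟧} {D : (Polynomial ℝ)⟦X⟧}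

/-- The sign left open by `sq_sqrt_relation` is fixed by the constant terms, which both equal p.
Then `h3` exchanges the factor involving k for 2Z - x. -/
theorem sqrt_relation (hp : 0 < p) (hp1 : p < 1) {x d R : ℝ⟦X⟧}
    (hZ : Z = 1 + 4 * (C p * C q * C r) * X ^ 3 * Z ^ 3) (hZ0 : constantCoeff Z = 1)
    (hd : d ^ 2 = 1 - 4 * (C p * C q * C r) * X ^ 3 * Z ^ 2 * x) (hd0 : constantCoeff d = 1)
    (hR : R ^ 2 = 1 - C p * Z * (1 + Z) + C p ^ 2 * Z ^ 2) (hR0 : constantCoeff R = 1 - p)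
    (hx : 1 - (1 - C p) * x + X ^ 3 * (C q * C r) * x ^ 2 = 0)
    (hx0 : constantCoeff x = 1 / (1 - p)) :
    (2 * Z - x) * d * R = Z * (2 - (1 - C p) * x) * (1 - 2 * C p * Z) := by
  have hp1' : 1 - p ≠ 0 := by linarith
  have h1 := sq_sqrt_relation hZ hd hR hx
  have h2 : d * R * (1 - (1 - C p) * Z) * x
      = C p * Z ^ 2 * (2 - (1 - C p) * x) * (1 - 2 * Z * (X ^ 3 * (C q * C r)) * x) := by
    refine (sq_eq_sq_iff_eq_or_eq_neg.1 h1).resolve_right fun h => ?_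
    have := congrArg constantCoeff h
    simp [hZ0, hd0, hR0, hx0, map_ofNat] at this
    field_simp at this
    norm_num at this
  have hne : (1 - (1 - C p) * Z) * x ≠ 0 := by
    intro h0
    have := congrArg constantCoeff h0
    simp [hZ0, hx0] at this
    exact this.elim hp.ne' hp1'
  have h3 : C p * Z * ((2 * Z - x) * (1 - 2 * Z * (X ^ 3 * (C q * C r)) * x))
      = x * (1 - 2 * C p * Z) * (1 - (1 - C p) * Z) := by
    linear_combination x * hZ + 2 * C p * Z ^ 2 * hx
  apply mul_right_cancel₀ hne
  linear_combination (2 * Z - x) * h2 + Z * (2 - (1 - C p) * x) * h3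

/-- The relations that define `A_{p,q}`. -/
theorem exists_A (hp : 0 < p) (hp1 : p < 1)
    (hZ : Z = 1 + 4 * (C p * C q * C r) * X ^ 3 * Z ^ 3) (hZ0 : constantCoeff Z = 1) :
    ∃ R A : ℝ⟦X⟧, R ^ 2 = 1 - C p * Z * (1 + Z) + C p ^ 2 * Z ^ 2 ∧ constantCoeff R = 1 - p ∧
      4 * C p * Z ^ 3 * (1 - X ^ 3) * A
        = (1 - (1 - 2 * C p) * Z - 2 * C p * (1 - 2 * C p) * Z ^ 2) * R ∧
      (1 - X ^ 3) * (1 - 2 * C p * Z) * A = (C p * (1 - 2 * C p) - C q * C r * X ^ 3) * R := by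
  have hp1' : 1 - p ≠ 0 := by linarith
  set f := 1 - C p * Z * (1 + Z) + C p ^ 2 * Z ^ 2 with hf
  have hf0 : constantCoeff f = (1 - p) ^ 2 := by
    simp [hf, hZ0]; ring
  obtain ⟨g, hg⟩ : X ∣ C ((1 - p)⁻¹ ^ 2) * f - 1 := by
    rw [X_dvd_iff]
    simp [hf0]
    field_simp
    simp
  obtain ⟨R, hR, hR0⟩ := exists_sq_eq_one_add g
  have hi : C (1 - p) * C (1 - p)⁻¹ = (1 : ℝ⟦X⟧) := by
    rw [← map_mul, mul_inv_cancel₀ hp1', map_one]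
  have hR2 : (C (1 - p) * R) ^ 2 = f := by
    rw [map_pow] at hg
    linear_combination C (1 - p) ^ 2 * hR - C (1 - p) ^ 2 * hg
      + f * (C (1 - p) * C (1 - p)⁻¹ + 1) * hi
  -- A is defined from the formula with denominator 4pZ³(1-t³), which is always a unit. The stated
  -- denominator (1-t³)(1-2pZ) has constant term 1-2p, which vanishes for p = 1/2; its relation is
  -- deduced from the equation of Z.
  have hden : constantCoeff (4 * C p * Z ^ 3 * (1 - X ^ 3)) ≠ 0 := by
    simp [hZ0, map_ofNat, hp.ne']
  have hden' : 4 * C p * Z ^ 3 ≠ 0 := by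
    intro h0
    rw [h0] at hden
    simp at hden
  have hA := PowerSeries.mul_inv_cancel _ hden
  refine ⟨C (1 - p) * R, (4 * C p * Z ^ 3 * (1 - X ^ 3))⁻¹ *
    ((1 - (1 - 2 * C p) * Z - 2 * C p * (1 - 2 * C p) * Z ^ 2) * (C (1 - p) * R)), hR2,
    by simp [hR0], ?_, ?_⟩
  · linear_combination ((1 - (1 - 2 * C p) * Z - 2 * C p * (1 - 2 * C p) * Z ^ 2)
      * (C (1 - p) * R)) * hA
  · apply mul_left_cancel₀ hden'
    linear_combination (1 - 2 * C p * Z) * ((1 - (1 - 2 * C p) * Z - 2 * C p * (1 - 2 * C p) * Z ^ 2)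
      * (C (1 - p) * R)) * hA - (C (1 - p) * R) * hZ

/-- The relation given by the root of one of the quadratic factors. -/
theorem relation_at_root (h : Params p q r p' r' q'' r'')
    (hZ : Z = 1 + 4 * (C p * C q * C r) * X ^ 3 * Z ^ 3) (hZ0 : constantCoeff Z = 1)
    {x d R A : ℝ⟦X⟧}
    (hd : d ^ 2 = 1 - 4 * (C p * C q * C r) * X ^ 3 * Z ^ 2 * x) (hd0 : constantCoeff d = 1)
    (hR : R ^ 2 = 1 - C p * Z * (1 + Z) + C p ^ 2 * Z ^ 2) (hR0 : constantCoeff R = 1 - p)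
    (hA : (1 - X ^ 3) * (1 - 2 * C p * Z) * A = (C p * (1 - 2 * C p) - C q * C r * X ^ 3) * R)
    (hx : 1 - (1 - C p) * x + X ^ 3 * (C q * C r) * x ^ 2 = 0)
    (hx0 : constantCoeff x = 1 / (1 - p)) (hZp : 1 - 2 * C p * Z ≠ 0) :
    (2 * Z - x) * d ≠ 0 ∧ (2 * Z - x) * d * ((1 - X ^ 3) * A)
      = Z * (2 - (1 - C p) * x) * (C p * (1 - 2 * C p) - C q * C r * X ^ 3) := by
  have hp1 : p < 1 := by linarith [h.hq, h.hr, h.sum]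
  have hp1' : 1 - p ≠ 0 := by linarith
  have key := sqrt_relation h.hp hp1 hZ hZ0 hd hd0 hR hR0 hx hx0
  constructor
  · intro h0
    rw [h0, zero_mul, eq_comm] at key
    rcases mul_eq_zero.1 key with h1 | h1
    · have := congrArg constantCoeff h1
      simp [hZ0, hx0, map_ofNat] at this
      field_simp at this
      norm_num at this
    · exact hZp h1
  · apply mul_left_cancel₀ hZp
    linear_combination (2 * Z - x) * d * hA + (C p * (1 - 2 * C p) - C q * C r * X ^ 3) * key

/-- Z is not constant: its coefficient of t³ is 4pqr. So no multiple of Z can equal 1, even when the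
constant terms agree. -/
theorem one_sub_two_mul_Z_ne_zero (h : Params p q r p' r' q'' r'')
    (hZ : Z = 1 + 4 * (C p * C q * C r) * X ^ 3 * Z ^ 3) (a : ℝ) :
    1 - 2 * C a * Z ≠ 0 := by
  intro h0
  have h1 := congrArg (coeff 3) hZ
  have h2 := congrArg (coeff 3) h0
  have h3 := congrArg constantCoeff hZ
  have h4 := congrArg constantCoeff h0
  rw [mul_assoc, mul_assoc, mul_comm (X ^ 3), ← mul_assoc, ← map_mul, ← map_mul,
    ← map_ofNat (C (R := ℝ)) 4, ← mul_assoc, ← map_mul] at h1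
  simp only [map_add, coeff_one, coeff_mul_X_pow', le_refl, if_true, coeff_C_mul, Nat.sub_self] at h1
  rw [show (1 : ℝ⟦X⟧) - 2 * C a * Z = 1 - C (2 * a) * Z by simp [map_ofNat], map_sub,
    coeff_C_mul, coeff_one] at h2
  simp [map_ofNat] at h1 h2 h3 h4
  simp [h3] at h1 h4
  have hc : 4 * (p * q * r) ≠ 0 := by
    have := h.hp; have := h.hq; have := h.hr
    positivity
  rcases h2 with h2 | h2
  · subst h2
    norm_num at h4
  · apply hc
    linarith

end Constants

end QuadrantChain

/-! ### Computation of a and b, and the equation for S(x,0) -/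

namespace QuadrantChain

open PowerSeries

section MainIdentity

variable {p q r p' r' q'' r'' : ℝ} {Z : ℝ⟦X⟧} {D : (Polynomial ℝ)⟦X⟧}

/-- The relations between `√Δ₋(p/t)` and `A_{p,q}`, without denominators. -/
structure IsA (p q r : ℝ) (Z R A : ℝ⟦X⟧) : Prop where
  sq : R ^ 2 = 1 - C p * Z * (1 + Z) + C p ^ 2 * Z ^ 2
  const : constantCoeff R = 1 - p
  eq_cube : 4 * C p * Z ^ 3 * (1 - X ^ 3) * A
        = (1 - (1 - 2 * C p) * Z - 2 * C p * (1 - 2 * C p) * Z ^ 2) * R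
  eq_linear : (1 - X ^ 3) * (1 - 2 * C p * Z) * A = (C p * (1 - 2 * C p) - C q * C r * X ^ 3) * R

theorem Hpoly_comm {A : Type*} [CommRing A] (p q r t x : A) :
    Hpoly p q r t x = Hpoly q p r t x := by
  unfold Hpoly
  ring

theorem exists_root_quad (hp1 : p < 1) (q r : ℝ) :
    ∃ x : ℝ⟦X⟧, 1 - (1 - C p) * x + X ^ 3 * (C q * C r) * x ^ 2 = 0 ∧
      constantCoeff x = 1 / (1 - p) := by
  have hp1' : 1 - p ≠ 0 := by linarith
  obtain ⟨x, hx⟩ := exists_quadratic_root hp1' 1 (q * r)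
  refine ⟨x, ?_, ?_⟩
  · simp only [map_sub, map_one, map_mul] at hx
    linear_combination -hx
  · have := congrArg constantCoeff hx
    simp at this
    rw [eq_div_iff hp1', mul_comm]
    exact this

theorem quad_eq_zero_at_root {x : ℝ⟦X⟧} (hx : 1 - (1 - C p) * x + X ^ 3 * (C q * C r) * x ^ 2 = 0) :
    quad (C p) (C q * C r) X (x * X) = 0 := by
  unfold quad
  linear_combination X * hx

theorem cubic_at_root {x : ℝ⟦X⟧} (hx : 1 - (1 - C p) * x + X ^ 3 * (C q * C r) * x ^ 2 = 0) :
    cubic (C p * C q * C r) X x = (C p * (1 - C p) + C q * C r * X ^ 3) * x ^ 2 := by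
  have h1 := one_sub_mul_quad (p := C p) (q := C q) (r := C r) (t := X) (u := x)
  rw [quad_eq_zero_at_root hx, mul_zero] at h1
  have h2 := (mul_eq_zero.1 h1.symm).resolve_left X_ne_zero
  linear_combination -h2

/-- At a root of `quad` the unknown τ drops out of N and J takes a known value, so the factorisation
of N becomes a linear equation in a and b; `relation_at_root` eliminates the square root. -/
theorem constants_at_root (h : Params p q r p' r' q'' r'')
    (hZ : Z = 1 + 4 * (C p * C q * C r) * X ^ 3 * Z ^ 3) (hZ0 : constantCoeff Z = 1)
    {x d R A a b : ℝ⟦X⟧}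
    (hd : d ^ 2 = 1 - 4 * (C p * C q * C r) * X ^ 3 * Z ^ 2 * x) (hd0 : constantCoeff d = 1)
    (hA : IsA p q r Z R A)
    (hx : 1 - (1 - C p) * x + X ^ 3 * (C q * C r) * x ^ 2 = 0)
    (hx0 : constantCoeff x = 1 / (1 - p))
    (hN : C r * Hpoly (C p) (C q) (C r) X (x * X)
      = (2 * Z - x) * d * (a * cubic (C p * C q * C r) X x + b * x ^ 2)) :
    Z * (a * (C p * (1 - C p) + C q * C r * X ^ 3) + b)
      = C r * X ^ 3 * (C q - C p) * ((1 - X ^ 3) * A) := by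
  have hp1' : 1 - p ≠ 0 := by linarith [h.hq, h.hr, h.sum]
  have hsum : (C p + C q + C r : ℝ⟦X⟧) = 1 := by rw [← map_add, ← map_add, h.sum, map_one]
  obtain ⟨hW, hWA⟩ := relation_at_root h hZ hZ0 hd hd0 hA.sq hA.const hA.eq_linear hx hx0
    (one_sub_two_mul_Z_ne_zero h hZ p)
  rw [Hpoly_at_root hsum hx, cubic_at_root hx] at hN
  have hx2 : x ≠ 0 := by
    rintro rfl
    simp at hx0
    exact hp1' hx0.symm
  apply mul_left_cancel₀ (mul_ne_zero hW (pow_ne_zero 2 hx2))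
  linear_combination -Z * hN - C r * X ^ 3 * (C q - C p) * x ^ 2 * hWA

/-- For p = q the two quadratic factors coincide and yield the same linear equation. The second
equation comes from dividing the factorisation by their common factor and evaluating at the root
once more. -/
theorem constant_of_eq (h : Params p p r p' r' q'' r'')
    (hZ : Z = 1 + 4 * (C p * C p * C r) * X ^ 3 * Z ^ 3) (hZ0 : constantCoeff Z = 1)
    (hd : ∀ x : ℝ⟦X⟧, evalPoly (x * X) D ^ 2 = 1 - 4 * (C p * C p * C r) * X ^ 3 * Z ^ 2 * x)
    (hd0 : ∀ x : ℝ⟦X⟧, constantCoeff (evalPoly (x * X) D) = 1)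
    {R A a b : ℝ⟦X⟧} (hA : IsA p p r Z R A)
    (hab : a * (C p * (1 - C p) + C p * C r * X ^ 3) + b = 0)
    (hN : homogenize (Nser p p r p' r' q'' r'')
      = (2 * constX Z - C Polynomial.X) * homogenize D
        * (constX a * cubic (algebraMap ℝ _ (p * p * r)) X (C Polynomial.X)
          + constX b * C Polynomial.X ^ 2)) :
    Z * a = -2 * X ^ 3 * A := by
  obtain ⟨x, hx, hx0⟩ := exists_root_quad (p := p) (by linarith [h.hq, h.hr, h.sum]) p r
  obtain ⟨-, hWA⟩ := relation_at_root h hZ hZ0 (hd x) (hd0 x) hA.sq hA.const hA.eq_linear hx hx0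
    (one_sub_two_mul_Z_ne_zero h hZ p)
  have hp1' : 1 - p ≠ 0 := by linarith [h.hq, h.hr, h.sum]
  have hsum : (2 * C p + C r : ℝ⟦X⟧) = 1 := by
    rw [two_mul, ← map_add, ← map_add, h.sum, map_one]
  have hc : ∀ a : ℝ, algebraMap ℝ (Polynomial ℝ)⟦X⟧ a = C (Polynomial.C a) := fun a => by
    rw [PowerSeries.algebraMap_apply, Polynomial.algebraMap_eq]
  obtain ⟨P, hP⟩ : ∃ P : (Polynomial ℝ)⟦X⟧, P = C (Polynomial.C p) := ⟨_, rfl⟩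
  obtain ⟨R', hR'⟩ : ∃ R' : (Polynomial ℝ)⟦X⟧, R' = C (Polynomial.C r) := ⟨_, rfl⟩
  obtain ⟨U, hU⟩ : ∃ U : (Polynomial ℝ)⟦X⟧, U = C Polynomial.X := ⟨_, rfl⟩
  have hab' := congrArg constX hab
  simp only [map_add, map_mul, map_sub, map_one, map_C, map_X, map_pow, map_zero] at hab'
  rw [← hP, ← hR'] at hab'
  have hquad : quad P (P * R') X (U * X) ≠ 0 := by
    intro h0
    have := congrArg (coeff 1) h0
    rw [show quad P (P * R') X (U * X) = X * (1 - (1 - P) * U + X ^ 3 * (P * R' * U ^ 2)) by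
      unfold quad; ring, show (1 : ℕ) = 0 + 1 from rfl, coeff_succ_X_mul] at this
    simp [hU, hP] at this
    have := congrArg (Polynomial.eval 0) this
    simp at this
  have h1 := one_sub_mul_quad (p := P) (q := P) (r := R') (t := X) (u := U)
  -- By `hab` the factor a·`cubic` + bu² is -a(1-pu)·`quad`/t, so every term carries a factor
  -- `quad`; the extra X clears the division by t.
  have hN2 : X * (2 * P * P * (quad P (P * R') X (U * X)
        * evalPoly (U * X) (tau p p r p' r' q'' r'' Polynomial.X))
      + R' * (2 * P * (2 * X - U * X + P * (U * X)) * (X - U * X * P)))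
      = -((2 * constX Z - U) * homogenize D * constX a * (1 - P * U)) := by
    apply mul_left_cancel₀ hquad
    have e1 : homogenize (Nser p p r p' r' q'' r'') = Npoly P P R' X (U * X)
        (evalPoly (U * X) (tau p p r p' r' q'' r'' Polynomial.X)) := by
      rw [homogenize, evalPoly_Nser, hc, hc, hP, hR', hU]
    rw [e1, map_mul, map_mul, hc, hc, ← hP, ← hR', ← hU] at hN
    unfold Npoly Hpoly at hN
    linear_combination X * hN + (2 * constX Z - U) * homogenize D * constX a * h1
      + X * (2 * constX Z - U) * homogenize D * U ^ 2 * hab'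
  have hev := congrArg (evalPoly x) hN2
  simp only [quad, map_add, map_mul, map_sub, map_neg, map_one, map_pow, map_ofNat, evalPoly_X,
    evalPoly_map_C, map_algebraMap_self, hU, hP, hR', evalPoly_C, Polynomial.aeval_X,
    Polynomial.aeval_C, evalPoly_homogenize] at hev
  have hc' : ∀ a : ℝ, algebraMap ℝ ℝ⟦X⟧ a = C a := fun a => by
    rw [PowerSeries.algebraMap_apply, Algebra.algebraMap_self, RingHom.id_apply]
  rw [hc', hc'] at hev
  have hpx : 1 - C p * x ≠ 0 := by
    intro h0
    have := congrArg constantCoeff h0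
    simp [hx0] at this
    field_simp at this
    linarith [h.hr, h.sum]
  have hX3 : (1 - X ^ 3 : ℝ⟦X⟧) ≠ 0 := by
    intro h0
    have := congrArg constantCoeff h0
    simp at this
  have hW : (2 * Z - x) * evalPoly (x * X) D ≠ 0 := (relation_at_root h hZ hZ0 (hd x) (hd0 x)
    hA.sq hA.const hA.eq_linear hx hx0 (one_sub_two_mul_Z_ne_zero h hZ p)).1
  have hWA' : (2 * Z - x) * evalPoly (x * X) D * A = Z * (2 - (1 - C p) * x) * (C p * C r) := by
    apply mul_left_cancel₀ hX3
    linear_combination hWA - Z * (2 - (1 - C p) * x) * C p * hsum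
  apply mul_left_cancel₀ (mul_ne_zero hpx hW)
  linear_combination Z * hev + 2 * (1 - C p * x) * X ^ 3 * hWA'
    - 2 * Z * X ^ 2 * C p * C p * evalPoly (x * X) (tau p p r p' r' q'' r'' Polynomial.X) * hx

theorem constants_eq (h : Params p q r p' r' q'' r'')
    (hZ : Z = 1 + 4 * (C p * C q * C r) * X ^ 3 * Z ^ 3) (hZ0 : constantCoeff Z = 1)
    (hd : ∀ x : ℝ⟦X⟧, evalPoly (x * X) D ^ 2 = 1 - 4 * (C p * C q * C r) * X ^ 3 * Z ^ 2 * x)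
    (hd0 : ∀ x : ℝ⟦X⟧, constantCoeff (evalPoly (x * X) D) = 1)
    {Rp Ap Rq Aq a b : ℝ⟦X⟧} (hp : IsA p q r Z Rp Ap) (hq : IsA q p r Z Rq Aq)
    (hpq : p = q → Ap = Aq)
    (hN : homogenize (Nser p q r p' r' q'' r'')
      = (2 * constX Z - C Polynomial.X) * homogenize D
        * (constX a * cubic (algebraMap ℝ _ (p * q * r)) X (C Polynomial.X)
          + constX b * C Polynomial.X ^ 2)) :
    Z * a = -X ^ 3 * (Ap + Aq) ∧ Z * b = X ^ 3 * (Ap * (C q * (1 - C q) + C p * C r * X ^ 3)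
      + Aq * (C p * (1 - C p) + C q * C r * X ^ 3)) := by
  have hev : ∀ x : ℝ⟦X⟧, Npoly (C p) (C q) (C r) X (x * X)
      (evalPoly (x * X) (tau p q r p' r' q'' r'' Polynomial.X))
      = (2 * Z - x) * evalPoly (x * X) D
        * (a * cubic (C p * C q * C r) X x + b * x ^ 2) := by
    intro x
    have := congrArg (evalPoly x) hN
    rw [evalPoly_homogenize, evalPoly_Nser] at this
    simp only [cubic, map_mul, map_add, map_sub, map_ofNat, map_one, evalPoly_map_C, evalPoly_X,
      map_algebraMap_self, evalPoly_C, Polynomial.aeval_X, evalPoly_homogenize, map_pow,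
      evalPoly_algebraMap] at this
    exact this
  have hsum : (C p + C q + C r : ℝ⟦X⟧) = 1 := by rw [← map_add, ← map_add, h.sum, map_one]
  obtain ⟨x, hx, hx0⟩ := exists_root_quad (p := p) (by linarith [h.hq, h.hr, h.sum]) q r
  have r1 := constants_at_root h hZ hZ0 (hd x) (hd0 x) hp hx hx0 (a := a) (b := b) (by
    rw [← hev x, Npoly, quad_eq_zero_at_root hx]
    ring)
  rcases eq_or_ne p q with rfl | hne
  · obtain rfl := hpq rfl
    have hZne : Z ≠ 0 := by
      rintro rfl
      simp at hZ0
    have hab : a * (C p * (1 - C p) + C p * C r * X ^ 3) + b = 0 := by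
      rw [sub_self, mul_zero, zero_mul] at r1
      exact (mul_eq_zero.1 r1).resolve_left hZne
    have ha := constant_of_eq h hZ hZ0 hd hd0 hp hab hN
    refine ⟨by linear_combination ha, ?_⟩
    linear_combination r1 - (C p * (1 - C p) + C p * C r * X ^ 3) * ha
  · obtain ⟨y, hy, hy0⟩ := exists_root_quad (p := q) (by linarith [h.hp, h.hr, h.sum]) p r
    have hZ' : Z = 1 + 4 * (C q * C p * C r) * X ^ 3 * Z ^ 3 := by linear_combination hZ
    have hs : Params q p r q'' r'' p' r' := ⟨h.hq, h.hp, h.hr, by linarith [h.sum], h.hq'', h.hp',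
      h.hr'', h.hr'⟩
    have r2 := constants_at_root hs hZ' hZ0 (d := evalPoly (y * X) D) (a := a) (b := b)
      (by linear_combination hd y) (hd0 y) hq hy hy0 (by
        rw [mul_comm (C q) (C p), ← hev y, Npoly, Hpoly_comm, quad_eq_zero_at_root hy]
        ring)
    have hX3 : (1 - X ^ 3 : ℝ⟦X⟧) ≠ 0 := by
      intro h0
      have := congrArg constantCoeff h0
      simp at this
    have hpqr : (C p - C q : ℝ⟦X⟧) * C r ≠ 0 := by
      rw [← map_sub, ← map_mul]
      intro h0
      have := congrArg constantCoeff h0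
      simp [sub_ne_zero.2 hne, h.hr.ne'] at this
    -- The two values of J differ by (p-q)r(1-t³), the determinant of the linear system. It explains
    -- the factor 1-t³ in the denominator of A.
    have ha : Z * a = -X ^ 3 * (Ap + Aq) := by
      apply mul_left_cancel₀ (mul_ne_zero hpqr hX3)
      linear_combination r1 - r2 + Z * a * (C p - C q) * hsum
    refine ⟨ha, ?_⟩
    linear_combination r1 - (C p * (1 - C p) + C q * C r * X ^ 3) * ha
      - X ^ 3 * Ap * (C p - C q) * hsum

/-- The equation satisfied by `S(x, 0)`, with coefficients in `ℝ[x]`. -/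
theorem main_identity (h : Params p q r p' r' q'' r'')
    (hZ : Z = 1 + C (4 * p * q * r) * X ^ 3 * Z ^ 3)
    (hD : D ^ 2 = 1 - algebraMap ℝ _ (4 * p * q * r) * X ^ 2 * constX Z ^ 2 * C Polynomial.X)
    (hD' : constantCoeff D = 1)
    {Rp Ap Rq Aq : ℝ⟦X⟧} (hp : IsA p q r Z Rp Ap) (hq : IsA q p r Z Rq Aq)
    (hpq : p = q → Ap = Aq) :
    constX Z * Nser p q r p' r' q'' r'' =
      (2 * X * constX Z - C Polynomial.X) * D *
        (constX Ap * ((X - C Polynomial.X * algebraMap ℝ _ q)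
            * quad (algebraMap ℝ _ q) (algebraMap ℝ _ p * algebraMap ℝ _ r) X (C Polynomial.X))
          + constX Aq * ((X - C Polynomial.X * algebraMap ℝ _ p)
            * quad (algebraMap ℝ _ p) (algebraMap ℝ _ q * algebraMap ℝ _ r) X (C Polynomial.X))) := by
  have e4 : 4 * p * q * r = 4 * (p * q * r) := by ring
  rw [e4] at hZ hD
  have hZ0 := constantCoeff_Z hZ
  have hZ4 : Z = 1 + 4 * (C p * C q * C r) * X ^ 3 * Z ^ 3 := by
    simpa [map_ofNat] using hZ
  obtain ⟨a, b, hN⟩ := homogenize_Nser_eq h hZ hD hD'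
  obtain ⟨ha, hb⟩ := constants_eq h hZ4 hZ0 (fun x => by
      rw [evalPoly_sqrtDeltaPlus hD]; simp [map_ofNat])
    (constantCoeff_evalPoly_sqrtDeltaPlus hD') hp hq hpq hN
  have ha' := congrArg constX ha
  have hb' := congrArg constX hb
  simp only [map_add, map_mul, map_sub, map_one, map_C, map_X, map_pow, map_neg] at ha' hb'
  -- The factorisation is known in the variable u = x/t, so the identity is compared after the
  -- substitution x = ut.
  apply homogenize_injective
  have eZ : ∀ F : ℝ⟦X⟧, homogenize (constX F) = constX F := evalPoly_map_C _
  rw [map_mul, hN, eZ]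
  simp only [quad, map_add, map_mul, map_sub, map_one, map_pow, map_ofNat, eZ, evalPoly_X, evalPoly_C,
    Polynomial.aeval_X, evalPoly_algebraMap, cubic]
  simp only [PowerSeries.algebraMap_apply, Polynomial.algebraMap_eq]
  generalize constX Z = z at *
  generalize constX a = a' at *
  generalize constX b = b' at *
  generalize constX Ap = A₁ at *
  generalize constX Aq = A₂ at *
  generalize homogenize D = d
  generalize (C (Polynomial.C p) : (Polynomial ℝ)⟦X⟧) = P at *
  generalize (C (Polynomial.C q) : (Polynomial ℝ)⟦X⟧) = Q at *
  generalize (C (Polynomial.C r) : (Polynomial ℝ)⟦X⟧) = R at *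
  generalize (C Polynomial.X : (Polynomial ℝ)⟦X⟧) = u at *
  linear_combination (2 * z - u) * d * ((u - 1 + P * Q * R * X ^ 3 * u ^ 3) * ha' + u ^ 2 * hb')

end MainIdentity

end QuadrantChain

/-! ### The explicit expressions in fields of Laurent series -/

namespace QuadrantChain

section Transfer

theorem tvar_eq (K : Type) [Field K] : tvar K = ((PowerSeries.X : K⟦X⟧) : K⸨X⸩) := HahnSeries.ofPowerSeries_X.symm

theorem C_eq {K : Type} [Field K] (a : K) : (HahnSeries.C a : K⸨X⸩) = ((PowerSeries.C a : K⟦X⟧) : K⸨X⸩) :=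
  (HahnSeries.ofPowerSeries_C a).symm

theorem tvar_ne_zero {K : Type} [Field K] : tvar K ≠ 0 := by
  rw [tvar_eq]
  exact (map_ne_zero_iff _ HahnSeries.ofPowerSeries_injective).2 PowerSeries.X_ne_zero

variable {K : Type} [Field K] [Algebra ℝ K] {p q r p' r' q'' r'' : ℝ}

theorem cst_eq (s : ℝ) : cst K s = ((algebraMap ℝ K⟦X⟧ s : K⟦X⟧) : K⸨X⸩) := by
  rw [cst, C_eq, PowerSeries.algebraMap_apply]

theorem cst_ne_zero {s : ℝ} (hs : s ≠ 0) : cst K s ≠ 0 := by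
  rw [cst]
  exact (map_ne_zero_iff _ HahnSeries.C_injective).2
    ((map_ne_zero_iff _ (algebraMap ℝ K).injective).2 hs)

theorem C_smul (s : ℝ) (a : K) :
    (PowerSeries.C (s • a) : K⟦X⟧) = algebraMap ℝ K⟦X⟧ s * PowerSeries.C a := by
  rw [Algebra.smul_def, map_mul, PowerSeries.algebraMap_apply]

theorem Sser_zero (h : Params p q r p' r' q'' r'') (a : K) :
    (Sser p q r p' r' q'' r'' a 0 : K⸨X⸩)
      = tvar K * ((tau p q r p' r' q'' r'' a : K⟦X⟧) : K⸨X⸩) := by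
  rw [Sser_eq h, Sgen_zero, map_mul, tvar_eq]

theorem Sser_eq_div (h : Params p q r p' r' q'' r'') {a b : K} (ha : a ≠ 0) (hb : b ≠ 0) :
    (Sser p q r p' r' q'' r'' a b : K⸨X⸩) =
      (Gexpr (cst K p) (cst K q) (cst K r) (tvar K) (HahnSeries.C a) (HahnSeries.C b)
        + Gexpr (cst K p) (cst K q) (cst K r) (tvar K) (HahnSeries.C b) (HahnSeries.C a)
        - (tvar K - cst K p * HahnSeries.C b) * (tvar K - cst K q * HahnSeries.C b)
          * HahnSeries.C a * (Sser p q r p' r' q'' r'' a 0 : K⸨X⸩)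
        - (tvar K - cst K p * HahnSeries.C a) * (tvar K - cst K q * HahnSeries.C a)
          * HahnSeries.C b * (Sser p q r p' r' q'' r'' 0 b : K⸨X⸩)) /
      (tvar K * (HahnSeries.C a * HahnSeries.C b - tvar K * (HahnSeries.C a + HahnSeries.C b
        + cst K p * cst K q * cst K r * HahnSeries.C a ^ 2 * HahnSeries.C b ^ 2))) := by
  have hcomm : Sser p q r p' r' q'' r'' 0 b = Sser p q r p' r' q'' r'' b 0 := by
    rw [Sser_eq h, Sser_eq h, Sgen_comm]
  have key := congrArg (fun F : K⟦X⟧ => (F : K⸨X⸩)) (Sgen_kernel h a b)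
  simp only [C_smul, map_add, map_sub, map_mul, map_pow] at key
  rw [hcomm, Sser_zero h, Sser_zero h, Sser_eq h, eq_div_iff]
  · rw [tvar_eq, cst_eq, cst_eq, cst_eq, C_eq, C_eq]
    unfold Gexpr
    linear_combination ((PowerSeries.X : K⟦X⟧) : K⸨X⸩) * key
  · refine mul_ne_zero tvar_ne_zero fun h0 => ?_
    rw [tvar_eq, cst_eq, cst_eq, cst_eq, C_eq, C_eq] at h0
    simp only [← map_mul, ← map_add, ← map_sub, ← map_pow] at h0
    have h1 := (map_eq_zero_iff _ HahnSeries.ofPowerSeries_injective).1 h0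
    have := congrArg PowerSeries.constantCoeff h1
    simp [ha, hb] at this

theorem map_aeval_constX (a : K) (F : ℝ⟦X⟧) :
    PowerSeries.map (Polynomial.aeval a : Polynomial ℝ →ₐ[ℝ] K).toRingHom (constX F)
      = PowerSeries.map (algebraMap ℝ K) F := by
  ext n
  simp

theorem map_aeval_algebraMap (a : K) (s : ℝ) :
    PowerSeries.map (Polynomial.aeval a : Polynomial ℝ →ₐ[ℝ] K).toRingHom
      (algebraMap ℝ (Polynomial ℝ)⟦X⟧ s) = algebraMap ℝ K⟦X⟧ s := by
  rw [PowerSeries.algebraMap_apply, PowerSeries.algebraMap_apply, PowerSeries.map_C]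
  simp

/-- The equation satisfied by `S(a, 0)`. -/
theorem Sser_zero_eq (h : Params p q r p' r' q'' r'') {Z : ℝ⟦X⟧} {D : (Polynomial ℝ)⟦X⟧}
    (hZ : Z = 1 + PowerSeries.C (4 * p * q * r) * PowerSeries.X ^ 3 * Z ^ 3)
    (hD : D ^ 2 = 1 - algebraMap ℝ _ (4 * p * q * r) * PowerSeries.X ^ 2 * constX Z ^ 2
      * PowerSeries.C Polynomial.X)
    (hD' : PowerSeries.constantCoeff D = 1)
    {Rp Ap Rq Aq : ℝ⟦X⟧} (hp : IsA p q r Z Rp Ap) (hq : IsA q p r Z Rq Aq)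
    (hpq : p = q → Ap = Aq) (a : K) :
    let t := tvar K
    let P := cst K p
    let Q := cst K q
    let R := cst K r
    let x : K⸨X⸩ := HahnSeries.C a
    let z := emb K Z
    let S : K⸨X⸩ := Sser p q r p' r' q'' r'' a 0
    (t - (1 - P) * x + t ^ 2 * Q * R * x ^ 2) *
        (t - (1 - Q) * x + t ^ 2 * P * R * x ^ 2) * (S / t)
      + R * Hexpr P Q R t x / (2 * P * Q) =
    (2 * t * z - x) *
      ((PowerSeries.map (Polynomial.aeval a : Polynomial ℝ →ₐ[ℝ] K).toRingHom D : K⟦X⟧) : K⸨X⸩)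
        / (2 * P * Q * z) *
      (emb K Ap * Fexpr P Q R t x + emb K Aq * Fexpr Q P R t x) := by
  intro t P Q R x z S
  have hZ0 := constantCoeff_Z hZ
  have ht : t ≠ 0 := tvar_ne_zero
  have hP : P ≠ 0 := cst_ne_zero h.hp.ne'
  have hQ : Q ≠ 0 := cst_ne_zero h.hq.ne'
  have hz : z ≠ 0 := by
    refine (map_ne_zero_iff _ HahnSeries.ofPowerSeries_injective).2 fun h0 => ?_
    have := congrArg PowerSeries.constantCoeff h0
    rw [← PowerSeries.coeff_zero_eq_constantCoeff_apply, PowerSeries.coeff_map,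
      PowerSeries.coeff_zero_eq_constantCoeff_apply, hZ0] at this
    simp at this
  have h2 : (2 : K⸨X⸩) ≠ 0 := by
    have : cst K 2 ≠ 0 := cst_ne_zero two_ne_zero
    rwa [cst, map_ofNat, map_ofNat] at this
  have hS : S / t = ((tau p q r p' r' q'' r'' a : K⟦X⟧) : K⸨X⸩) := by
    rw [div_eq_iff ht, mul_comm]
    exact Sser_zero h a
  have key := congrArg (fun F => ((PowerSeries.map
    (Polynomial.aeval a : Polynomial ℝ →ₐ[ℝ] K).toRingHom F : K⟦X⟧) : K⸨X⸩))
    (main_identity h hZ hD hD' hp hq hpq)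
  have ht' := tau_map (p := p) (q := q) (r := r) (p' := p') (r' := r') (q'' := q'') (r'' := r'')
    (Polynomial.aeval a : Polynomial ℝ →ₐ[ℝ] K) Polynomial.X
  rw [Polynomial.aeval_X] at ht'
  simp only [Nser, Npoly, Hpoly, quad, map_mul, map_add, map_sub, map_pow, map_one, map_ofNat,
    map_aeval_constX, map_aeval_algebraMap, PowerSeries.map_X, PowerSeries.map_C, ht'] at key
  simp only [AlgHom.toRingHom_eq_coe, RingHom.coe_coe, Polynomial.aeval_X, ← cst_eq, ← tvar_eq,
    ← C_eq] at key
  rw [hS]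
  simp only [AlgHom.toRingHom_eq_coe, emb]
  have et : tvar K = t := rfl
  have eP : cst K p = P := rfl
  have eQ : cst K q = Q := rfl
  have eR : cst K r = R := rfl
  have ex : HahnSeries.C a = x := rfl
  have ez : HahnSeries.ofPowerSeries ℤ K (PowerSeries.map (algebraMap ℝ K) Z) = z := rfl
  clear_value t P Q R x z
  rw [et, eP, eQ, eR, ex, ez] at key
  generalize ((tau p q r p' r' q'' r'' a : K⟦X⟧) : K⸨X⸩) = τ at *
  generalize HahnSeries.ofPowerSeries ℤ K (PowerSeries.map
    (↑(Polynomial.aeval a : Polynomial ℝ →ₐ[ℝ] K)) D) = d at *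
  generalize HahnSeries.ofPowerSeries ℤ K (PowerSeries.map (algebraMap ℝ K) Ap) = A₁ at *
  generalize HahnSeries.ofPowerSeries ℤ K (PowerSeries.map (algebraMap ℝ K) Aq) = A₂ at *
  unfold Hexpr Fexpr
  field_simp
  linear_combination key

end Transfer

/-! ### The value at x = 0 -/

section Specialisations

variable {p q r p' r' q'' r'' : ℝ}

theorem tau_zero :
    tau p q r p' r' q'' r'' (0 : ℝ) = 2 * PowerSeries.X * P00 ℝ p q r p' r' q'' r'' := by
  have : Qgen p q r p' r' q'' r'' (0 : ℝ) 0 = P00 ℝ p q r p' r' q'' r'' := by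
    ext n
    rw [Qgen, P00, PowerSeries.coeff_mk, PowerSeries.coeff_mk, gen_eq,
      sum_mul_zero_pow _ _ n.succ_pos, sum_mul_zero_pow _ _ n.succ_pos, mass, weight, one_mul]
  rw [tau, smul_zero, smul_zero, this, map_zero]
  ring

theorem Sser_zero_zero (h : Params p q r p' r' q'' r'') :
    Sser p q r p' r' q'' r'' (0 : ℝ) 0
      = 2 * PowerSeries.X ^ 2 * P00 ℝ p q r p' r' q'' r'' := by
  rw [Sser_eq h, Sgen_zero, tau_zero]
  ring

/-- At x = 0 both quadratic factors reduce to t, √Δ₊ to 1 and H to 2(p+q)t³, while τ is 2t·P₀₀; the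
common factor 2t³Z cancels. -/
theorem P00_eq (h : Params p q r p' r' q'' r'') {Z : ℝ⟦X⟧} {D : (Polynomial ℝ)⟦X⟧}
    (hZ : Z = 1 + PowerSeries.C (4 * p * q * r) * PowerSeries.X ^ 3 * Z ^ 3)
    (hD : D ^ 2 = 1 - algebraMap ℝ _ (4 * p * q * r) * PowerSeries.X ^ 2 * constX Z ^ 2
      * PowerSeries.C Polynomial.X)
    (hD' : PowerSeries.constantCoeff D = 1)
    {Rp Ap Rq Aq : ℝ⟦X⟧} (hp : IsA p q r Z Rp Ap) (hq : IsA q p r Z Rq Aq)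
    (hpq : p = q → Ap = Aq) :
    PowerSeries.C (2 * p * q) * P00 ℝ p q r p' r' q'' r'' + PowerSeries.C (r * (1 - r))
      = Ap + Aq := by
  have hZ0 := constantCoeff_Z hZ
  have hZ' : Z ≠ 0 := by
    rintro rfl
    simp at hZ0
  have key := congrArg (PowerSeries.map (Polynomial.aeval (0 : ℝ)).toRingHom)
    (main_identity h hZ hD hD' hp hq hpq)
  have ht' := tau_map (p := p) (q := q) (r := r) (p' := p') (r' := r') (q'' := q'') (r'' := r'')
    (Polynomial.aeval (0 : ℝ) : Polynomial ℝ →ₐ[ℝ] ℝ) Polynomial.X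
  rw [Polynomial.aeval_X, tau_zero] at ht'
  set d := PowerSeries.map (Polynomial.aeval (0 : ℝ)).toRingHom D with hd
  have hd1 : d = 1 := by
    have h1 := congrArg (PowerSeries.map (Polynomial.aeval (0 : ℝ)).toRingHom) hD
    simp only [map_sub, map_one, map_mul, map_pow, PowerSeries.map_C] at h1
    rw [← hd] at h1
    have h2 : d ^ 2 = 1 ^ 2 := by
      rw [h1]; simp
    refine (sq_eq_sq_iff_eq_or_eq_neg.1 h2).resolve_right fun h3 => ?_
    have := congrArg PowerSeries.constantCoeff h3
    rw [hd, ← PowerSeries.coeff_zero_eq_constantCoeff_apply, PowerSeries.coeff_map,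
      PowerSeries.coeff_zero_eq_constantCoeff_apply, hD'] at this
    norm_num at this
  simp only [Nser, Npoly, Hpoly, quad, map_mul, map_add, map_sub, map_pow, map_one, map_ofNat,
    map_aeval_constX, map_aeval_algebraMap, PowerSeries.map_X, PowerSeries.map_C, ht', ← hd, hd1] at key
  simp only [AlgHom.toRingHom_eq_coe, RingHom.coe_coe, Polynomial.aeval_X, map_zero,
    PowerSeries.algebraMap_apply, Algebra.algebraMap_self, RingHom.id_apply,
    PowerSeries.map_id, id_eq] at key
  have hsum : (PowerSeries.C p + PowerSeries.C q + PowerSeries.C r : ℝ⟦X⟧) = 1 := by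
    rw [← map_add, ← map_add, h.sum, map_one]
  have h2 : (2 : ℝ⟦X⟧) ≠ 0 := by
    intro h0
    have := congrArg PowerSeries.constantCoeff h0
    simp [map_ofNat] at this
  have hne : (2 * PowerSeries.X ^ 3 * Z : ℝ⟦X⟧) ≠ 0 :=
    mul_ne_zero (mul_ne_zero h2 (pow_ne_zero 3 PowerSeries.X_ne_zero)) hZ'
  simp only [map_mul, map_sub, map_one, map_ofNat]
  apply mul_left_cancel₀ hne
  linear_combination key - 2 * PowerSeries.X ^ 3 * Z * PowerSeries.C r * hsum

end Specialisations

end QuadrantChain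

/-! ### Algebraicity -/

namespace QuadrantChain

open PowerSeries

section General

/-- If no relation existed, F and the variables would be algebraically independent, and F
transcendental over the subalgebra generated by the variables. This lets closure properties of
algebraic elements replace explicit polynomials. -/
theorem isAlgSeries_of_isAlgebraic {A : Type} [CommRing A] [Nontrivial A] [Algebra ℝ A] {k : ℕ}
    {v : Fin k → A} {F : A} (h : IsAlgebraic (Algebra.adjoin ℝ (Set.range v)) F) :
    IsAlgSeries v F := by
  by_contra hF
  have hind : AlgebraicIndependent ℝ (Fin.cons F v : Fin (k + 1) → A) := by
    rw [algebraicIndependent_iff]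
    intro P hP
    by_contra hP0
    exact hF ⟨P, hP0, hP⟩
  have h1 := hind.transcendental_adjoin (s := {0}ᶜ) (i := 0) (by simp)
  have h2 : (Fin.cons F v : Fin (k + 1) → A) '' {0}ᶜ = Set.range v := by
    ext a
    constructor
    · rintro ⟨i, hi, rfl⟩
      obtain ⟨j, rfl⟩ := Fin.exists_succ_eq.2 hi
      exact ⟨j, by simp⟩
    · rintro ⟨j, rfl⟩
      exact ⟨j.succ, by simp, by simp⟩
  rw [h2, Fin.cons_zero] at h1
  exact h1 h

variable {A : Type} [CommRing A] [IsDomain A] [Algebra ℝ A]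

/-- The elements that are algebraic over a subalgebra. -/
noncomputable def algOver (T : Subalgebra ℝ A) : Subalgebra T A := Subalgebra.algebraicClosure T A

variable {T : Subalgebra ℝ A}

theorem mem_algOver_of_mem {a : A} (ha : a ∈ T) : a ∈ algOver T :=
  isAlgebraic_algebraMap (⟨a, ha⟩ : T)

theorem algebraMap_mem_algOver (s : ℝ) : algebraMap ℝ A s ∈ algOver T :=
  mem_algOver_of_mem (T.algebraMap_mem s)

theorem mem_algOver_of_mul {a b : A} (ha0 : a ≠ 0) (ha : a ∈ algOver T) (hab : a * b ∈ algOver T) :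
    b ∈ algOver T :=
  IsAlgebraic.of_mul (mem_nonZeroDivisors_of_ne_zero ha0) ha hab

theorem mem_algOver_of_linear {z m n τ rest rhs : A} (h : z * (m * (n * τ) + rest) = rhs)
    (hne : z * (m * n) ≠ 0) (hz : z ∈ algOver T) (hmn : m * n ∈ algOver T)
    (hrest : rest ∈ algOver T) (hrhs : rhs ∈ algOver T) : τ ∈ algOver T := by
  refine mem_algOver_of_mul hne (mul_mem hz hmn) ?_
  have : z * (m * n) * τ = rhs - z * rest := by rw [← h]; ring
  rw [this]
  exact sub_mem hrhs (mul_mem hz hrest)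

theorem quad_mem_algOver {a b t x : A} (ha : a ∈ algOver T) (hb : b ∈ algOver T)
    (ht : t ∈ algOver T) (hx : x ∈ algOver T) : quad a b t x ∈ algOver T :=
  add_mem (sub_mem ht (mul_mem (sub_mem (one_mem _) ha) hx))
    (mul_mem (mul_mem (pow_mem ht 2) hb) (pow_mem hx 2))

theorem Hpoly_mem_algOver {p q r t x : A} (hp : p ∈ algOver T) (hq : q ∈ algOver T)
    (hr : r ∈ algOver T) (ht : t ∈ algOver T) (hx : x ∈ algOver T) :
    Hpoly p q r t x ∈ algOver T := by
  have h2 : (2 : A) ∈ algOver T := ofNat_mem _ 2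
  have h1 : (1 : A) ∈ algOver T := one_mem _
  have q1 := quad_mem_algOver hp (mul_mem hq hr) ht hx
  have q2 := quad_mem_algOver hq (mul_mem hp hr) ht hx
  unfold Hpoly
  repeat' first | assumption | apply add_mem | apply sub_mem | apply pow_mem | apply mul_mem

/-- `Npoly` is affine in τ, so the equation of S(x,0) can be solved for τ as soon as its leading
coefficient is nonzero. -/
theorem mem_algOver_of_Npoly {p q r t x z d a b τ : A} (hp : p ∈ algOver T) (hq : q ∈ algOver T)
    (hr : r ∈ algOver T) (ht : t ∈ algOver T) (hx : x ∈ algOver T) (hz : z ∈ algOver T)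
    (hd : d ∈ algOver T) (ha : a ∈ algOver T) (hb : b ∈ algOver T)
    (h : z * Npoly p q r t x τ = (2 * t * z - x) * d
      * (a * ((t - x * q) * quad q (p * r) t x) + b * ((t - x * p) * quad p (q * r) t x)))
    (hne : z * (2 * p * q * (quad p (q * r) t x * quad q (p * r) t x)) ≠ 0) :
    τ ∈ algOver T := by
  have h2 : (2 : A) ∈ algOver T := ofNat_mem _ 2
  have q1 := quad_mem_algOver hp (mul_mem hq hr) ht hx
  have q2 := quad_mem_algOver hq (mul_mem hp hr) ht hx
  have hH := mul_mem hr (Hpoly_mem_algOver hp hq hr ht hx)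
  refine mem_algOver_of_linear h hne hz ?_ hH ?_
  all_goals
    repeat' first | assumption | apply add_mem | apply sub_mem | apply mul_mem

theorem mem_algOver_of_sq {a : A} (h : a ^ 2 ∈ algOver T) : a ∈ algOver T :=
  IsAlgebraic.of_pow two_pos h

theorem mem_algOver_of_cubic {a c : A} (hc : c ∈ T) (h : a = 1 + c * a ^ 3) : a ∈ algOver T := by
  refine ⟨Polynomial.C ⟨c, hc⟩ * Polynomial.X ^ 3 - Polynomial.X + 1, fun h0 => ?_, ?_⟩
  · have := congrArg (Polynomial.coeff · 0) h0
    simp at this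
  · simp only [map_add, map_sub, map_mul, map_pow, Polynomial.aeval_X, Polynomial.aeval_C, map_one]
    have : algebraMap T A ⟨c, hc⟩ = c := rfl
    rw [this]
    linear_combination -h

end General

section Series

variable {K : Type} [Field K] [Algebra ℝ K] {T : Subalgebra ℝ K⟦X⟧}
  {p q r p' r' q'' r'' : ℝ} {Z : ℝ⟦X⟧}

theorem map_algebraMap_C (s : ℝ) :
    PowerSeries.map (algebraMap ℝ K) (C s) = algebraMap ℝ K⟦X⟧ s := by
  rw [map_C, PowerSeries.algebraMap_apply]

theorem map_Z_mem_algOver {k : ℝ} (hX : (X : K⟦X⟧) ∈ T) (hZ : Z = 1 + C k * X ^ 3 * Z ^ 3) :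
    PowerSeries.map (algebraMap ℝ K) Z ∈ algOver T := by
  refine mem_algOver_of_cubic (T.mul_mem (T.algebraMap_mem k) (T.pow_mem hX 3)) ?_
  have := congrArg (PowerSeries.map (algebraMap ℝ K)) hZ
  simpa only [map_add, map_one, map_mul, map_pow, map_X, map_algebraMap_C] using this

theorem isA_factor_ne_zero (h : Params p q r p' r' q'' r'')
    (hZ : Z = 1 + C (4 * p * q * r) * X ^ 3 * Z ^ 3) (a : ℝ) :
    (1 - X ^ 3) * (1 - 2 * C a * Z) ≠ 0 := by
  have hZ4 : Z = 1 + 4 * (C p * C q * C r) * X ^ 3 * Z ^ 3 := by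
    nth_rewrite 1 [hZ]
    simp only [map_mul, map_ofNat]
    ring
  refine mul_ne_zero (fun h0 => ?_) (one_sub_two_mul_Z_ne_zero h hZ4 a)
  have := congrArg constantCoeff h0
  simp at this

theorem map_A_mem_algOver (hX : (X : K⟦X⟧) ∈ T) (h : Params p q r p' r' q'' r'')
    (hZ : Z = 1 + C (4 * p * q * r) * X ^ 3 * Z ^ 3) {a b : ℝ} {R A : ℝ⟦X⟧} (hA : IsA a b r Z R A) :
    PowerSeries.map (algebraMap ℝ K) A ∈ algOver T := by
  have hX' := mem_algOver_of_mem hX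
  have hZm := map_Z_mem_algOver hX hZ
  have hR := congrArg (PowerSeries.map (algebraMap ℝ K)) hA.sq
  have hAl := congrArg (PowerSeries.map (algebraMap ℝ K)) hA.eq_linear
  have hne := isA_factor_ne_zero h hZ a
  have hne' : PowerSeries.map (algebraMap ℝ K) ((1 - X ^ 3) * (1 - 2 * C a * Z)) ≠ 0 :=
    (map_ne_zero_iff _ (PowerSeries.map_injective _ (algebraMap ℝ K).injective)).2 hne
  simp only [map_add, map_one, map_mul, map_pow, map_X, map_algebraMap_C, map_sub, map_ofNat]
    at hR hAl hne'
  have hc : ∀ s, algebraMap ℝ K⟦X⟧ s ∈ algOver T := algebraMap_mem_algOver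
  have h2 : (2 : K⟦X⟧) ∈ algOver T := ofNat_mem _ 2
  have hR' : PowerSeries.map (algebraMap ℝ K) R ∈ algOver T := by
    apply mem_algOver_of_sq
    rw [hR]
    apply_rules [add_mem, sub_mem, mul_mem, pow_mem, one_mem]
  apply mem_algOver_of_mul hne'
  · apply_rules [add_mem, sub_mem, mul_mem, pow_mem, one_mem]
  · rw [hAl]
    apply_rules [add_mem, sub_mem, mul_mem, pow_mem, one_mem]

theorem tau_mem_algOver (hX : (X : K⟦X⟧) ∈ T) (h : Params p q r p' r' q'' r'')
    (hZ : Z = 1 + C (4 * p * q * r) * X ^ 3 * Z ^ 3) {D : (Polynomial ℝ)⟦X⟧}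
    (hD : D ^ 2 = 1 - algebraMap ℝ _ (4 * p * q * r) * X ^ 2 * constX Z ^ 2 * C Polynomial.X)
    (hD' : constantCoeff D = 1)
    {Rp Ap Rq Aq : ℝ⟦X⟧} (hp : IsA p q r Z Rp Ap) (hq : IsA q p r Z Rq Aq)
    (hpq : p = q → Ap = Aq) {a : K} (ha : (C a : K⟦X⟧) ∈ T) :
    tau p q r p' r' q'' r'' a ∈ algOver T := by
  have hX' := mem_algOver_of_mem hX
  have ha' := mem_algOver_of_mem ha
  have hZm := map_Z_mem_algOver hX hZ
  have hAp := map_A_mem_algOver hX h hZ hp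
  have hAq := map_A_mem_algOver hX h hZ hq
  have hc : ∀ s, algebraMap ℝ K⟦X⟧ s ∈ algOver T := algebraMap_mem_algOver
  have h2 : (2 : K⟦X⟧) ∈ algOver T := ofNat_mem _ 2
  set ev := PowerSeries.map (Polynomial.aeval a : Polynomial ℝ →ₐ[ℝ] K).toRingHom with hev
  have hDm : ev D ∈ algOver T := by
    have h1 := congrArg ev hD
    simp only [hev, map_sub, map_one, map_mul, map_pow, map_aeval_constX, map_aeval_algebraMap,
      map_X, map_C] at h1
    simp only [AlgHom.toRingHom_eq_coe, RingHom.coe_coe, Polynomial.aeval_X] at h1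
    apply mem_algOver_of_sq
    simp only [hev, AlgHom.toRingHom_eq_coe]
    rw [h1]
    have := hc (4 * p * q * r)
    simp only [map_mul] at this
    apply_rules [add_mem, sub_mem, mul_mem, pow_mem, one_mem]
  have key := congrArg ev (main_identity h hZ hD hD' hp hq hpq)
  have ht' := tau_map (p := p) (q := q) (r := r) (p' := p') (r' := r') (q'' := q'') (r'' := r'')
    (Polynomial.aeval a : Polynomial ℝ →ₐ[ℝ] K) Polynomial.X
  rw [Polynomial.aeval_X] at ht'
  have hx : ev (C Polynomial.X) = C a := by
    rw [hev, map_C]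
    simp
  have hquad' : ∀ a b t x, ev (quad a b t x) = quad (ev a) (ev b) (ev t) (ev x) := by
    intro a b t x
    simp only [quad, map_add, map_sub, map_mul, map_pow, map_one]
  have ec : ∀ s, ev (algebraMap ℝ _ s) = algebraMap ℝ _ s := map_aeval_algebraMap a
  have eF : ∀ F, ev (constX F) = PowerSeries.map (algebraMap ℝ K) F := map_aeval_constX a
  have eX : ev X = X := map_X _
  simp only [Nser, map_mul, map_add, map_sub, map_ofNat, map_Npoly, hquad', ec, eF, eX, hx] at key
  rw [ht'] at key
  -- The coefficient of t is 1 whatever s, k and a are, so a = 0 is not exceptional.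
  have hquad : ∀ s k : ℝ, (X - (1 - algebraMap ℝ K⟦X⟧ s) * C a
      + X ^ 2 * algebraMap ℝ K⟦X⟧ k * C a ^ 2 : K⟦X⟧) ≠ 0 := by
    intro s k h0
    have := congrArg (coeff 1) h0
    rw [mul_assoc, map_add, coeff_X_pow_mul', map_sub, coeff_one_X] at this
    rw [PowerSeries.algebraMap_apply, ← map_one C, ← map_sub, ← map_mul, coeff_C] at this
    simp at this
  have hZ0 : PowerSeries.map (algebraMap ℝ K) Z ≠ 0 := by
    refine (map_ne_zero_iff _ (PowerSeries.map_injective _ (algebraMap ℝ K).injective)).2 ?_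
    rintro rfl
    simpa using constantCoeff_Z hZ
  have hne : ∀ s : ℝ, s ≠ 0 → algebraMap ℝ K⟦X⟧ s ≠ 0 := fun s hs =>
    (map_ne_zero_iff _ (algebraMap ℝ K⟦X⟧).injective).2 hs
  have h20 : (2 : K⟦X⟧) ≠ 0 := by
    have := hne 2 two_ne_zero
    rwa [map_ofNat] at this
  have q1 := hquad p (q * r)
  have q2 := hquad q (p * r)
  rw [map_mul] at q1 q2
  exact mem_algOver_of_Npoly (hc p) (hc q) (hc r) hX' ha' hZm hDm hAp hAq key
    (mul_ne_zero hZ0 (mul_ne_zero (mul_ne_zero (mul_ne_zero h20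
      (hne p h.hp.ne')) (hne q h.hq.ne')) (mul_ne_zero q1 q2)))

theorem Sgen_mem_algOver (hX : (X : K⟦X⟧) ∈ T) {a b : K} (h : Params p q r p' r' q'' r'')
    (ha0 : a ≠ 0) (hb0 : b ≠ 0) (ha : (C a : K⟦X⟧) ∈ T) (hb : (C b : K⟦X⟧) ∈ T)
    (hta : tau p q r p' r' q'' r'' a ∈ algOver T) (htb : tau p q r p' r' q'' r'' b ∈ algOver T) :
    Sgen p q r p' r' q'' r'' a b ∈ algOver T := by
  have hX' := mem_algOver_of_mem hX
  have ha' := mem_algOver_of_mem ha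
  have hb' := mem_algOver_of_mem hb
  have hc : ∀ s, algebraMap ℝ K⟦X⟧ s ∈ algOver T := algebraMap_mem_algOver
  have key := Sgen_kernel h a b
  have hne : (C (a * b) - X * C (a + b + (p * q * r) • (a ^ 2 * b ^ 2)) : K⟦X⟧) ≠ 0 := by
    intro h0
    have := congrArg constantCoeff h0
    simp [ha0, hb0] at this
  refine mem_algOver_of_mul hne ?_ ?_
  · rw [map_add, map_add, C_smul]
    simp only [map_mul, map_pow]
    repeat' first
      | assumption | apply hc | apply add_mem | apply sub_mem | apply pow_mem | apply mul_mem
  · rw [key]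
    simp only [C_smul, map_mul]
    repeat' first
      | assumption | apply hc | apply add_mem | apply sub_mem | apply pow_mem | apply mul_mem

end Series

end QuadrantChain

/-! ### Degrees of sums of two square roots over a cubic extension -/

namespace QuadrantChain

section FieldTheory

open Polynomial IntermediateField

variable {E L : Type*} [Field E] [Field L] [Algebra E L]

section Quartic

variable {A B : L} {a b : E}

theorem eq_zero_of_add_mul_eq_zero (hA : A ∉ Set.range (algebraMap E L)) {x y : E}
    (h : algebraMap E L x + algebraMap E L y * A = 0) : x = 0 ∧ y = 0 := by
  have hy : y = 0 := by
    by_contra hy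
    have hy' : algebraMap E L y ≠ 0 := (_root_.map_ne_zero _).2 hy
    refine hA ⟨-x / y, ?_⟩
    rw [map_div₀, map_neg, div_eq_iff hy']
    linear_combination -h
  subst hy
  simpa using h

theorem minpoly_sqrt (hA : A ∉ Set.range (algebraMap E L)) (hAa : A ^ 2 = algebraMap E L a) :
    minpoly E A = X ^ 2 - C a := by
  refine (minpoly.eq_of_irreducible_of_monic ?_ (by simp [hAa]) (monic_X_pow_sub_C a two_ne_zero)).symm
  refine irreducible_of_degree_le_three_of_not_isRoot (by simp) fun x hx => ?_
  have h1 : x ^ 2 = a := by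
    have : x ^ 2 - a = 0 := by simpa using hx
    linear_combination this
  rw [← h1, map_pow, sq_eq_sq_iff_eq_or_eq_neg] at hAa
  rcases hAa with h2 | h2
  · exact hA ⟨x, h2.symm⟩
  · exact hA ⟨-x, by rw [h2, map_neg]⟩

variable [CharZero E]

/-- Multiplying the relation by its conjugate for each of the three sign changes leaves a relation
over E in A, B or AB alone. Each gives one quadratic equation between the four coordinates. -/
theorem eq_zero_of_biquadratic (hA : A ∉ Set.range (algebraMap E L))
    (hB : B ∉ Set.range (algebraMap E L)) (hAB : A * B ∉ Set.range (algebraMap E L))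
    (hAa : A ^ 2 = algebraMap E L a) (hBb : B ^ 2 = algebraMap E L b) {x y z w : E}
    (h : algebraMap E L x + algebraMap E L y * A + algebraMap E L z * B
      + algebraMap E L w * (A * B) = 0) : x = 0 ∧ y = 0 ∧ z = 0 ∧ w = 0 := by
  have ha0 : a ≠ 0 := by
    rintro rfl
    rw [map_zero, pow_eq_zero_iff two_ne_zero] at hAa
    exact hA ⟨0, by rw [hAa, map_zero]⟩
  have hb0 : b ≠ 0 := by
    rintro rfl
    rw [map_zero, pow_eq_zero_iff two_ne_zero] at hBb
    exact hB ⟨0, by rw [hBb, map_zero]⟩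
  have e1 : x * y - b * z * w = 0 := by
    have := (eq_zero_of_add_mul_eq_zero hA (x := x ^ 2 + y ^ 2 * a - b * z ^ 2 - b * w ^ 2 * a)
      (y := 2 * (x * y - b * z * w)) ?_).2
    · exact (mul_eq_zero.1 this).resolve_left two_ne_zero
    · simp only [map_add, map_sub, map_mul, map_pow, map_ofNat, ← hAa, ← hBb]
      linear_combination (algebraMap E L x + algebraMap E L y * A
        - B * (algebraMap E L z + algebraMap E L w * A)) * h
  have e2 : x * z - a * y * w = 0 := by
    have := (eq_zero_of_add_mul_eq_zero hB (x := x ^ 2 + z ^ 2 * b - a * y ^ 2 - a * w ^ 2 * b)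
      (y := 2 * (x * z - a * y * w)) ?_).2
    · exact (mul_eq_zero.1 this).resolve_left two_ne_zero
    · simp only [map_add, map_sub, map_mul, map_pow, map_ofNat, ← hAa, ← hBb]
      linear_combination (algebraMap E L x + algebraMap E L z * B
        - A * (algebraMap E L y + algebraMap E L w * B)) * h
  have e3 : x * w - y * z = 0 := by
    have := (eq_zero_of_add_mul_eq_zero hAB (x := x ^ 2 + w ^ 2 * a * b - y ^ 2 * a - z ^ 2 * b)
      (y := 2 * (x * w - y * z)) ?_).2
    · exact (mul_eq_zero.1 this).resolve_left two_ne_zero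
    · simp only [map_add, map_sub, map_mul, map_pow, map_ofNat, ← hAa, ← hBb]
      linear_combination (algebraMap E L x + algebraMap E L w * (A * B)
        - (algebraMap E L y * A + algebraMap E L z * B)) * h
  by_cases hx : x = 0
  · subst hx
    have h1 : z = 0 ∨ w = 0 := by simpa [hb0] using e1
    have h2 : y = 0 ∨ w = 0 := by simpa [ha0] using e2
    have h3 : y = 0 ∨ z = 0 := by simpa using e3
    have hA0 : A ≠ 0 := fun h0 => hA ⟨0, by simp [h0]⟩
    have hB0 : B ≠ 0 := fun h0 => hB ⟨0, by simp [h0]⟩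
    rcases h1 with h1 | h1 <;> rcases h2 with h2 | h2 <;> rcases h3 with h3 | h3 <;>
      simp_all
  -- If x and y were both nonzero, b would be the square of x/z and B would lie in E.
  · have h4 : y * (x ^ 2 - b * z ^ 2) = 0 := by linear_combination x * e1 + b * z * e3
    have hy : y = 0 := by
      refine (mul_eq_zero.1 h4).resolve_right fun h5 => ?_
      have hz : z ≠ 0 := by
        rintro rfl
        simp [hx] at h5
      have : B ^ 2 = algebraMap E L (x / z) ^ 2 := by
        rw [hBb, ← map_pow]
        congr 1
        field_simp
        linear_combination -h5
      rcases sq_eq_sq_iff_eq_or_eq_neg.1 this with h6 | h6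
      · exact hB ⟨x / z, h6.symm⟩
      · exact hB ⟨-(x / z), by rw [h6, map_neg]⟩
    subst hy
    have hz : z = 0 := by simpa [hx] using e2
    have hw : w = 0 := by simpa [hx] using e3
    subst hz hw
    exact absurd (by simpa using h) hx

theorem minpoly_add_sqrt (hA : A ∉ Set.range (algebraMap E L))
    (hB : B ∉ Set.range (algebraMap E L)) (hAB : A * B ∉ Set.range (algebraMap E L))
    (hAa : A ^ 2 = algebraMap E L a) (hBb : B ^ 2 = algebraMap E L b) :
    minpoly E (A + B) = (X ^ 2 - C (a + b)) ^ 2 - C (4 * a * b) := by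
  have hmonic : ((X ^ 2 - C (a + b)) ^ 2 - C (4 * a * b) : E[X]).Monic := by
    refine ((monic_X_pow_sub_C (a + b) two_ne_zero).pow 2).sub_of_left ?_
    rw [degree_pow, degree_X_pow_sub_C two_pos]
    exact lt_of_le_of_lt degree_C_le (by norm_num)
  have hdeg : ((X ^ 2 - C (a + b)) ^ 2 - C (4 * a * b) : E[X]).natDegree = 4 := by
    rw [natDegree_sub_C, natDegree_pow, natDegree_X_pow_sub_C]
  symm
  refine minpoly.unique E _ hmonic ?_ fun f hf hf0 => ?_
  · simp only [map_sub, map_pow, map_mul, aeval_X, aeval_C, map_add, map_ofNat, ← hAa, ← hBb]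
    ring
  · rw [degree_eq_natDegree hmonic.ne_zero, degree_eq_natDegree hf.ne_zero, hdeg, Nat.cast_le]
    by_contra! hlt
    rw [aeval_eq_sum_range' hlt] at hf0
    simp only [Finset.sum_range_succ, Finset.sum_range_zero, Algebra.smul_def] at hf0
    -- The four arguments are the coordinates of f(A+B) on 1, A, B, AB, from (A+B)² = a+b+2AB and
    -- (A+B)³ = (a+3b)A + (3a+b)B.
    obtain ⟨h0, h1, h2, h3⟩ := eq_zero_of_biquadratic hA hB hAB hAa hBb
      (x := f.coeff 0 + f.coeff 2 * (a + b)) (y := f.coeff 1 + f.coeff 3 * (a + 3 * b))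
      (z := f.coeff 1 + f.coeff 3 * (3 * a + b)) (w := 2 * f.coeff 2) (by
        simp only [map_add, map_mul, map_ofNat, ← hAa, ← hBb]
        linear_combination hf0)
    have hab : a - b ≠ 0 := by
      intro hab
      obtain rfl : a = b := by linear_combination hab
      rw [← hBb, sq_eq_sq_iff_eq_or_eq_neg] at hAa
      rcases hAa with rfl | rfl
      · exact hAB ⟨a, by rw [← hBb, sq]⟩
      · exact hAB ⟨-a, by rw [map_neg, ← hBb]; ring⟩
    have c2 : f.coeff 2 = 0 := by simpa using h3
    have c3 : f.coeff 3 = 0 := by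
      have : f.coeff 3 * (2 * (a - b)) = 0 := by linear_combination h2 - h1
      simpa [hab] using this
    have c1 : f.coeff 1 = 0 := by simpa [c3] using h1
    have c0 : f.coeff 0 = 0 := by simpa [c2] using h0
    have hl : f.coeff f.natDegree = 1 := hf
    interval_cases f.natDegree <;> simp_all

theorem natDegree_minpoly_add_sqrt (hA : A ∉ Set.range (algebraMap E L))
    (hB : B ∉ Set.range (algebraMap E L)) (hAB : A * B ∉ Set.range (algebraMap E L))
    (hAa : A ^ 2 = algebraMap E L a) (hBb : B ^ 2 = algebraMap E L b) :
    (minpoly E (A + B)).natDegree = 4 := by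
  rw [minpoly_add_sqrt hA hB hAB hAa hBb, natDegree_sub_C, natDegree_pow, natDegree_X_pow_sub_C]

theorem coeff_two_minpoly_add_sqrt (hA : A ∉ Set.range (algebraMap E L))
    (hB : B ∉ Set.range (algebraMap E L)) (hAB : A * B ∉ Set.range (algebraMap E L))
    (hAa : A ^ 2 = algebraMap E L a) (hBb : B ^ 2 = algebraMap E L b) :
    (minpoly E (A + B)).coeff 2 = -(2 * (a + b)) := by
  rw [minpoly_add_sqrt hA hB hAB hAa hBb]
  generalize a + b = c
  rw [show (X ^ 2 - C c) ^ 2 = X ^ 4 - C (2 * c) * X ^ 2 + C (c ^ 2) by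
    rw [C_mul, C_pow, C_ofNat]; ring]
  rw [coeff_sub, coeff_add, coeff_sub, coeff_C_mul, coeff_X_pow, coeff_X_pow, coeff_C, coeff_C]
  simp

end Quartic

section Cubic

/-- Both products are the degree of E(x,y) over E, computed through either intermediate field. -/
theorem natDegree_minpoly_mul_comm {x y : L} (hx : IsIntegral E x) (hy : IsIntegral E y) :
    (minpoly E x).natDegree * (minpoly E⟮x⟯ y).natDegree
      = (minpoly E y).natDegree * (minpoly E⟮y⟯ x).natDegree := by
  rw [← adjoin.finrank hx, ← adjoin.finrank hy, ← adjoin.finrank hx.tower_top,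
    ← adjoin.finrank hy.tower_top, Module.finrank_mul_finrank, Module.finrank_mul_finrank]
  exact congrArg (fun F : IntermediateField E L => Module.finrank E F) (adjoin_simple_comm E x y)

variable {f : E[X]} {U : L}

/-- A cubic is irreducible over a field that contains none of its roots, and U is the only candidate
within L. The field F is left free so as to cover both E and E(α). -/
theorem minpoly_of_unique_root (hf : f.Monic) (hf3 : f.natDegree = 3) (hU : aeval U f = 0)
    (huniq : ∀ V : L, aeval V f = 0 → V = U) {F : Type*} [Field F] [Algebra E F] [Algebra F L]
    [IsScalarTower E F L] (hUF : U ∉ Set.range (algebraMap F L)) :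
    minpoly F U = f.map (algebraMap E F) := by
  refine (minpoly.eq_of_irreducible_of_monic ?_ (by simpa using hU) (hf.map _)).symm
  refine irreducible_of_degree_le_three_of_not_isRoot (by simp [hf3]) fun x hx => hUF ⟨x, ?_⟩
  apply huniq
  rw [aeval_algebraMap_apply, ← eval_map_algebraMap, hx.eq_zero, map_zero]

/-- If `U` is the only root in `L` of a cubic polynomial over `E`, the degree of an element
over `E` is three times its degree over `E(U)`, unless its minimal polynomials over both fields
coincide. -/
theorem natDegree_minpoly_eq_three_mul (hf : f.Monic) (hf3 : f.natDegree = 3) (hU : aeval U f = 0)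
    (huniq : ∀ V : L, aeval V f = 0 → V = U) (hUE : U ∉ Set.range (algebraMap E L)) {α : L}
    (hα : IsIntegral E⟮U⟯ α) {i : ℕ}
    (hi : algebraMap E⟮U⟯ L ((minpoly E⟮U⟯ α).coeff i) ∉ Set.range (algebraMap E L)) :
    (minpoly E α).natDegree = 3 * (minpoly E⟮U⟯ α).natDegree := by
  have hUint : IsIntegral E U := ⟨f, hf, hU⟩
  have : Algebra.IsIntegral E E⟮U⟯ := isAlgebraic_adjoin_simple hUint |>.isIntegral
  have hα' : IsIntegral E α := isIntegral_trans α hα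
  have hmul := natDegree_minpoly_mul_comm hUint hα'
  rw [minpoly_of_unique_root hf hf3 hU huniq hUE, Algebra.algebraMap_self, Polynomial.map_id, hf3]
    at hmul
  -- If U is in E(α), the factor 3 is gained. Otherwise f stays irreducible over E(α), the degrees
  -- of α over E and E(U) agree, and so do its minimal polynomials, which contradicts `hi`.
  by_cases hUF : U ∈ Set.range (algebraMap E⟮α⟯ L)
  · rw [minpoly.natDegree_eq_one_iff.2 hUF, mul_one] at hmul
    exact hmul.symm
  · rw [minpoly_of_unique_root hf hf3 hU huniq hUF, (hf.natDegree_map _), hf3, mul_comm] at hmul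
    have hdeg : (minpoly E⟮U⟯ α).natDegree = (minpoly E α).natDegree :=
      Nat.eq_of_mul_eq_mul_right three_pos hmul
    have heq : (minpoly E α).map (algebraMap E E⟮U⟯) = minpoly E⟮U⟯ α := by
      refine eq_of_monic_of_dvd_of_natDegree_le (minpoly.monic hα) ((minpoly.monic hα').map _)
        (minpoly.dvd_map_of_isScalarTower E E⟮U⟯ α) ?_
      rw [(minpoly.monic hα').natDegree_map, hdeg]
    refine absurd ⟨(minpoly E α).coeff i, ?_⟩ hi
    rw [← heq, coeff_map, ← IsScalarTower.algebraMap_apply]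

end Cubic

end FieldTheory

end QuadrantChain

/-! ### The cubic extension of `ℝ(t)` generated by `Z` -/

namespace QuadrantChain

section CubicExtension

open Polynomial

open scoped RatFunc

/-- The polynomial over `ℝ[t]` whose root is `1 / Z`. -/
noncomputable def invCubic (k : ℝ) : ℝ[X][X] := X ^ 3 - X ^ 2 + C (C k * X ^ 3)

theorem invCubic_monic (k : ℝ) : (invCubic k).Monic := by
  unfold invCubic
  monicity!

theorem invCubic_natDegree (k : ℝ) : (invCubic k).natDegree = 3 := by
  unfold invCubic
  compute_degree!

theorem algebraMap_poly_C (s : ℝ) : algebraMap ℝ[X] ℝ⸨X⸩ (C s) = cst ℝ s := by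
  simp [cst]

theorem algebraMap_poly_X : algebraMap ℝ[X] ℝ⸨X⸩ X = tvar ℝ := by
  rw [tvar_eq, ← Polynomial.coe_X]
  simp

theorem aeval_invCubic (k : ℝ) (V : ℝ⸨X⸩) :
    aeval V (invCubic k) = V ^ 3 - V ^ 2 + cst ℝ k * tvar ℝ ^ 3 := by
  simp only [invCubic, map_add, map_sub, map_pow, aeval_X, aeval_C, map_mul, algebraMap_poly_C,
    algebraMap_poly_X]

theorem order_coe_eq_zero {G : ℝ⟦X⟧} (hG : PowerSeries.constantCoeff G ≠ 0) :
    (G : ℝ⸨X⸩).order = 0 := by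
  have hc : (G : ℝ⸨X⸩).coeff 0 ≠ 0 := by
    rw [PowerSeries.coeff_coe]
    simpa using hG
  refine le_antisymm (HahnSeries.order_le_of_coeff_ne_zero hc) ?_
  by_contra! hlt
  have h0 : (G : ℝ⸨X⸩) ≠ 0 := HahnSeries.ne_zero_of_coeff_ne_zero hc
  exact h0 (HahnSeries.coeff_order_eq_zero.1 (by rw [PowerSeries.coeff_coe, if_pos hlt]))

variable {k : ℝ} {Z : ℝ⟦X⟧}

theorem coe_Z_eq (hZ : Z = 1 + PowerSeries.C k * PowerSeries.X ^ 3 * Z ^ 3) :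
    (Z : ℝ⸨X⸩) = 1 + cst ℝ k * tvar ℝ ^ 3 * (Z : ℝ⸨X⸩) ^ 3 := by
  have e := congrArg (fun F : ℝ⟦X⟧ => (F : ℝ⸨X⸩)) hZ
  have eC : ((PowerSeries.C k : ℝ⟦X⟧) : ℝ⸨X⸩) = cst ℝ k := by
    rw [cst, C_eq]; rfl
  simp only [map_add, map_mul, map_pow, map_one, eC, ← tvar_eq] at e
  exact e

theorem coe_Z_ne_zero (hZ : Z = 1 + PowerSeries.C k * PowerSeries.X ^ 3 * Z ^ 3) :
    (Z : ℝ⸨X⸩) ≠ 0 := by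
  refine (map_ne_zero_iff _ HahnSeries.ofPowerSeries_injective).2 ?_
  rintro rfl
  simpa using constantCoeff_Z hZ

theorem aeval_inv_Z (hZ : Z = 1 + PowerSeries.C k * PowerSeries.X ^ 3 * Z ^ 3) :
    aeval (Z : ℝ⸨X⸩)⁻¹ (invCubic k) = 0 := by
  have h0 := coe_Z_ne_zero hZ
  have h1 := coe_Z_eq hZ
  rw [aeval_invCubic]
  field_simp
  linear_combination -h1

/-- The two other roots satisfy a quadratic equation whose discriminant is t³ times a unit, up to a
square; a Laurent series with such a square would have order 3/2. -/
theorem eq_inv_Z_of_aeval (hk : k ≠ 0)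
    (hZ : Z = 1 + PowerSeries.C k * PowerSeries.X ^ 3 * Z ^ 3) {V : ℝ⸨X⸩}
    (hV : aeval V (invCubic k) = 0) : V = (Z : ℝ⸨X⸩)⁻¹ := by
  have hZ0 := coe_Z_ne_zero hZ
  have hZ1 := coe_Z_eq hZ
  have hU := aeval_inv_Z hZ
  rw [aeval_invCubic] at hV hU
  set U := (Z : ℝ⸨X⸩)⁻¹ with hUdef
  have hUZ : (Z : ℝ⸨X⸩) * U = 1 := mul_inv_cancel₀ hZ0
  by_contra hne
  have h1 : V ^ 2 + V * U + U ^ 2 - V - U = 0 := by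
    refine (mul_eq_zero.1 ?_).resolve_left (sub_ne_zero.2 hne)
    linear_combination hV - hU
  have h2 : (Z * (2 * V + U - 1)) ^ 2
      = tvar ℝ ^ 3 * ((PowerSeries.C k * Z ^ 3 * (Z + 3) : ℝ⟦X⟧) : ℝ⸨X⸩) := by
    have eC : ((PowerSeries.C k : ℝ⟦X⟧) : ℝ⸨X⸩) = cst ℝ k := by
      rw [cst, C_eq]; rfl
    simp only [map_add, map_mul, map_pow, map_ofNat, eC]
    linear_combination 4 * (Z : ℝ⸨X⸩) ^ 2 * h1 + (Z + 3 : ℝ⸨X⸩) * hZ1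
      - (3 * (Z * U) + 3 - 2 * Z : ℝ⸨X⸩) * hUZ
  have hc : PowerSeries.constantCoeff (PowerSeries.C k * Z ^ 3 * (Z + 3)) ≠ 0 := by
    have := constantCoeff_Z hZ
    have h3 : PowerSeries.constantCoeff (3 : ℝ⟦X⟧) = 3 := map_ofNat _ 3
    simp only [map_mul, map_add, map_pow, this, PowerSeries.constantCoeff_C, h3]
    norm_num [hk]
  have h3 := congrArg HahnSeries.order h2
  have hG : ((PowerSeries.C k * Z ^ 3 * (Z + 3) : ℝ⟦X⟧) : ℝ⸨X⸩) ≠ 0 := by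
    refine (map_ne_zero_iff _ HahnSeries.ofPowerSeries_injective).2 fun h0 => hc ?_
    rw [h0, map_zero]
  rw [HahnSeries.order_pow, HahnSeries.order_mul (pow_ne_zero 3 tvar_ne_zero) hG,
    order_coe_eq_zero hc, HahnSeries.order_pow, tvar, HahnSeries.order_single one_ne_zero] at h3
  simp only [nsmul_eq_mul] at h3
  push_cast at h3
  omega

/-- A rational root is integral over ℝ[t], hence a polynomial w with w²(w-1) = -kt³. Then w has
degree 1, and both the zero of w and that of w - 1 would be t = 0. -/
theorem inv_Z_notMem_range (hk : k ≠ 0)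
    (hZ : Z = 1 + PowerSeries.C k * PowerSeries.X ^ 3 * Z ^ 3) :
    (Z : ℝ⸨X⸩)⁻¹ ∉ Set.range (algebraMap (RatFunc ℝ) ℝ⸨X⸩) := by
  rintro ⟨u, hu⟩
  have h1 : aeval u (invCubic k) = 0 := by
    apply (algebraMap (RatFunc ℝ) ℝ⸨X⸩).injective
    rw [← aeval_algebraMap_apply, hu, aeval_inv_Z hZ, map_zero]
  obtain ⟨w, rfl⟩ := isInteger_of_is_root_of_monic (invCubic_monic k) h1
  rw [aeval_algebraMap_apply] at h1
  have h2 := (map_eq_zero_iff _ (IsFractionRing.injective ℝ[X] (RatFunc ℝ))).1 h1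
  simp only [invCubic, map_add, map_sub, map_pow, aeval_X, aeval_C, Algebra.algebraMap_self,
    RingHom.id_apply] at h2
  have h3 : w ^ 2 * (w - 1) = -(C k * X ^ 3) := by linear_combination h2
  have hd : w.natDegree = 1 := by
    have hw0 : w ≠ 0 := by
      rintro rfl
      have := congrArg (coeff · 3) h3
      simp [hk, eq_comm] at this
    have hw1 : w - 1 ≠ 0 := by
      intro h0
      have := congrArg (coeff · 3) h3
      simp [h0, hk, eq_comm] at this
    have h4 := congrArg natDegree h3
    rw [natDegree_mul (pow_ne_zero 2 hw0) hw1, natDegree_pow, natDegree_neg,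
      natDegree_C_mul_X_pow 3 k hk, show (1 : ℝ[X]) = C 1 from rfl, natDegree_sub_C] at h4
    omega
  obtain ⟨b, c, hw⟩ : ∃ b c, w = C b * X + C c := ⟨_, _, eq_X_add_C_of_natDegree_le_one hd.le⟩
  have hb : b ≠ 0 := by
    rintro rfl
    simp [hw] at hd
  have h5 : (fun x => eval x (w ^ 2 * (w - 1))) = fun x => eval x (-(C k * X ^ 3)) := by rw [h3]
  simp only [hw, eval_mul, eval_pow, eval_add, eval_C, eval_X, eval_sub, eval_one, eval_neg] at h5
  have r := fun x => congrFun h5 x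
  have e0 : b * (-c / b) = -c := by field_simp
  have e1 : b * ((1 - c) / b) = 1 - c := by field_simp
  have r0 := r (-c / b)
  have r1 := r ((1 - c) / b)
  rw [e0] at r0
  rw [e1] at r1
  have z0 : -c / b = 0 := by simpa [hk] using r0
  have z1 : (1 - c) / b = 0 := by
    have : k * ((1 - c) / b) ^ 3 = 0 := by linear_combination r1
    simpa [hk] using this
  rw [div_eq_zero_iff] at z0 z1
  have := z0.resolve_right hb
  have := z1.resolve_right hb
  linarith

end CubicExtension

end QuadrantChain

/-! ### Parametrisation of ℝ(t,Z) by w = tZ -/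

namespace QuadrantChain

section Parametrisation

open Polynomial IntermediateField

open scoped RatFunc

variable {k : ℝ} {Z : ℝ⟦X⟧}

/-- The series tZ is nonzero with zero constant term, so a polynomial vanishing at it has zero
constant term; dividing by X and repeating shows that it is divisible by every power of X. -/
theorem aeval_X_mul_Z_injective (hZ : Z = 1 + PowerSeries.C k * PowerSeries.X ^ 3 * Z ^ 3) :
    Function.Injective (aeval (PowerSeries.X * Z) : ℝ[X] →ₐ[ℝ] ℝ⟦X⟧) := by
  have hw : PowerSeries.X * Z ≠ 0 := by
    refine mul_ne_zero PowerSeries.X_ne_zero ?_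
    rintro rfl
    simpa using constantCoeff_Z hZ
  rw [injective_iff_map_eq_zero]
  intro P hP
  have h0 : ∀ Q : ℝ[X], aeval (PowerSeries.X * Z) Q = 0 → X ∣ Q := by
    intro Q hQ
    rw [X_dvd_iff, coeff_zero_eq_eval_zero]
    have h1 := congrArg PowerSeries.constantCoeff hQ
    rw [aeval_def, hom_eval₂] at h1
    have h2 : PowerSeries.constantCoeff.comp (algebraMap ℝ ℝ⟦X⟧) = RingHom.id ℝ := by
      ext s
      simp
    rw [h2] at h1
    simpa [eval] using h1
  have h1 : ∀ n, X ^ n ∣ P := by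
    intro n
    induction n with
    | zero => simp
    | succ n ih =>
      obtain ⟨Q, rfl⟩ := ih
      rw [map_mul, map_pow, aeval_X] at hP
      rw [pow_succ]
      exact mul_dvd_mul_left _ (h0 Q ((mul_eq_zero.1 hP).resolve_left (pow_ne_zero n hw)))
  by_contra hP0
  have h2 := natDegree_le_of_dvd (h1 (P.natDegree + 1)) hP0
  rw [natDegree_X_pow] at h2
  omega

/-- The embedding of `ℝ[w]` into `ℝ((t))` that maps `w` to `t Z`. -/
noncomputable def paramHom (Z : ℝ⟦X⟧) : ℝ[X] →+* ℝ⸨X⸩ :=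
  (HahnSeries.ofPowerSeries ℤ ℝ).comp (aeval (PowerSeries.X * Z) : ℝ[X] →ₐ[ℝ] ℝ⟦X⟧).toRingHom

theorem paramHom_injective (hZ : Z = 1 + PowerSeries.C k * PowerSeries.X ^ 3 * Z ^ 3) :
    Function.Injective (paramHom Z) :=
  HahnSeries.ofPowerSeries_injective.comp (aeval_X_mul_Z_injective hZ)

theorem paramHom_C (s : ℝ) : paramHom Z (C s) = cst ℝ s := by
  simp [paramHom, cst]

theorem paramHom_X : paramHom Z X = tvar ℝ * (Z : ℝ⸨X⸩) := by
  simp [paramHom, tvar_eq]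

theorem paramHom_Z (hZ : Z = 1 + PowerSeries.C k * PowerSeries.X ^ 3 * Z ^ 3) :
    paramHom Z (1 + C k * X ^ 3) = (Z : ℝ⸨X⸩) := by
  simp only [map_add, map_mul, map_pow, map_one, paramHom_C, paramHom_X]
  linear_combination -coe_Z_eq hZ

/-- The extension of `paramHom` to rational functions. -/
noncomputable def paramField (hZ : Z = 1 + PowerSeries.C k * PowerSeries.X ^ 3 * Z ^ 3) :
    RatFunc ℝ →+* ℝ⸨X⸩ :=
  IsFractionRing.lift (paramHom_injective hZ)

theorem paramField_algebraMap (hZ : Z = 1 + PowerSeries.C k * PowerSeries.X ^ 3 * Z ^ 3)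
    (P : ℝ[X]) : paramField hZ (algebraMap ℝ[X] (RatFunc ℝ) P) = paramHom Z P :=
  IsFractionRing.lift_algebraMap _ P

theorem mem_paramField_range (hZ : Z = 1 + PowerSeries.C k * PowerSeries.X ^ 3 * Z ^ 3)
    (P : ℝ[X]) : paramHom Z P ∈ (paramField hZ).fieldRange :=
  ⟨_, paramField_algebraMap hZ P⟩

theorem coe_Z_mem_range (hZ : Z = 1 + PowerSeries.C k * PowerSeries.X ^ 3 * Z ^ 3) :
    (Z : ℝ⸨X⸩) ∈ (paramField hZ).fieldRange := by
  rw [← paramHom_Z hZ]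
  exact mem_paramField_range hZ _

/-- With w = tZ one has Z = 1 + kw³ and t = w/Z, so ℝ(t,Z) is contained in a field of rational
functions in one variable. -/
theorem algebraMap_mem_range (hZ : Z = 1 + PowerSeries.C k * PowerSeries.X ^ 3 * Z ^ 3)
    (x : RatFunc ℝ) : algebraMap (RatFunc ℝ) ℝ⸨X⸩ x ∈ (paramField hZ).fieldRange := by
  have hpoly : ∀ P : ℝ[X], algebraMap ℝ[X] ℝ⸨X⸩ P ∈ (paramField hZ).fieldRange := by
    intro P
    have ht : tvar ℝ ∈ (paramField hZ).fieldRange := by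
      have : tvar ℝ = paramHom Z X / (Z : ℝ⸨X⸩) := by
        rw [paramHom_X, mul_div_cancel_right₀ _ (coe_Z_ne_zero hZ)]
      rw [this]
      exact div_mem (mem_paramField_range hZ _) (coe_Z_mem_range hZ)
    induction P using Polynomial.induction_on' with
    | add P Q hP hQ =>
      rw [map_add]
      exact add_mem hP hQ
    | monomial n s =>
      rw [← C_mul_X_pow_eq_monomial, map_mul, map_pow, algebraMap_poly_C, algebraMap_poly_X,
        ← paramHom_C (Z := Z)]
      exact mul_mem (mem_paramField_range hZ _) (pow_mem ht n)
  induction x using RatFunc.induction_on with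
  | f P Q _ =>
    rw [RatFunc.algebraMap_apply_div]
    exact div_mem (hpoly P) (hpoly Q)

theorem adjoin_inv_Z_le (hZ : Z = 1 + PowerSeries.C k * PowerSeries.X ^ 3 * Z ^ 3)
    (x : (RatFunc ℝ)⟮(Z : ℝ⸨X⸩)⁻¹⟯) :
    algebraMap (RatFunc ℝ)⟮(Z : ℝ⸨X⸩)⁻¹⟯ ℝ⸨X⸩ x ∈ (paramField hZ).fieldRange := by
  have : (RatFunc ℝ)⟮(Z : ℝ⸨X⸩)⁻¹⟯
      ≤ (paramField hZ).fieldRange.toIntermediateField (algebraMap_mem_range hZ) := by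
    rw [adjoin_simple_le_iff]
    exact inv_mem (coe_Z_mem_range hZ)
  exact this x.2

/-- A square root of a polynomial in `t Z` that takes a negative value is not in `ℝ(t, Z)`. -/
theorem sqrt_notMem_range (hZ : Z = 1 + PowerSeries.C k * PowerSeries.X ^ 3 * Z ^ 3)
    {G : ℝ[X]} {s : ℝ} (hs : G.eval s < 0) {V : ℝ⸨X⸩} (hV : V ^ 2 = paramHom Z G) :
    V ∉ Set.range (algebraMap (RatFunc ℝ)⟮(Z : ℝ⸨X⸩)⁻¹⟯ ℝ⸨X⸩) := by
  rintro ⟨x, rfl⟩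
  obtain ⟨y, hy⟩ := adjoin_inv_Z_le hZ x
  rw [← hy, ← map_pow, ← paramField_algebraMap hZ] at hV
  have h1 := (paramField hZ).injective hV
  -- A rational square root of a polynomial is a polynomial, and the square of a real polynomial
  -- takes no negative value.
  obtain ⟨P, rfl⟩ := isInteger_of_is_root_of_monic (r := y) (monic_X_pow_sub_C G two_ne_zero)
    (by simp [h1])
  rw [← map_pow] at h1
  have h2 := IsFractionRing.injective ℝ[X] (RatFunc ℝ) h1
  rw [← h2, eval_pow] at hs
  exact absurd (sq_nonneg _) (not_le.2 hs)

/-- If a polynomial in `1 / Z` is in `ℝ(t)`, the polynomial has the same values at `0` and `1`. -/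
theorem eval_zero_eq_eval_one (hk : k ≠ 0)
    (hZ : Z = 1 + PowerSeries.C k * PowerSeries.X ^ 3 * Z ^ 3) {G : ℝ[X]}
    (hG : aeval (Z : ℝ⸨X⸩)⁻¹ (G.map C) ∈ Set.range (algebraMap (RatFunc ℝ) ℝ⸨X⸩)) :
    G.eval 0 = G.eval 1 := by
  obtain ⟨c, hc⟩ := hG
  set U : ℝ⸨X⸩ := (Z : ℝ⸨X⸩)⁻¹
  have hmp := minpoly_of_unique_root (E := RatFunc ℝ) (F := RatFunc ℝ) (L := ℝ⸨X⸩)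
    (f := (invCubic k).map (algebraMap ℝ[X] (RatFunc ℝ))) (U := U)
    ((invCubic_monic k).map _) (by rw [(invCubic_monic k).natDegree_map, invCubic_natDegree])
    (by rw [aeval_map_algebraMap, aeval_inv_Z hZ])
    (fun V hV => eq_inv_Z_of_aeval hk hZ (by rwa [aeval_map_algebraMap] at hV))
    (inv_Z_notMem_range hk hZ)
  rw [Algebra.algebraMap_self, Polynomial.map_id] at hmp
  -- As 1/Z has degree 3 over ℝ(t), the remainder modulo its cubic, if its value is in ℝ(t), must be
  -- a constant polynomial.
  set ρ := (G.map C) %ₘ (invCubic k) with hρ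
  have hdiv : ρ + invCubic k * ((G.map C) /ₘ (invCubic k)) = G.map C := modByMonic_add_div _ _
  have hρU : aeval U ρ = algebraMap (RatFunc ℝ) ℝ⸨X⸩ c := by
    rw [hc, ← hdiv, map_add, map_mul, aeval_inv_Z hZ, zero_mul, add_zero]
  have hρdeg : ρ.degree < 3 := by
    have := degree_modByMonic_lt (G.map C) (invCubic_monic k)
    rwa [degree_eq_natDegree (invCubic_monic k).ne_zero, invCubic_natDegree] at this
  have hρc : ρ.map (algebraMap ℝ[X] (RatFunc ℝ)) = C c := by
    by_contra hne
    have h1 : ρ.map (algebraMap ℝ[X] (RatFunc ℝ)) - C c ≠ 0 := sub_ne_zero.2 hne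
    have h2 := minpoly.degree_le_of_ne_zero (RatFunc ℝ) U h1
      (by rw [map_sub, aeval_map_algebraMap, hρU, aeval_C, sub_self])
    rw [hmp, degree_map_eq_of_injective (IsFractionRing.injective ℝ[X] (RatFunc ℝ)),
      degree_eq_natDegree (invCubic_monic k).ne_zero, invCubic_natDegree] at h2
    have h3 : (ρ.map (algebraMap ℝ[X] (RatFunc ℝ)) - C c).degree < 3 :=
      lt_of_le_of_lt (degree_sub_le _ _) (max_lt (lt_of_le_of_lt degree_map_le hρdeg)
        (lt_of_le_of_lt degree_C_le (by norm_num)))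
    exact absurd h2 (not_le.2 h3)
  have hρC : ρ = C (ρ.coeff 0) := by
    ext1 n
    apply IsFractionRing.injective ℝ[X] (RatFunc ℝ)
    rw [← coeff_map, hρc]
    cases n with
    | zero => rw [coeff_C_zero, coeff_C_zero, ← coeff_map, hρc, coeff_C_zero]
    | succ n => rw [coeff_C_succ, coeff_C_succ, map_zero]
  -- At t = 0 the cubic becomes s³ - s², which vanishes at s = 0 and s = 1; there G equals its
  -- constant remainder.
  have hev : ∀ s : ℝ, s ^ 3 - s ^ 2 = 0 → G.eval s = (ρ.coeff 0).eval 0 := by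
    intro s hs
    have := congrArg (fun P => (P.eval (C s)).eval 0) hdiv
    rw [hρC] at this
    generalize (G.map C) /ₘ (invCubic k) = q at this
    simp only [eval_add, eval_mul, eval_C, invCubic, eval_sub, eval_pow, eval_X, eval_map,
      eval₂_at_apply] at this
    rw [← this]
    linear_combination (eval 0 (eval (C s) q)) * hs
  rw [hev 0 (by norm_num), hev 1 (by norm_num)]

end Parametrisation

/-! ### Negative values of the radicands -/

section Signs

open Polynomial

theorem exists_one_add_mul_cube {k z : ℝ} (hk : 0 < k) (hz : 1 ≤ z) : ∃ s, 1 + k * s ^ 3 = z := by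
  refine ⟨((z - 1) / k) ^ ((1 : ℝ) / 3), ?_⟩
  have h0 : 0 ≤ (z - 1) / k := div_nonneg (by linarith) hk.le
  rw [← Real.rpow_natCast, ← Real.rpow_mul h0]
  norm_num
  field_simp
  ring

/-- The polynomial `Δ₋(p/t)` in `w = t Z`. -/
noncomputable def radicand (p k : ℝ) : ℝ[X] :=
  1 - C p * (1 + C k * X ^ 3) * (1 + (1 + C k * X ^ 3)) + C p ^ 2 * (1 + C k * X ^ 3) ^ 2

theorem eval_radicand (p k s : ℝ) : (radicand p k).eval s
    = 1 - p * (1 + k * s ^ 3) - p * (1 - p) * (1 + k * s ^ 3) ^ 2 := by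
  simp only [radicand, eval_add, eval_sub, eval_mul, eval_pow, eval_C, eval_X, eval_one]
  ring

theorem exists_radicand_neg {p k : ℝ} (hp : 0 < p) (hp1 : p < 1) (hk : 0 < k) :
    ∃ s, (radicand p k).eval s < 0 := by
  -- At Z = 1/p the first two terms of the radicand cancel and only -p(1-p)Z² remains.
  obtain ⟨s, hs⟩ := exists_one_add_mul_cube hk (z := 1 / p) ((one_le_div hp).2 hp1.le)
  refine ⟨s, ?_⟩
  rw [eval_radicand, hs]
  have : 0 < p * (1 - p) * (1 / p) ^ 2 := by
    have : 0 < 1 - p := by linarith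
    positivity
  rw [mul_one_div_cancel hp.ne']
  linarith

/-- As functions of Z ≥ 1 the radicands differ by at least q - p. Where the one of p takes a
positive value e < q - p, the other one is negative; such a point exists because the former starts
at (1-p)² and becomes negative. -/
theorem exists_radicand_mul_neg_of_lt {p q k : ℝ} (hp : 0 < p) (hpq : p < q) (hpq1 : p + q < 1)
    (hk : 0 < k) : ∃ s, (radicand p k * radicand q k).eval s < 0 := by
  obtain ⟨e, he0, he1, he2⟩ : ∃ e, 0 < e ∧ e ≤ (1 - p) ^ 2 ∧ e < q - p := by
    have h1 : 0 < (1 - p) ^ 2 := pow_pos (by linarith) 2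
    refine ⟨min ((1 - p) ^ 2) ((q - p) / 2), lt_min h1 (by linarith), min_le_left _ _, ?_⟩
    exact lt_of_le_of_lt (min_le_right _ _) (by linarith)
  have hcont : ContinuousOn (fun z : ℝ => 1 - p * z - p * (1 - p) * z ^ 2) (Set.Icc 1 (1 / p)) := by
    fun_prop
  have h1p : 1 ≤ 1 / p := (one_le_div hp).2 (by linarith)
  have hp1 : 0 < 1 - p := by linarith
  obtain ⟨z, ⟨hz1, -⟩, hz⟩ := intermediate_value_Icc' h1p hcont (show e ∈ _ from by
    constructor
    · have : 0 < p * (1 - p) * (1 / p) ^ 2 := by positivity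
      rw [mul_one_div_cancel hp.ne']
      linarith
    · linarith)
  obtain ⟨s, hs⟩ := exists_one_add_mul_cube hk hz1
  refine ⟨s, ?_⟩
  rw [eval_mul, eval_radicand, eval_radicand, hs]
  simp only at hz
  rw [hz]
  refine mul_neg_of_pos_of_neg he0 ?_
  have h2 : 1 - q * z - q * (1 - q) * z ^ 2 = e - (q - p) * (z + (1 - p - q) * z ^ 2) := by
    rw [← hz]; ring
  have h3 : 1 ≤ z + (1 - p - q) * z ^ 2 := by
    have : 0 ≤ (1 - p - q) * z ^ 2 := mul_nonneg (by linarith) (sq_nonneg z)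
    linarith
  have h4 : q - p ≤ (q - p) * (z + (1 - p - q) * z ^ 2) :=
    le_mul_of_one_le_right (by linarith) h3
  rw [h2]
  linarith

theorem exists_radicand_mul_neg {p q k : ℝ} (hp : 0 < p) (hq : 0 < q) (hpq : p ≠ q)
    (hpq1 : p + q < 1) (hk : 0 < k) : ∃ s, (radicand p k * radicand q k).eval s < 0 := by
  rcases lt_or_gt_of_ne hpq with h | h
  · exact exists_radicand_mul_neg_of_lt hp h hpq1 hk
  · rw [mul_comm (radicand p k)]
    exact exists_radicand_mul_neg_of_lt hq h (by linarith) hk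

end Signs

end QuadrantChain

/-! ### The degree of `P₀₀` -/

namespace QuadrantChain

section DegreeOfP00

open Polynomial IntermediateField

open scoped RatFunc

/-- A nonconstant affine change over E does not alter the field generated over E. -/
theorem natDegree_minpoly_affine {E L : Type*} [Field E] [Field L] [Algebra E L] {x α : L} {u v : E}
    (hu : u ≠ 0) (hx : α = algebraMap E L u * x + algebraMap E L v) (hα : IsIntegral E α) :
    (minpoly E x).natDegree = (minpoly E α).natDegree := by
  have hu' : algebraMap E L u ≠ 0 := (_root_.map_ne_zero _).2 hu
  have hx' : x = algebraMap E L u⁻¹ * (α - algebraMap E L v) := by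
    rw [hx, map_inv₀]
    field_simp
    ring
  have hxi : IsIntegral E x := by
    rw [hx']
    exact isIntegral_algebraMap.mul (hα.sub isIntegral_algebraMap)
  have : E⟮x⟯ = E⟮α⟯ := by
    apply le_antisymm
    · rw [adjoin_simple_le_iff, hx']
      exact mul_mem (IntermediateField.algebraMap_mem _ _) (sub_mem (mem_adjoin_simple_self E α) (IntermediateField.algebraMap_mem _ _))
    · rw [adjoin_simple_le_iff, hx]
      exact add_mem (mul_mem (IntermediateField.algebraMap_mem _ _) (mem_adjoin_simple_self E x)) (IntermediateField.algebraMap_mem _ _)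
  rw [← adjoin.finrank hxi, ← adjoin.finrank hα, this]

/-- The coefficient of the square root in `4 p (1 - t³) A_{p,q}`, as a polynomial in `1 / Z`. -/
noncomputable def coeffPoly (p : ℝ) : ℝ[X] := X ^ 2 - C (1 - 2 * p) * X - C (2 * p * (1 - 2 * p))

/-- The polynomial in `1 / Z` whose square root appears in `4 p (1 - t³) A_{p,q}`. -/
noncomputable def radPoly (p : ℝ) : ℝ[X] := X ^ 2 - C p * X - C (p * (1 - p))

variable {p q r p' r' q'' r'' k : ℝ} {Z R A Rp Ap Rq Aq : ℝ⟦X⟧}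

/-- Evaluation of polynomials at `1 / Z`. -/
noncomputable def invHom (Z : ℝ⟦X⟧) : ℝ[X] →+* ℝ⸨X⸩ := eval₂RingHom HahnSeries.C (Z : ℝ⸨X⸩)⁻¹

theorem invHom_C (s : ℝ) : invHom Z (C s) = HahnSeries.C s := by simp [invHom]

theorem invHom_X : invHom Z X = (Z : ℝ⸨X⸩)⁻¹ := by simp [invHom]

theorem aeval_map_C (P : ℝ[X]) : aeval (Z : ℝ⸨X⸩)⁻¹ (P.map C) = invHom Z P := by
  rw [aeval_def, eval₂_map, invHom, coe_eval₂RingHom]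
  congr 1
  ext s
  simp

theorem invHom_mem_adjoin (P : ℝ[X]) : invHom Z P ∈ (RatFunc ℝ)⟮(Z : ℝ⸨X⸩)⁻¹⟯ := by
  rw [← aeval_map_C, ← aeval_map_algebraMap (RatFunc ℝ)]
  exact algebra_adjoin_le_adjoin _ _ (aeval_mem_adjoin_singleton _ _)

/-- Evaluation of polynomials at `1 / Z`, in the field `ℝ(t, Z)`. -/
noncomputable def invHomAdjoin (Z : ℝ⟦X⟧) : ℝ[X] →+* (RatFunc ℝ)⟮(Z : ℝ⸨X⸩)⁻¹⟯ :=
  (invHom Z).codRestrict _ invHom_mem_adjoin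

theorem algebraMap_invHomAdjoin (P : ℝ[X]) :
    algebraMap (RatFunc ℝ)⟮(Z : ℝ⸨X⸩)⁻¹⟯ ℝ⸨X⸩ (invHomAdjoin Z P) = invHom Z P := rfl

/-- Division of `eq_cube` by Z³ makes the coefficient of the square root a polynomial in 1/Z. The
extra factor 1/Z is kept with R, since (R/Z)² is again a polynomial in 1/Z. -/
theorem isA_scaled (hA : IsA p q r Z R A) (hZ : (Z : ℝ⸨X⸩) ≠ 0) :
    4 * cst ℝ p * (1 - tvar ℝ ^ 3) * (A : ℝ⸨X⸩) = invHom Z (coeffPoly p * X) * R := by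
  have e := congrArg (fun F : ℝ⟦X⟧ => (F : ℝ⸨X⸩)) hA.eq_cube
  have eC : ∀ s, ((PowerSeries.C s : ℝ⟦X⟧) : ℝ⸨X⸩) = HahnSeries.C s := fun s => (C_eq s).symm
  have ec : cst ℝ p = HahnSeries.C p := rfl
  simp only [map_sub, map_mul, map_pow, map_one, eC, map_ofNat, ← tvar_eq] at e
  simp only [coeffPoly, map_sub, map_mul, map_pow, map_one, map_ofNat, invHom_C, invHom_X, ec]
  field_simp
  linear_combination e

theorem invHom_sq (hA : IsA p q r Z R A) (hZ : (Z : ℝ⸨X⸩) ≠ 0) :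
    (invHom Z X * R) ^ 2 = invHom Z (radPoly p) := by
  have e := congrArg (fun F : ℝ⟦X⟧ => (F : ℝ⸨X⸩)) hA.sq
  have eC : ∀ s, ((PowerSeries.C s : ℝ⟦X⟧) : ℝ⸨X⸩) = HahnSeries.C s := fun s => (C_eq s).symm
  simp only [map_add, map_sub, map_mul, map_pow, map_one, eC] at e
  rw [mul_pow, e]
  simp only [radPoly, map_sub, map_mul, map_pow, map_one, invHom_C, invHom_X]
  field_simp
  ring

theorem invHom_coeffPoly_ne_zero (hp : p ≠ 0)
    (hZ : Z = 1 + PowerSeries.C k * PowerSeries.X ^ 3 * Z ^ 3) :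
    invHom Z (coeffPoly p) ≠ 0 := by
  have hZ0 := coe_Z_ne_zero hZ
  intro h0
  simp only [coeffPoly, map_sub, map_mul, map_pow, map_one, map_ofNat, invHom_C, invHom_X] at h0
  have h1 : ((1 - PowerSeries.C (1 - 2 * p) * Z
      - PowerSeries.C (2 * p * (1 - 2 * p)) * Z ^ 2 : ℝ⟦X⟧) : ℝ⸨X⸩) = 0 := by
    simp only [map_sub, map_mul, map_pow, map_one, map_ofNat, ← C_eq]
    field_simp at h0
    linear_combination h0
  have h2 := congrArg PowerSeries.constantCoeff
    ((map_eq_zero_iff _ HahnSeries.ofPowerSeries_injective).1 h1)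
  rw [map_sub, map_sub, map_mul, map_mul, map_pow, map_one, PowerSeries.constantCoeff_C,
    PowerSeries.constantCoeff_C, constantCoeff_Z hZ, map_zero] at h2
  apply hp
  have : p ^ 2 = 0 := by linear_combination h2 / 4
  simpa using this

theorem radicand_eq (hZ : Z = 1 + PowerSeries.C k * PowerSeries.X ^ 3 * Z ^ 3)
    (hA : IsA p q r Z R A) : (R : ℝ⸨X⸩) ^ 2 = paramHom Z (radicand p k) := by
  have e := congrArg (fun F : ℝ⟦X⟧ => (F : ℝ⸨X⸩)) hA.sq
  have eC : ((PowerSeries.C p : ℝ⟦X⟧) : ℝ⸨X⸩) = cst ℝ p := (C_eq p).symm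
  simp only [map_add, map_sub, map_mul, map_pow, map_one, eC] at e
  rw [e, radicand, map_add, map_sub, map_mul, map_mul, map_mul, map_add _ 1 (1 + C k * X ^ 3),
    map_pow, map_pow, paramHom_Z hZ, paramHom_C, map_one]

theorem mul_notMem_range {F L : Type*} [Field F] [Field L] [Algebra F L] {e : F} {V : L}
    (he : algebraMap F L e ≠ 0) (hV : V ∉ Set.range (algebraMap F L)) :
    algebraMap F L e * V ∉ Set.range (algebraMap F L) := by
  rintro ⟨x, hx⟩
  refine hV ⟨x / e, ?_⟩
  rw [map_div₀, hx, mul_div_cancel_left₀ _ he]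

/-- The square of `4 p q (1 - t³) A_{p,q}`, as a polynomial in `1 / Z`. -/
noncomputable def sqPoly (p q : ℝ) : ℝ[X] := (C q * coeffPoly p) ^ 2 * radPoly p

/-- Together with positivity at 1, this shows that the value of `sqPoly` at 1/Z is not in ℝ(t), by
`eval_zero_eq_eval_one`. The inequality is not strict: the value is 0 for p = 1/2. -/
theorem eval_sqPoly_zero_le (hp : 0 < p) (hp1 : p < 1) : (sqPoly p q).eval 0 ≤ 0 := by
  have : 0 ≤ (q * (2 * p * (1 - 2 * p))) ^ 2 * (p * (1 - p)) :=
    mul_nonneg (sq_nonneg _) (mul_nonneg hp.le (by linarith))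
  simp only [sqPoly, coeffPoly, radPoly, eval_mul, eval_pow, eval_sub, eval_C, eval_X]
  linarith

theorem eval_sqPoly_one_pos (hp : 0 < p) (hp1 : p < 1) (hq : 0 < q) :
    0 < (sqPoly p q).eval 1 := by
  have : 0 < (q * (4 * p ^ 2)) ^ 2 * (1 - p) ^ 2 :=
    mul_pos (by positivity) (pow_pos (by linarith) 2)
  simp only [sqPoly, coeffPoly, radPoly, eval_mul, eval_pow, eval_sub, eval_C, eval_X]
  linarith

/-- The series `4 p q (1 - t³) A_{p,q}`. -/
noncomputable def scaledA (p q : ℝ) (Z R : ℝ⟦X⟧) : ℝ⸨X⸩ :=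
  invHom Z (C q * coeffPoly p * X) * (R : ℝ⸨X⸩)

theorem scaledA_eq (hA : IsA p q r Z R A) (hZ : (Z : ℝ⸨X⸩) ≠ 0) :
    scaledA p q Z R = 4 * cst ℝ p * cst ℝ q * (1 - tvar ℝ ^ 3) * (A : ℝ⸨X⸩) := by
  have ec : HahnSeries.C q = cst ℝ q := rfl
  rw [scaledA, mul_assoc (C q), map_mul _ (C q), invHom_C, mul_assoc, ← isA_scaled hA hZ, ec]
  ring

theorem scaledA_sq (hA : IsA p q r Z R A) (hZ : (Z : ℝ⸨X⸩) ≠ 0) :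
    scaledA p q Z R ^ 2 = algebraMap (RatFunc ℝ)⟮(Z : ℝ⸨X⸩)⁻¹⟯ ℝ⸨X⸩
      (invHomAdjoin Z (sqPoly p q)) := by
  rw [algebraMap_invHomAdjoin, sqPoly, map_mul _ _ (radPoly p), ← invHom_sq hA hZ, scaledA,
    map_mul _ _ X, map_pow]
  ring

theorem invHom_coeff_ne_zero (hp : p ≠ 0) (hq : q ≠ 0)
    (hZ : Z = 1 + PowerSeries.C k * PowerSeries.X ^ 3 * Z ^ 3) :
    invHom Z (C q * coeffPoly p * X) ≠ 0 := by
  rw [map_mul, map_mul, invHom_X, invHom_C]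
  exact mul_ne_zero (mul_ne_zero (cst_ne_zero hq) (invHom_coeffPoly_ne_zero hp hZ))
    (inv_ne_zero (coe_Z_ne_zero hZ))

theorem invHom_mul_notMem_range {P : ℝ[X]} (hP : invHom Z P ≠ 0) {V : ℝ⸨X⸩}
    (hV : V ∉ Set.range (algebraMap (RatFunc ℝ)⟮(Z : ℝ⸨X⸩)⁻¹⟯ ℝ⸨X⸩)) :
    invHom Z P * V ∉ Set.range (algebraMap (RatFunc ℝ)⟮(Z : ℝ⸨X⸩)⁻¹⟯ ℝ⸨X⸩) := by
  rw [← algebraMap_invHomAdjoin] at hP ⊢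
  exact mul_notMem_range hP hV

theorem sqrt_radicand_notMem_range (hk : 0 < k) (hp : 0 < p) (hp1 : p < 1)
    (hZ : Z = 1 + PowerSeries.C k * PowerSeries.X ^ 3 * Z ^ 3) (hA : IsA p q r Z R A) :
    (R : ℝ⸨X⸩) ∉ Set.range (algebraMap (RatFunc ℝ)⟮(Z : ℝ⸨X⸩)⁻¹⟯ ℝ⸨X⸩) := by
  obtain ⟨s, hs⟩ := exists_radicand_neg hp hp1 hk
  exact sqrt_notMem_range hZ hs (radicand_eq hZ hA)

theorem scaledA_notMem_range (hk : 0 < k) (hp : 0 < p) (hp1 : p < 1) (hq : q ≠ 0)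
    (hZ : Z = 1 + PowerSeries.C k * PowerSeries.X ^ 3 * Z ^ 3) (hA : IsA p q r Z R A) :
    scaledA p q Z R ∉ Set.range (algebraMap (RatFunc ℝ)⟮(Z : ℝ⸨X⸩)⁻¹⟯ ℝ⸨X⸩) :=
  invHom_mul_notMem_range (invHom_coeff_ne_zero hp.ne' hq hZ)
    (sqrt_radicand_notMem_range hk hp hp1 hZ hA)

theorem scaledA_mul_notMem_range (hk : 0 < k) (hp : 0 < p) (hq : 0 < q) (hpq : p ≠ q)
    (hpq1 : p + q < 1) (hZ : Z = 1 + PowerSeries.C k * PowerSeries.X ^ 3 * Z ^ 3)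
    (hA : IsA p q r Z Rp Ap) (hB : IsA q p r Z Rq Aq) :
    scaledA p q Z Rp * scaledA q p Z Rq
      ∉ Set.range (algebraMap (RatFunc ℝ)⟮(Z : ℝ⸨X⸩)⁻¹⟯ ℝ⸨X⸩) := by
  obtain ⟨s, hs⟩ := exists_radicand_mul_neg hp hq hpq hpq1 hk
  have hRR := sqrt_notMem_range hZ hs (V := (Rp : ℝ⸨X⸩) * (Rq : ℝ⸨X⸩))
    (by rw [mul_pow, radicand_eq hZ hA, radicand_eq hZ hB, map_mul])
  rw [scaledA, scaledA, mul_mul_mul_comm, ← map_mul]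
  refine invHom_mul_notMem_range ?_ hRR
  rw [map_mul]
  exact mul_ne_zero (invHom_coeff_ne_zero hp.ne' hq.ne' hZ) (invHom_coeff_ne_zero hq.ne' hp.ne' hZ)

theorem invHomAdjoin_notMem_range (hk : k ≠ 0)
    (hZ : Z = 1 + PowerSeries.C k * PowerSeries.X ^ 3 * Z ^ 3) {G : ℝ[X]}
    (hG : G.eval 0 ≠ G.eval 1) :
    algebraMap (RatFunc ℝ)⟮(Z : ℝ⸨X⸩)⁻¹⟯ ℝ⸨X⸩ (invHomAdjoin Z G)
      ∉ Set.range (algebraMap (RatFunc ℝ) ℝ⸨X⸩) := by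
  intro hmem
  rw [algebraMap_invHomAdjoin, ← aeval_map_C] at hmem
  exact hG (eval_zero_eq_eval_one hk hZ hmem)

theorem natDegree_minpoly_eq_three_mul_adjoin_Z (hk : k ≠ 0)
    (hZ : Z = 1 + PowerSeries.C k * PowerSeries.X ^ 3 * Z ^ 3) {α : ℝ⸨X⸩} {i : ℕ}
    (hi : algebraMap (RatFunc ℝ)⟮(Z : ℝ⸨X⸩)⁻¹⟯ ℝ⸨X⸩
        ((minpoly (RatFunc ℝ)⟮(Z : ℝ⸨X⸩)⁻¹⟯ α).coeff i)
          ∉ Set.range (algebraMap (RatFunc ℝ) ℝ⸨X⸩)) :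
    IsIntegral (RatFunc ℝ) α ∧
      (minpoly (RatFunc ℝ) α).natDegree = 3 * (minpoly (RatFunc ℝ)⟮(Z : ℝ⸨X⸩)⁻¹⟯ α).natDegree := by
  -- The minimal polynomial of a non-integral element is 0 by convention, and its coefficients would
  -- lie in ℝ(t).
  have hint : IsIntegral (RatFunc ℝ)⟮(Z : ℝ⸨X⸩)⁻¹⟯ α := by
    rw [← minpoly.ne_zero_iff]
    intro h0
    rw [h0, coeff_zero, map_zero] at hi
    exact hi ⟨0, map_zero _⟩
  have hUroot : aeval (Z : ℝ⸨X⸩)⁻¹ ((invCubic k).map (algebraMap ℝ[X] (RatFunc ℝ))) = 0 := by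
    rw [aeval_map_algebraMap, aeval_inv_Z hZ]
  have hmon := (invCubic_monic k).map (algebraMap ℝ[X] (RatFunc ℝ))
  have : Algebra.IsIntegral (RatFunc ℝ) (RatFunc ℝ)⟮(Z : ℝ⸨X⸩)⁻¹⟯ :=
    (isAlgebraic_adjoin_simple ⟨_, hmon, hUroot⟩).isIntegral
  exact ⟨isIntegral_trans _ hint, natDegree_minpoly_eq_three_mul hmon
    (by rw [(invCubic_monic k).natDegree_map, invCubic_natDegree]) hUroot
    (fun V hV => eq_inv_Z_of_aeval hk hZ (by rwa [aeval_map_algebraMap] at hV))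
    (inv_Z_notMem_range hk hZ) hint hi⟩

theorem algDegree_eq_natDegree_minpoly (hp0 : p ≠ 0) (hq0 : q ≠ 0) (hZ : (Z : ℝ⸨X⸩) ≠ 0)
    (hp : IsA p q r Z Rp Ap) (hq : IsA q p r Z Rq Aq) {F : ℝ⟦X⟧}
    (hF : PowerSeries.C (2 * p * q) * F + PowerSeries.C (r * (1 - r)) = Ap + Aq)
    (hint : IsIntegral (RatFunc ℝ) (scaledA p q Z Rp + scaledA q p Z Rq)) :
    algDegree F = (minpoly (RatFunc ℝ) (scaledA p q Z Rp + scaledA q p Z Rq)).natDegree := by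
  have hu : (C (8 * p ^ 2 * q ^ 2) * (1 - X ^ 3) : ℝ[X]) ≠ 0 := by
    intro h0
    have := congrArg (eval 0) h0
    simp [hp0, hq0] at this
  refine natDegree_minpoly_affine
    (u := algebraMap ℝ[X] (RatFunc ℝ) (C (8 * p ^ 2 * q ^ 2) * (1 - X ^ 3)))
    (v := algebraMap ℝ[X] (RatFunc ℝ) (C (4 * p * q * (r * (1 - r))) * (1 - X ^ 3)))
    ((map_ne_zero_iff _ (IsFractionRing.injective ℝ[X] (RatFunc ℝ))).2 hu) ?_ hint
  have e := congrArg (fun F : ℝ⟦X⟧ => (F : ℝ⸨X⸩)) hF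
  have ec : ∀ s : ℝ, cst ℝ s = HahnSeries.C s := fun s => rfl
  rw [← IsScalarTower.algebraMap_apply, ← IsScalarTower.algebraMap_apply, scaledA_eq hp hZ,
    scaledA_eq hq hZ]
  simp only [map_mul, map_add, map_sub, map_one, map_pow, algebraMap_poly_X, map_ofNat,
    ← C_eq, ec, algebraMap_poly_C] at e ⊢
  linear_combination -4 * HahnSeries.C p * HahnSeries.C q * (1 - tvar ℝ ^ 3) * e

/-- The two square roots coincide, so the sum has degree 2 over ℝ(t,Z); the constant coefficient of
its minimal polynomial is not in ℝ(t), which gives 3·2. -/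
theorem algDegree_of_eq (h : Params p q r p' r' q'' r'')
    (hZ : Z = 1 + PowerSeries.C (4 * p * q * r) * PowerSeries.X ^ 3 * Z ^ 3)
    (hp : IsA p q r Z Rp Ap) (hq : IsA q p r Z Rq Aq) {F : ℝ⟦X⟧}
    (hF : PowerSeries.C (2 * p * q) * F + PowerSeries.C (r * (1 - r)) = Ap + Aq)
    (hpq : p = q) (hAA : Ap = Aq) : algDegree F = 6 := by
  have hp0 := h.hp
  have hq0 := h.hq
  have hr0 := h.hr
  have hp1 : p < 1 := by linarith [h.sum]
  have hk0 : 0 < 4 * p * q * r := by positivity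
  have hZ0 := coe_Z_ne_zero hZ
  have hsum : scaledA p q Z Rp + scaledA q p Z Rq = invHom Z (C 2) * scaledA p q Z Rp := by
    rw [scaledA_eq hp hZ0, scaledA_eq hq hZ0, hAA, hpq, invHom_C, map_ofNat]
    ring
  have hmin := minpoly_sqrt (invHom_mul_notMem_range
    (P := C 2) (by rw [invHom_C]; exact cst_ne_zero two_ne_zero)
    (scaledA_notMem_range hk0 hp0 hp1 hq0.ne' hZ hp))
    (a := invHomAdjoin Z (C 4 * sqPoly p q)) (by
      rw [mul_pow, scaledA_sq hp hZ0, algebraMap_invHomAdjoin, algebraMap_invHomAdjoin,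
        ← map_pow, ← map_mul, ← C_pow]
      norm_num)
  rw [← hsum] at hmin
  have hi := natDegree_minpoly_eq_three_mul_adjoin_Z (i := 0) hk0.ne' hZ
    (α := scaledA p q Z Rp + scaledA q p Z Rq) (by
      rw [hmin, coeff_sub, coeff_C_zero, coeff_X_pow, if_neg (by norm_num), zero_sub, ← map_neg]
      apply invHomAdjoin_notMem_range hk0.ne' hZ
      have h1 := eval_sqPoly_zero_le (q := q) hp0 hp1
      have h2 := eval_sqPoly_one_pos hp0 hp1 hq0
      simp only [eval_neg, eval_mul, eval_C]
      intro h3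
      linarith)
  rw [algDegree_eq_natDegree_minpoly hp0.ne' hq0.ne' hZ0 hp hq hF hi.1, hi.2, hmin,
    natDegree_X_pow_sub_C]

/-- The square roots are independent, so the degree over ℝ(t,Z) is 4. The coefficient of X² is -2
times a sum of two values of `sqPoly`, which is not in ℝ(t), because both terms are nonpositive at 0
and positive at 1; this gives 3·4. -/
theorem algDegree_of_ne (h : Params p q r p' r' q'' r'')
    (hZ : Z = 1 + PowerSeries.C (4 * p * q * r) * PowerSeries.X ^ 3 * Z ^ 3)
    (hp : IsA p q r Z Rp Ap) (hq : IsA q p r Z Rq Aq) {F : ℝ⟦X⟧}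
    (hF : PowerSeries.C (2 * p * q) * F + PowerSeries.C (r * (1 - r)) = Ap + Aq)
    (hpq : p ≠ q) : algDegree F = 12 := by
  have hp0 := h.hp
  have hq0 := h.hq
  have hr0 := h.hr
  have hp1 : p < 1 := by linarith [h.sum]
  have hq1 : q < 1 := by linarith [h.sum]
  have hk0 : 0 < 4 * p * q * r := by positivity
  have hZ0 := coe_Z_ne_zero hZ
  have hAn := scaledA_notMem_range hk0 hp0 hp1 hq0.ne' hZ hp
  have hBn := scaledA_notMem_range hk0 hq0 hq1 hp0.ne' hZ hq
  have hABn := scaledA_mul_notMem_range hk0 hp0 hq0 hpq (by linarith [h.sum]) hZ hp hq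
  have hAs := scaledA_sq hp hZ0
  have hBs := scaledA_sq hq hZ0
  have hi := natDegree_minpoly_eq_three_mul_adjoin_Z (i := 2) hk0.ne' hZ
    (α := scaledA p q Z Rp + scaledA q p Z Rq) (by
      rw [coeff_two_minpoly_add_sqrt hAn hBn hABn hAs hBs, ← map_add, ← map_ofNat (invHomAdjoin Z) 2,
        ← map_mul, ← map_neg]
      apply invHomAdjoin_notMem_range hk0.ne' hZ
      have h1 := eval_sqPoly_zero_le (q := q) hp0 hp1
      have h2 := eval_sqPoly_one_pos hp0 hp1 hq0
      have h3 := eval_sqPoly_zero_le (q := p) hq0 hq1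
      have h4 := eval_sqPoly_one_pos hq0 hq1 hp0
      simp only [eval_neg, eval_mul, eval_add, eval_ofNat]
      intro h5
      linarith)
  rw [algDegree_eq_natDegree_minpoly hp0.ne' hq0.ne' hZ0 hp hq hF hi.1, hi.2,
    natDegree_minpoly_add_sqrt hAn hBn hABn hAs hBs]

end DegreeOfP00

end QuadrantChain

/-! ### Translation to the stated forms and conclusion -/

namespace QuadrantChain

section Assembly

variable {p q r p' r' q'' r'' : ℝ}

theorem params_of_ratios (hp : 0 < p) (hq : 0 < q) (hr : 0 < r) (hpqr : p + q + r = 1)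
    (hr' : 0 < r') (hpr' : p' + r' = 1) (hr'' : 0 < r'') (hqr'' : q'' + r'' = 1)
    (hα : p / r = p' / r') (hβ : q / r = q'' / r'') : Params p q r p' r' q'' r'' := by
  have e1 : p * r' = p' * r := (div_eq_div_iff hr.ne' hr'.ne').1 hα
  have e2 : q * r'' = q'' * r := (div_eq_div_iff hr.ne' hr''.ne').1 hβ
  refine ⟨hp, hq, hr, hpqr, ?_, ?_, ?_, ?_⟩
  · rw [hα]; field_simp
  · rw [hβ]; field_simp
  · linear_combination e1 + r * hpr' - r' * hpqr
  · linear_combination e2 + r * hqr'' - r'' * hpqr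

theorem isSqrtDeltaMinus_of_isA {Z R A : ℝ⟦X⟧} (hp1 : p < 1) (hA : IsA p q r Z R A) :
    IsSqrtDeltaMinus p Z R := by
  refine ⟨?_, by rw [hA.const]; linarith⟩
  have ht : tvar ℝ ≠ 0 := tvar_ne_zero
  have e := congrArg (fun F : ℝ⟦X⟧ => (F : ℝ⸨X⸩)) hA.sq
  have eC : ((PowerSeries.C p : ℝ⟦X⟧) : ℝ⸨X⸩) = cst ℝ p := by
    rw [cst, C_eq]; rfl
  simp only [map_add, map_sub, map_mul, map_pow, map_one, eC] at e
  rw [e, deltaMinus]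
  field_simp

theorem eq_Aexpr_of_isA (h : Params p q r p' r' q'' r'') {a b : ℝ} {Z R A : ℝ⟦X⟧}
    (hZ : Z = 1 + PowerSeries.C (4 * p * q * r) * PowerSeries.X ^ 3 * Z ^ 3)
    (hA : IsA a b r Z R A) :
    (A : ℝ⸨X⸩) = Aexpr (cst ℝ a) (cst ℝ b) (cst ℝ r) (tvar ℝ) (Z : ℝ⸨X⸩) (R : ℝ⸨X⸩) := by
  have hne : (1 - PowerSeries.X ^ 3) * (1 - 2 * PowerSeries.C a * Z) ≠ 0 := isA_factor_ne_zero h hZ a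
  have hne' := (map_ne_zero_iff (HahnSeries.ofPowerSeries ℤ ℝ)
    HahnSeries.ofPowerSeries_injective).2 hne
  have e := congrArg (fun F : ℝ⟦X⟧ => (F : ℝ⸨X⸩)) hA.eq_linear
  have eC : ∀ s, ((PowerSeries.C s : ℝ⟦X⟧) : ℝ⸨X⸩) = cst ℝ s := by
    intro s
    rw [cst, C_eq]; rfl
  simp only [map_sub, map_mul, map_pow, map_one, eC, ← tvar_eq, map_ofNat] at e hne'
  rw [Aexpr, eq_div_iff hne']
  linear_combination e

theorem isSqrtDeltaPlus_map {Z : ℝ⟦X⟧} {D : (Polynomial ℝ)⟦X⟧}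
    (hD : D ^ 2 = 1 - algebraMap ℝ _ (4 * p * q * r) * PowerSeries.X ^ 2 * constX Z ^ 2
      * PowerSeries.C Polynomial.X)
    (hD' : PowerSeries.constantCoeff D = 1) (a : Kxy) :
    IsSqrtDeltaPlus p q r Z a
      (PowerSeries.map (Polynomial.aeval a : Polynomial ℝ →ₐ[ℝ] Kxy).toRingHom D) := by
  constructor
  · have e := congrArg (fun F => ((PowerSeries.map
      (Polynomial.aeval a : Polynomial ℝ →ₐ[ℝ] Kxy).toRingHom F : Kxy⟦X⟧) : Kxy⸨X⸩)) hD
    simp only [map_sub, map_one, map_mul, map_pow, map_aeval_constX, map_aeval_algebraMap,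
      PowerSeries.map_X, PowerSeries.map_C, map_ofNat] at e
    simp only [AlgHom.toRingHom_eq_coe, RingHom.coe_coe, Polynomial.aeval_X, ← cst_eq, ← tvar_eq,
      ← C_eq] at e ⊢
    rw [e, deltaPlus, emb]
  · rw [← PowerSeries.coeff_zero_eq_constantCoeff_apply, PowerSeries.coeff_map,
      PowerSeries.coeff_zero_eq_constantCoeff_apply, hD', map_one]

theorem xvar_ne_zero : xvar ≠ 0 :=
  (map_ne_zero_iff _ (IsFractionRing.injective (MvPolynomial (Fin 2) ℝ) Kxy)).2
    (MvPolynomial.X_ne_zero 0)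

theorem yvar_ne_zero : yvar ≠ 0 :=
  (map_ne_zero_iff _ (IsFractionRing.injective (MvPolynomial (Fin 2) ℝ) Kxy)).2
    (MvPolynomial.X_ne_zero 1)

theorem exists_isA (h : Params p q r p' r' q'' r'') {Z : ℝ⟦X⟧}
    (hZ : Z = 1 + PowerSeries.C (4 * p * q * r) * PowerSeries.X ^ 3 * Z ^ 3) :
    ∃ Rp Ap Rq Aq, IsA p q r Z Rp Ap ∧ IsA q p r Z Rq Aq ∧ (p = q → Ap = Aq) := by
  have hZ0 := constantCoeff_Z hZ
  have hp1 : p < 1 := by linarith [h.hq, h.hr, h.sum]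
  have hq1 : q < 1 := by linarith [h.hp, h.hr, h.sum]
  have hZ4 : Z = 1 + 4 * (PowerSeries.C p * PowerSeries.C q * PowerSeries.C r)
      * PowerSeries.X ^ 3 * Z ^ 3 := by
    nth_rewrite 1 [hZ]
    simp only [map_mul, map_ofNat]
    ring
  have hZ4' : Z = 1 + 4 * (PowerSeries.C q * PowerSeries.C p * PowerSeries.C r)
      * PowerSeries.X ^ 3 * Z ^ 3 := by
    nth_rewrite 1 [hZ4]
    ring
  obtain ⟨R, A, h1, h2, h3, h4⟩ := exists_A h.hp hp1 hZ4 hZ0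
  -- For p = q the same witnesses serve twice, so the two series are equal by construction.
  by_cases hpq : p = q
  · subst hpq
    exact ⟨R, A, R, A, ⟨h1, h2, h3, h4⟩, ⟨h1, h2, h3, h4⟩, fun _ => rfl⟩
  · obtain ⟨R', A', h1', h2', h3', h4'⟩ := exists_A h.hq hq1 hZ4' hZ0
    exact ⟨R, A, R', A', ⟨h1, h2, h3, h4⟩, ⟨h1', h2', h3', h4'⟩, fun e => absurd e hpq⟩

end Assembly

end QuadrantChain

theorem mainTheorem4 (p q r p' r' q'' r'' : ℝ)
    (hp : 0 < p) (hq : 0 < q) (hr : 0 < r) (hpqr : p + q + r = 1)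
    (hp' : 0 < p') (hr' : 0 < r') (hpr' : p' + r' = 1)
    (hq'' : 0 < q'') (hr'' : 0 < r'') (hqr'' : q'' + r'' = 1)
    (hα : p / r = p' / r') (hβ : q / r = q'' / r'') :
    -- `S(x, y)` is symmetric and algebraic
    (∀ a b : Kxy,
      Sser p q r p' r' q'' r'' a b = Sser p q r p' r' q'' r'' b a) ∧
    IsAlgSeries
      ![PowerSeries.X, PowerSeries.C xvar, PowerSeries.C yvar]
      (Sser p q r p' r' q'' r'' xvar yvar) ∧
    -- expression of `S(x, y)` in terms of `S(x, 0)` and `S(0, y)`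
    (let t := tvar Kxy
     let P := cst Kxy p
     let Q := cst Kxy q
     let R := cst Kxy r
     let x : Kxy⸨X⸩ := HahnSeries.C xvar
     let y : Kxy⸨X⸩ := HahnSeries.C yvar
     let S : Kxy → Kxy → Kxy⸨X⸩ :=
       fun a b => Sser p q r p' r' q'' r'' a b
     S xvar yvar =
       (Gexpr P Q R t x y + Gexpr P Q R t y x
          - (t - P * y) * (t - Q * y) * x * S xvar 0
          - (t - P * x) * (t - Q * x) * y * S 0 yvar) /
         (t * (x * y - t * (x + y + P * Q * R * x ^ 2 * y ^ 2)))) ∧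
    -- the coefficient of `x⁰y⁰` in `S(x, y)`
    Sser p q r p' r' q'' r'' (0 : ℝ) 0 =
      2 * PowerSeries.X ^ 2 * P00 ℝ p q r p' r' q'' r'' ∧
    IsAlgSeries ![PowerSeries.X]
      (Sser p q r p' r' q'' r'' (0 : ℝ) 0) ∧
    -- `P₀₀` is algebraic of degree 6 or 12
    IsAlgSeries ![PowerSeries.X] (P00 ℝ p q r p' r' q'' r'') ∧
    (p = q → algDegree (P00 ℝ p q r p' r' q'' r'') = 6) ∧
    (p ≠ q → algDegree (P00 ℝ p q r p' r' q'' r'') = 12) ∧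
    -- explicit expressions in terms of the unique power series `Z = 1 + 4pqrt³Z³`
    ∃ Z : ℝ⟦X⟧,
      (∀ W : ℝ⟦X⟧, W = 1 + PowerSeries.C (4 * p * q * r) * PowerSeries.X ^ 3 * W ^ 3 ↔ W = Z) ∧
      ∃ Rp Rq Apq Aqp : ℝ⟦X⟧,
        IsSqrtDeltaMinus p Z Rp ∧
        IsSqrtDeltaMinus q Z Rq ∧
        (Apq : ℝ⸨X⸩) = Aexpr (cst ℝ p) (cst ℝ q)
          (cst ℝ r) (tvar ℝ) (Z : ℝ⸨X⸩) (Rp : ℝ⸨X⸩) ∧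
        (Aqp : ℝ⸨X⸩) = Aexpr (cst ℝ q) (cst ℝ p)
          (cst ℝ r) (tvar ℝ) (Z : ℝ⸨X⸩) (Rq : ℝ⸨X⸩) ∧
        IsAlgSeries ![PowerSeries.X] Apq ∧
        IsAlgSeries ![PowerSeries.X] Aqp ∧
        PowerSeries.C (2 * p * q) * P00 ℝ p q r p' r' q'' r''
          + PowerSeries.C (r * (1 - r)) = Apq + Aqp ∧
        -- the expression of `S(a, 0)`, for `a = x` and more generally all `a` in `ℝ(x, y)`
        ∀ a : Kxy, ∃ D : Kxy⟦X⟧,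
          IsSqrtDeltaPlus p q r Z a D ∧
          (let t := tvar Kxy
           let P := cst Kxy p
           let Q := cst Kxy q
           let R := cst Kxy r
           let x : Kxy⸨X⸩ := HahnSeries.C a
           let z := emb Kxy Z
           let S : Kxy⸨X⸩ := Sser p q r p' r' q'' r'' a 0
           (t - (1 - P) * x + t ^ 2 * Q * R * x ^ 2) *
               (t - (1 - Q) * x + t ^ 2 * P * R * x ^ 2) * (S / t)
             + R * Hexpr P Q R t x / (2 * P * Q) =
           (2 * t * z - x) * (D : Kxy⸨X⸩) / (2 * P * Q * z) *
             (emb Kxy Apq * Fexpr P Q R t x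
               + emb Kxy Aqp * Fexpr Q P R t x)) := by
  have h := params_of_ratios hp hq hr hpqr hr' hpr' hr'' hqr'' hα hβ
  have hp1 : p < 1 := by linarith
  have hq1 : q < 1 := by linarith
  obtain ⟨Z, hZu⟩ := existsUnique_Z (4 * p * q * r)
  have hZ := (hZu Z).2 rfl
  obtain ⟨D, hD, hD'⟩ := exists_sqrtDeltaPlus (4 * p * q * r) Z
  obtain ⟨Rp, Ap, Rq, Aq, hAp, hAq, hpq⟩ := exists_isA h hZ
  have hP := P00_eq h hZ hD hD' hAp hAq hpq
  have hX : (PowerSeries.X : ℝ⟦X⟧) ∈ Algebra.adjoin ℝ (Set.range ![(PowerSeries.X : ℝ⟦X⟧)]) :=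
    Algebra.subset_adjoin ⟨0, rfl⟩
  have hAp' := map_A_mem_algOver hX h hZ hAp
  have hAq' := map_A_mem_algOver hX h hZ hAq
  rw [map_algebraMap_self] at hAp' hAq'
  have hP' : P00 ℝ p q r p' r' q'' r''
      ∈ algOver (Algebra.adjoin ℝ (Set.range ![(PowerSeries.X : ℝ⟦X⟧)])) := by
    have h0 : (PowerSeries.C (2 * p * q) : ℝ⟦X⟧) ≠ 0 :=
      (map_ne_zero_iff _ PowerSeries.C_injective).2 (by positivity)
    refine mem_algOver_of_mul h0 (algebraMap_mem_algOver (2 * p * q)) ?_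
    rw [eq_sub_of_add_eq hP]
    exact sub_mem (add_mem hAp' hAq') (algebraMap_mem_algOver (r * (1 - r)))
  refine ⟨fun a b => ?_, ?_, ?_, Sser_zero_zero h, ?_, isAlgSeries_of_isAlgebraic hP',
    fun e => algDegree_of_eq h hZ hAp hAq hP e (hpq e),
    algDegree_of_ne h hZ hAp hAq hP, Z, hZu, Rp, Rq, Ap, Aq, isSqrtDeltaMinus_of_isA hp1 hAp,
    isSqrtDeltaMinus_of_isA hq1 hAq, eq_Aexpr_of_isA h hZ hAp, eq_Aexpr_of_isA h hZ hAq,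
    isAlgSeries_of_isAlgebraic hAp', isAlgSeries_of_isAlgebraic hAq', hP, fun a =>
    ⟨_, isSqrtDeltaPlus_map hD hD' a, Sser_zero_eq h hZ hD hD' hAp hAq hpq a⟩⟩
  · rw [Sser_eq h, Sser_eq h, Sgen_comm]
  · apply isAlgSeries_of_isAlgebraic
    rw [Sser_eq h]
    set T := Algebra.adjoin ℝ (Set.range
      ![(PowerSeries.X : Kxy⟦X⟧), PowerSeries.C xvar, PowerSeries.C yvar])
    have m0 : (PowerSeries.X : Kxy⟦X⟧) ∈ T := Algebra.subset_adjoin ⟨0, rfl⟩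
    have m1 : (PowerSeries.C xvar : Kxy⟦X⟧) ∈ T := Algebra.subset_adjoin ⟨1, rfl⟩
    have m2 : (PowerSeries.C yvar : Kxy⟦X⟧) ∈ T := Algebra.subset_adjoin ⟨2, rfl⟩
    exact Sgen_mem_algOver m0 h xvar_ne_zero yvar_ne_zero m1 m2
      (tau_mem_algOver m0 h hZ hD hD' hAp hAq hpq m1)
      (tau_mem_algOver m0 h hZ hD hD' hAp hAq hpq m2)
  · exact Sser_eq_div h xvar_ne_zero yvar_ne_zero
  · apply isAlgSeries_of_isAlgebraic
    rw [Sser_zero_zero h]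
    exact mul_mem (mul_mem (ofNat_mem _ 2) (pow_mem (mem_algOver_of_mem hX) 2)) hP'
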